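/- **Conventions.** Let $M$ be a connected closed smooth $3$-manifold. A complex foliation $\mathcal F$ by Riemann surfaces on $M$ is given by smooth foliated charts into $\mathbb C\times\mathbb R$ whose coordinate changes have locally the form $(z,t)\mapsto(f(z,t),g(t))$ with $f$ holomorphic in $z$. Let $\phi$ be a smooth flow on $M$ with generating vector field $\dot\phi$. The triple $\mathfrak S=(M,\mathcal F,\phi)$ is an FDS$^3$ if every $\phi^t$ maps leaves to leaves and there are finitely many compact leaves, each invariant under all $\phi^t$, such that the orbits are transverse to the leaves off their union. Let $M_0$ be the complement of the non-transverse compact leaves and $\mathcal P_{\mathfrak S}$ the set of closed orbits in $M_0$. The canonical $1$-form $\omega_{\mathfrak S}$ is the unique smooth closed $1$-form on $M_0$ with $\omega_{\mathfrak S}|_{T\mathcal F}=0$ and $\omega_{\mathfrak S}(\dot\phi)=1$. Let $D\subset\mathbb C$ be the closed unit disc. The flow $\phi$ is *of contraction type* around $\gamma\in\mathcal P_{\mathfrak S}$, with tubular neighbourhood $V\cong D\times S^1$ of $\gamma=\{0\}\times S^1$ (the identification being smooth up to the boundary), if for all $t\ge 0$ and $p\in\gamma$ we have $\phi^t(D\times\{p\})\subset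 D\times\{\phi^t(p)\}$, and for all $t>0$ the induced map $\phi^t_{D,p}:D\to D$ is a contraction, i.e. it strictly decreases distances between distinct points, and the eigenvalues $\lambda_1,\lambda_2$ of its differential at every $z\in\mathrm{Int}(D)\setminus\{0\}$ satisfy $0<|\lambda_1|,|\lambda_2|<1$. A *horseshoe map* is an orientation-preserving smooth embedding $h:D\to\mathrm{Int}(D)$ of the following kind. $D$ is the disjoint union of a smoothly embedded closed square $Q\cong[0,1]^2$ and two caps $A,B$. In the coordinates of $Q$, there are two disjoint horizontal strips of full width in $Q$, away from its top and bottom sides, which $h$ maps affinely, contracting horizontally and expanding vertically, onto two disjoint vertical strips of full height in $Q$, away from its left and right sides, the first without and the second with a rotation by $\pi$. Moreover $h$ maps the rest of $Q$ out of $Q$, $h(A\cup B)\subset A$, and there is a fixed point $s\in A$ of $h$ to which $h^n(z)$ converges for every $z\in A$. **Lemma.** Let $\mathfrak S=(M,\mathcal F,\phi)$ be an FDS$^3$, let $\gamma\in\mathcal P_{\mathfrak S}$, let $\phi$ be of contraction type around $\gamma$ with tubular neighbourhood $V$, and let $h$ be a horseshoe map. Say that a smooth flow $\phi_{\gamma,h}$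 on $M$ is obtained from $\phi$ by *replacing $\phi|_{\mathrm{Int}(V)}$ by the suspension of $h$* if * its generating vector field equals $\dot\phi$ on $M\setminus\mathrm{Int}(V)$; * for all $t\ge0$ and $p\in\gamma$, $\phi_{\gamma,h}^t(\mathrm{Int}(D)\times\{p\})\subset\mathrm{Int}(D)\times\{\phi^t(p)\}$; * for some $p\in\gamma$, with $T$ the minimal period of $\gamma$, the first return map $\phi_{\gamma,h}^{T}:\mathrm{Int}(D)\times\{p\}\to\mathrm{Int}(D)\times\{p\}$ is conjugate to $h|_{\mathrm{Int}(D)}$ by a diffeomorphism of $\mathrm{Int}(D)$. Then such a flow exists, and for every such flow $\phi_{\gamma,h}$: 1. $\mathfrak S_{\gamma,h}=(M,\mathcal F,\phi_{\gamma,h})$ is an FDS$^3$; 2. the set of the closed orbits in $\mathcal P_{\mathfrak S_{\gamma,h}}$ that are contained in $\mathrm{Int}(V)$ is countably infinite; 3. $\mathfrak S$ and $\mathfrak S_{\gamma,h}$ have the same $M_0$ and the same canonical $1$-form, $\omega_{\mathfrak S_{\gamma,h}}=\omega_{\mathfrak S}$. -/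

import Mathlib

open scoped Manifold ContDiff Topology

noncomputable section

/-- A complex foliation by Riemann surfaces on a smooth `3`-manifold without boundary, given by an
atlas of smooth foliated charts with values in `ℂ × ℝ`. -/
structure ComplexFoliation (M : Type*) [TopologicalSpace M]
    [ChartedSpace (EuclideanSpace ℝ (Fin 3)) M] where
  /-- the foliated charts -/
  atlas : Set (OpenPartialHomeomorph M (ℂ × ℝ))
  cover : ∀ p : M, ∃ e ∈ atlas, p ∈ e.source
  smooth : ∀ e ∈ atlas, ContMDiffOn (𝓡 3) 𝓘(ℝ, ℂ × ℝ) ∞ e e.source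
  smooth_symm : ∀ e ∈ atlas, ContMDiffOn 𝓘(ℝ, ℂ × ℝ) (𝓡 3) ∞ e.symm e.target
  /-- the image of a chart is an open disc times an open interval -/
  target_eq : ∀ e ∈ atlas, ∃ (c : ℂ) (r a b : ℝ),
    e.target = Metric.ball c r ×ˢ Set.Ioo a b
  /-- the leaf component of a coordinate change is holomorphic along the leaves -/
  holomorphic : ∀ e ∈ atlas, ∀ e' ∈ atlas, ∀ (z : ℂ) (t : ℝ), (z, t) ∈ e.target →
    e.symm (z, t) ∈ e'.source → DifferentiableAt ℂ (fun w : ℂ => (e' (e.symm (w, t))).1) z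
  /-- the transverse component of a coordinate change does not depend on the leaf variable -/
  transversal : ∀ e ∈ atlas, ∀ e' ∈ atlas, ∀ (z : ℂ) (t : ℝ), (z, t) ∈ e.target →
    e.symm (z, t) ∈ e'.source →
    ∀ᶠ w in 𝓝 z, (e' (e.symm (w, t))).2 = (e' (e.symm (z, t))).2

section

variable {M : Type*} [TopologicalSpace M] [ChartedSpace (EuclideanSpace ℝ (Fin 3)) M]

/-- Two points lie in a common plaque. -/
def ComplexFoliation.SamePlaque (F : ComplexFoliation M) (p q : M) : Prop :=
  ∃ e ∈ F.atlas, p ∈ e.source ∧ q ∈ e.source ∧ (e p).2 = (e q).2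

/-- The leaf through `p`: all points that can be reached from `p` by a chain of plaques. -/
def ComplexFoliation.leaf (F : ComplexFoliation M) (p : M) : Set M :=
  {q | Relation.EqvGen F.SamePlaque p q}

/-- The tangent vector `v` at `p` is tangent to the leaf through `p`. -/
def ComplexFoliation.IsTangent (F : ComplexFoliation M) (p : M)
    (v : TangentSpace (𝓡 3) p) : Prop :=
  ∀ e ∈ F.atlas, p ∈ e.source →
    (show ℂ × ℝ from mfderiv (𝓡 3) 𝓘(ℝ, ℂ × ℝ) e p v).2 = 0

/-- Smoothness of a flow `ℝ × M → M`. -/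
def IsSmoothFlow (φ : Flow ℝ M) : Prop :=
  ContMDiff (𝓘(ℝ, ℝ).prod (𝓡 3)) (𝓡 3) ∞ (fun x : ℝ × M => φ x.1 x.2)

/-- The vector field that generates the flow. -/
def velocity (φ : Flow ℝ M) (p : M) : TangentSpace (𝓡 3) p :=
  mfderiv 𝓘(ℝ, ℝ) (𝓡 3) (fun t : ℝ => φ t p) 0 (1 : ℝ)

/-- `(M, F, φ)` is a `3`-dimensional foliated dynamical system (on a connected closed `M`). -/
structure IsFDS (F : ComplexFoliation M) (φ : Flow ℝ M) : Prop where
  smooth : IsSmoothFlow φ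
  /-- finitely many invariant compact leaves, off which the orbits are transverse to the leaves -/
  transverse : ∃ P : Set (Set M), P.Finite ∧
    (∀ L ∈ P, (∃ p, L = F.leaf p) ∧ IsCompact L ∧ ∀ t : ℝ, φ t '' L = L) ∧
    ∀ p, p ∉ ⋃₀ P → ¬ F.IsTangent p (velocity φ p)
  /-- every time-`t` map carries leaves to leaves -/
  leaf_to_leaf : ∀ (t : ℝ) (p : M), φ t '' F.leaf p = F.leaf (φ t p)

/-- The set of non-transverse compact leaves. -/
def nonTransverseLeaves (F : ComplexFoliation M) (φ : Flow ℝ M) : Set (Set M) :=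
  {L | (∃ p, L = F.leaf p) ∧ IsCompact L ∧ ∃ q ∈ L, F.IsTangent q (velocity φ q)}

/-- The region `M₀`: the complement of the non-transverse compact leaves. -/
def transverseRegion (F : ComplexFoliation M) (φ : Flow ℝ M) : Set M :=
  (⋃₀ nonTransverseLeaves F φ)ᶜ

/-- The closed orbits in `M₀`, as subsets of `M`. (The flow has no rest point in `M₀`.) -/
def closedOrbits (F : ComplexFoliation M) (φ : Flow ℝ M) : Set (Set M) :=
  {γ | ∃ p ∈ transverseRegion F φ, (∃ T : ℝ, 0 < T ∧ φ T p = p) ∧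
    γ = Set.range (fun t : ℝ => φ t p)}

/-- The coefficients of the `1`-form `η` in the chart of `M` around `x`. -/
def formInChart (η : ∀ p : M, TangentSpace (𝓡 3) p →L[ℝ] ℝ) (x : M)
    (y : EuclideanSpace ℝ (Fin 3)) : EuclideanSpace ℝ (Fin 3) →L[ℝ] ℝ :=
  (η ((chartAt (EuclideanSpace ℝ (Fin 3)) x).symm y)).comp
    (mfderiv 𝓘(ℝ, EuclideanSpace ℝ (Fin 3)) (𝓡 3)
      (chartAt (EuclideanSpace ℝ (Fin 3)) x).symm y)

/-- The part of the image of the chart around `x` that corresponds to points of `S`. -/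
def chartDomain (S : Set M) (x : M) : Set (EuclideanSpace ℝ (Fin 3)) :=
  (chartAt (EuclideanSpace ℝ (Fin 3)) x).target ∩
    (chartAt (EuclideanSpace ℝ (Fin 3)) x).symm ⁻¹' S

/-- `η` restricts to the canonical `1`-form on `M₀`: it is smooth and closed there, vanishes on
vectors tangent to the leaves, and is `1` on the generating vector field. Its values off `M₀` are
irrelevant. -/
structure IsCanonicalForm (F : ComplexFoliation M) (φ : Flow ℝ M)
    (η : ∀ p : M, TangentSpace (𝓡 3) p →L[ℝ] ℝ) : Prop where
  smooth : ∀ x, ContDiffOn ℝ ∞ (formInChart η x) (chartDomain (transverseRegion F φ) x)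
  /-- `dη = 0`: the matrix of partial derivatives of the coefficients is symmetric -/
  closed : ∀ x, ∀ y ∈ chartDomain (transverseRegion F φ) x,
    ∀ u v : EuclideanSpace ℝ (Fin 3),
      fderiv ℝ (formInChart η x) y u v = fderiv ℝ (formInChart η x) y v u
  tangent : ∀ p ∈ transverseRegion F φ, ∀ v, F.IsTangent p v → η p v = 0
  velocity : ∀ p ∈ transverseRegion F φ, η p (velocity φ p) = 1

/-- For tube coordinates `τ (z, θ)`: the `S¹`-coordinate of the point of the core to which the time
`t` map carries the point `τ (0, θ)` of the core. -/
def phase (φ : Flow ℝ M) (τ : OpenPartialHomeomorph (ℂ × Circle) M) (t : ℝ) (θ : Circle) :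
    Circle :=
  (τ.symm (φ t (τ (0, θ)))).2

/-- The disc component of the time `t` map on the disc over `θ`, in tube coordinates. -/
def sliceMap (φ : Flow ℝ M) (τ : OpenPartialHomeomorph (ℂ × Circle) M) (t : ℝ) (θ : Circle)
    (z : ℂ) : ℂ :=
  (τ.symm (φ t (τ (z, θ)))).1

/-- `τ` restricts to a diffeomorphism of `D × S¹` (`D` the closed unit disc) onto a tubular
neighbourhood `V` of `γ`, with `γ` as its core, that exhibits the flow as of contraction type
around `γ`: for positive times each disc `D × {θ}` is carried into a disc, by a contraction map
whose differentials have eigenvalues of absolute value in `(0, 1)` off the core. -/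
structure IsContractionTube (φ : Flow ℝ M) (γ : Set M)
    (τ : OpenPartialHomeomorph (ℂ × Circle) M) : Prop where
  subset_source : Metric.closedBall (0 : ℂ) 1 ×ˢ (Set.univ : Set Circle) ⊆ τ.source
  smooth : ContMDiffOn (𝓘(ℝ, ℂ).prod (𝓡 1)) (𝓡 3) ∞ τ τ.source
  smooth_symm : ContMDiffOn (𝓡 3) (𝓘(ℝ, ℂ).prod (𝓡 1)) ∞ τ.symm τ.target
  core : γ = τ '' ({(0 : ℂ)} ×ˢ (Set.univ : Set Circle))
  mapsTo : ∀ t : ℝ, 0 ≤ t → ∀ θ : Circle, ∀ z ∈ Metric.closedBall (0 : ℂ) 1,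
    ∃ z' ∈ Metric.closedBall (0 : ℂ) 1, φ t (τ (z, θ)) = τ (z', phase φ τ t θ)
  contraction : ∀ t : ℝ, 0 < t → ∀ θ : Circle, ∀ z ∈ Metric.closedBall (0 : ℂ) 1,
    ∀ w ∈ Metric.closedBall (0 : ℂ) 1, z ≠ w →
      dist (sliceMap φ τ t θ z) (sliceMap φ τ t θ w) < dist z w
  eigenvalue : ∀ t : ℝ, 0 < t → ∀ θ : Circle, ∀ z ∈ Metric.ball (0 : ℂ) 1, z ≠ 0 →
    ∀ μ : ℂ, Polynomial.aeval μ
        (LinearMap.charpoly (fderiv ℝ (sliceMap φ τ t θ) z : ℂ →ₗ[ℝ] ℂ)) = 0 →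
      0 < ‖μ‖ ∧ ‖μ‖ < 1

/-- The open tube `Int V`. -/
def openTube (τ : OpenPartialHomeomorph (ℂ × Circle) M) : Set M :=
  τ '' (Metric.ball (0 : ℂ) 1 ×ˢ (Set.univ : Set Circle))

/-- `φ'` arises from `φ` by replacing the flow on the open tube by the suspension of
`h : Int D → Int D`: the generating fields agree off the open tube; in the tube, `φ'` carries discs
into discs for nonnegative times, with the phase of `φ`; and the first return map to one of the open
discs is `h`, up to a smooth change `c` of coordinates on that disc. As `h` need not be onto, an
orbit of `φ'` may enter the tube from outside, and the return maps are diffeomorphisms onto their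
images. -/
structure IsSuspensionReplacement (φ : Flow ℝ M) (τ : OpenPartialHomeomorph (ℂ × Circle) M)
    (h : ℂ → ℂ) (φ' : Flow ℝ M) : Prop where
  smooth : IsSmoothFlow φ'
  outside : ∀ p ∉ openTube τ, velocity φ' p = velocity φ p
  slices : ∀ t : ℝ, 0 ≤ t → ∀ θ : Circle, ∀ z ∈ Metric.ball (0 : ℂ) 1,
    ∃ z' ∈ Metric.ball (0 : ℂ) 1, φ' t (τ (z, θ)) = τ (z', phase φ τ t θ)
  firstReturn : ∃ (θ : Circle) (T : ℝ) (c : OpenPartialHomeomorph ℂ ℂ),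
    0 < T ∧ phase φ τ T θ = θ ∧ (∀ t ∈ Set.Ioo 0 T, phase φ τ t θ ≠ θ) ∧
    c.source = Metric.ball 0 1 ∧ c.target = Metric.ball 0 1 ∧
    ContDiffOn ℝ ∞ c (Metric.ball 0 1) ∧ ContDiffOn ℝ ∞ c.symm (Metric.ball 0 1) ∧
    ∀ z ∈ Metric.ball (0 : ℂ) 1, φ' T (τ (c z, θ)) = τ (c (h z), θ)

end

/-- The unit square. -/
def unitSquare : Set (ℝ × ℝ) := Set.Icc 0 1 ×ˢ Set.Icc 0 1

/-- `h` restricts to Smale's horseshoe diffeomorphism of the unit disc `D` (a diffeomorphism onto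
its image). `D` consists of a square `Q = κ ([0,1]²)` and two caps `A`, `B`. Two horizontal strips
of `Q` are mapped affinely, with contraction `a` in the horizontal and expansion `b` in the vertical
direction, onto two vertical strips that cross `Q`, the second one after a half turn. The rest of
`Q` leaves `Q`, and both caps are mapped into the cap `A`, where there is an attracting fixed
point. -/
structure IsHorseshoe (h : ℂ → ℂ) : Prop where
  smooth : ContDiff ℝ ∞ h
  injOn : Set.InjOn h (Metric.closedBall 0 1)
  mapsTo : Set.MapsTo h (Metric.closedBall 0 1) (Metric.ball 0 1)
  orientation : ∀ z ∈ Metric.closedBall (0 : ℂ) 1, 0 < (fderiv ℝ h z).det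
  horseshoe : ∃ (κ : ℝ × ℝ → ℂ) (A B : Set ℂ) (s : ℂ) (a b x₀ x₁ y₀ y₁ : ℝ),
    ContDiff ℝ ∞ κ ∧ Set.InjOn κ unitSquare ∧
    (∀ q ∈ unitSquare, Function.Bijective (fderiv ℝ κ q)) ∧
    Set.MapsTo κ unitSquare (Metric.closedBall 0 1) ∧
    Metric.closedBall 0 1 \ κ '' unitSquare = A ∪ B ∧ Disjoint A B ∧
    0 < a ∧ 0 < b ∧
    0 < y₀ ∧ y₀ + b⁻¹ < y₁ ∧ y₁ + b⁻¹ < 1 ∧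
    0 < x₀ ∧ x₀ + a < 1 ∧ 0 < x₁ ∧ x₁ + a < 1 ∧ (x₀ + a < x₁ ∨ x₁ + a < x₀) ∧
    (∀ x ∈ Set.Icc (0 : ℝ) 1, ∀ y ∈ Set.Icc y₀ (y₀ + b⁻¹),
      h (κ (x, y)) = κ (x₀ + a * x, b * (y - y₀))) ∧
    (∀ x ∈ Set.Icc (0 : ℝ) 1, ∀ y ∈ Set.Icc y₁ (y₁ + b⁻¹),
      h (κ (x, y)) = κ (x₁ + a * (1 - x), 1 - b * (y - y₁))) ∧
    (∀ q ∈ unitSquare, q.2 ∉ Set.Icc y₀ (y₀ + b⁻¹) → q.2 ∉ Set.Icc y₁ (y₁ + b⁻¹) →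
      h (κ q) ∉ κ '' unitSquare) ∧
    Set.MapsTo h (A ∪ B) A ∧
    s ∈ A ∧ h s = s ∧ ∀ z ∈ A, Filter.Tendsto (fun n : ℕ => h^[n] z) Filter.atTop (𝓝 s)

end

noncomputable section

open Set Filter Metric

/-! The key quantity is the transverse speed. In a foliated chart `(z, ξ)` a leaf-preserving flow
moves the height `ξ` at a speed `a ξ` independent of `z`: since `M` is compact, a leaf meets a chart
in countably many heights, so the height is constant on the connected image of a small plaque
(`exists_flowBox`, `exists_transverseSpeed`). A second smooth flow with the same transverse speed
solves the same equation `ξ' = a ξ`, so at each time it moves a point into the leaf to which the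
first flow moves it (`flow_mem_leaf_flow`). Hence it preserves the foliation, is tangent to the
leaves at the same points, and has the same canonical form, locally `dξ / a ξ`. This yields (1) and
(3) once the speeds are known to agree.

Off the open tube the velocities agree by assumption. Inside, both flows carry discs to discs with
the same phase, so it is enough that the discs are tangent to the leaves. The return map of `φ`
preserves heights near the core, because it fixes the points of the core and their heights fill an
interval; iterating it pushes a disc towards its centre, so the height on the disc is that of the
centre (`eventually_height_tube`).

For (2), closed orbits in the tube correspond to periodic orbits of `h`. There are infinitely many:
for every `n` there is a point of period `n + 1` that visits the first strip `n` times and then the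
second. There are countably many: a periodic point other than `s` stays in the square, and among
points fixed by `h^[k]` it is determined by its itinerary of length `k` (`infinite_discPeriodicPts`,
`countable_discPeriodicPts`).

For existence, the return map `R` of `φ` and the horseshoe `h` are both orientation-preserving
embeddings of the closed disc into its interior. Any two of these differ by an ambient isotopy `G`
with compact support in the open disc, `h = G₁ ∘ R` (`IsDiscEmbedding.isotopic`). Performing `G`
while the orbits cross part of the tube changes the return map to `R ∘ G₁`, which `G₁` conjugates to
`h` (`exists_flow_of_discIsotopy`). -/

/-! ### Leaves meet charts in countably many heights. -/

theorem countable_image_of_eventually_eq {X Y : Type*} [TopologicalSpace X]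
    [TopologicalSpace.SeparableSpace X] {S : Set X} (hS : IsOpen S) {f : X → Y}
    (hf : ∀ z ∈ S, ∀ᶠ w in 𝓝 z, f w = f z) : (f '' S).Countable := by
  -- The fibres are disjoint nonempty open sets, and a separable space has only countably many of
  -- these.
  refine Set.PairwiseDisjoint.countable_of_isOpen (s := fun v => S ∩ f ⁻¹' {v}) ?_ ?_ ?_
  · rintro v - v' - hv
    refine Set.disjoint_left.2 ?_
    rintro x ⟨-, hx⟩ ⟨-, hx'⟩
    exact hv (hx.symm.trans hx')
  · rintro v -
    rw [isOpen_iff_mem_nhds]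
    rintro z ⟨hz, rfl⟩
    filter_upwards [hS.mem_nhds hz, hf z hz] with w h1 h2
    exact ⟨h1, h2⟩
  · rintro v ⟨z, hz, rfl⟩
    exact ⟨z, hz, rfl⟩

theorem IsPreconnected.subsingleton_of_countable {s : Set ℝ} (hs : IsPreconnected s)
    (hc : s.Countable) : s.Subsingleton := by
  have key : ∀ a ∈ s, ∀ b ∈ s, ¬ a < b := by
    intro a ha b hb hab
    obtain ⟨x, hx, hx'⟩ := (hc.dense_compl ℝ).exists_mem_open isOpen_Ioo (nonempty_Ioo.2 hab)
    exact hx (hs.Icc_subset ha hb (Ioo_subset_Icc_self hx'))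
  intro a ha b hb
  exact le_antisymm (not_lt.1 (key b hb a ha)) (not_lt.1 (key a ha b hb))

namespace ComplexFoliation

variable {M : Type*} [TopologicalSpace M] [ChartedSpace (EuclideanSpace ℝ (Fin 3)) M]
  (F : ComplexFoliation M)

/-- The plaque at height `ξ` of the chart `e`. -/
def plaque (e : OpenPartialHomeomorph M (ℂ × ℝ)) (ξ : ℝ) : Set M :=
  {q | q ∈ e.source ∧ (e q).2 = ξ}

variable {F}

theorem leaf_eq_of_mem {p q : M} (h : q ∈ F.leaf p) : F.leaf q = F.leaf p := by
  ext x
  exact ⟨fun hx => Relation.EqvGen.trans _ _ _ h hx,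
    fun hx => Relation.EqvGen.trans _ _ _ (Relation.EqvGen.symm _ _ h) hx⟩

theorem mem_leaf_self (p : M) : p ∈ F.leaf p := Relation.EqvGen.refl _

theorem SamePlaque.symm {p q : M} (h : F.SamePlaque p q) : F.SamePlaque q p := by
  obtain ⟨e, he, hp, hq, h⟩ := h
  exact ⟨e, he, hq, hp, h.symm⟩

theorem SamePlaque.mem_leaf {p q : M} (h : F.SamePlaque p q) : q ∈ F.leaf p :=
  Relation.EqvGen.rel _ _ h

theorem eventually_transverse_eq {e e' : OpenPartialHomeomorph M (ℂ × ℝ)} (he : e ∈ F.atlas)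
    (he' : e' ∈ F.atlas) {z : ℂ} {ξ : ℝ} (h : (z, ξ) ∈ e.target)
    (h' : e.symm (z, ξ) ∈ e'.source) :
    ∀ᶠ w in 𝓝 z, (w, ξ) ∈ e.target ∧ e.symm (w, ξ) ∈ e'.source ∧
      (e' (e.symm (w, ξ))).2 = (e' (e.symm (z, ξ))).2 := by
  have hc : ContinuousAt (fun w : ℂ => (w, ξ)) z := by fun_prop
  have hc' : ContinuousAt (fun w : ℂ => e.symm (w, ξ)) z :=
    ContinuousAt.comp (g := e.symm) (f := fun w : ℂ => (w, ξ)) (e.symm.continuousAt h) hc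
  filter_upwards [hc (e.open_target.mem_nhds h), hc' (e'.open_source.mem_nhds h'),
    F.transversal e he e' he' z ξ h h'] with w h1 h2 h3
  exact ⟨h1, h2, h3⟩

/-- In a plaque of `e`, seen as an open part of `ℂ`, the height of `e'` is locally constant. -/
theorem countable_transverse_plaque {e e' : OpenPartialHomeomorph M (ℂ × ℝ)} (he : e ∈ F.atlas)
    (he' : e' ∈ F.atlas) (ξ : ℝ) :
    ((fun q => (e' q).2) '' (plaque e ξ ∩ e'.source)).Countable := by
  let S : Set ℂ := {z | (z, ξ) ∈ e.target ∧ e.symm (z, ξ) ∈ e'.source}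
  have hS : IsOpen S := by
    rw [isOpen_iff_mem_nhds]
    rintro z ⟨h, h'⟩
    filter_upwards [eventually_transverse_eq he he' h h'] with w hw
    exact ⟨hw.1, hw.2.1⟩
  refine (countable_image_of_eventually_eq hS (f := fun z => (e' (e.symm (z, ξ))).2) ?_).mono ?_
  · rintro z ⟨h, h'⟩
    filter_upwards [eventually_transverse_eq he he' h h'] with w hw
    exact hw.2.2
  · rintro _ ⟨q, ⟨⟨hq, rfl⟩, hq'⟩, rfl⟩
    have : e.symm ((e q).1, (e q).2) = q := e.left_inv hq
    refine ⟨(e q).1, ⟨e.map_source hq, ?_⟩, ?_⟩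
    · rw [this]; exact hq'
    · simp only [this]

/-- Finitely many charts cover `M`. Starting from the plaques through `p` in these charts, all
plaques of the finite family that meet one already found are added, again and again; each round adds
only countably many. The union `A` of the result is saturated, hence contains the leaf. -/
theorem exists_countable_plaques_cover [CompactSpace M] (F : ComplexFoliation M) (p : M) :
    ∃ N : Set (OpenPartialHomeomorph M (ℂ × ℝ) × ℝ), N.Countable ∧ (∀ n ∈ N, n.1 ∈ F.atlas) ∧
      F.leaf p ⊆ ⋃ n ∈ N, plaque n.1 n.2 := by
  classical
  choose c hc hpc using F.cover
  obtain ⟨t, ht⟩ := isCompact_univ.elim_finite_subcover (fun q : M => (c q).source)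
    (fun q => (c q).open_source) (fun q _ => mem_iUnion.2 ⟨q, hpc q⟩)
  let C : Set (OpenPartialHomeomorph M (ℂ × ℝ)) := c '' (t : Set M)
  have hCc : C.Countable := (t.countable_toSet).image c
  have hCa : ∀ e ∈ C, e ∈ F.atlas := by rintro _ ⟨q, -, rfl⟩; exact hc q
  have hCov : ∀ q : M, ∃ e ∈ C, q ∈ e.source := by
    intro q
    obtain ⟨i, hi, hq⟩ := mem_iUnion₂.1 (ht (mem_univ q))
    exact ⟨c i, ⟨i, hi, rfl⟩, hq⟩
  let step : Set (OpenPartialHomeomorph M (ℂ × ℝ) × ℝ) →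
      Set (OpenPartialHomeomorph M (ℂ × ℝ) × ℝ) := fun N =>
    ⋃ n ∈ N, ⋃ e' ∈ C, (Prod.mk e') '' ((fun q => (e' q).2) '' (plaque n.1 n.2 ∩ e'.source))
  let N₀ : Set (OpenPartialHomeomorph M (ℂ × ℝ) × ℝ) := (fun e => (e, (e p).2)) '' C
  let N : ℕ → Set (OpenPartialHomeomorph M (ℂ × ℝ) × ℝ) := fun k => step^[k] N₀
  have hN : ∀ k, (N k).Countable ∧ ∀ n ∈ N k, n.1 ∈ C := by
    intro k
    induction k with
    | zero =>
      refine ⟨hCc.image _, ?_⟩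
      rintro _ ⟨e, he, rfl⟩
      exact he
    | succ k ih =>
      have hk : N (k + 1) = step (N k) := Function.iterate_succ_apply' step k N₀
      rw [hk]
      refine ⟨ih.1.biUnion fun n hn => hCc.biUnion fun e' he' =>
        (countable_transverse_plaque (hCa _ (ih.2 n hn)) (hCa _ he') n.2).image _, ?_⟩
      intro m hm
      simp only [step, mem_iUnion] at hm
      obtain ⟨n, hn, e', he', _, -, rfl⟩ := hm
      exact he'
  have hclosed : ∀ n ∈ ⋃ k, N k, ∀ e' ∈ C, ∀ q ∈ plaque n.1 n.2, q ∈ e'.source →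
      (e', (e' q).2) ∈ ⋃ k, N k := by
    intro n hn e' he' q hq hq'
    obtain ⟨k, hk⟩ := mem_iUnion.1 hn
    refine mem_iUnion.2 ⟨k + 1, ?_⟩
    have hk1 : N (k + 1) = step (N k) := Function.iterate_succ_apply' step k N₀
    rw [hk1]
    exact mem_iUnion₂.2 ⟨n, hk, mem_iUnion₂.2 ⟨e', he', _, ⟨q, ⟨hq, hq'⟩, rfl⟩, rfl⟩⟩
  let A : Set M := ⋃ n ∈ ⋃ k, N k, plaque n.1 n.2
  have hA : ∀ e ∈ C, ∀ q ∈ e.source, q ∈ A ↔ (e, (e q).2) ∈ ⋃ k, N k := by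
    intro e he q hq
    constructor
    · intro h
      obtain ⟨n, hn, hqn⟩ := mem_iUnion₂.1 h
      exact hclosed n hn e he q hqn hq
    · intro h
      exact mem_iUnion₂.2 ⟨_, h, hq, rfl⟩
  -- The chart `e` of this plaque need not belong to the finite family `C`. Membership in `A` is
  -- locally constant along the plaque, since near each point it can be read off the height of a
  -- chart in `C`; the plaque is connected.
  have hplaque : ∀ x y, F.SamePlaque x y → (x ∈ A → y ∈ A) := by
    rintro x y ⟨e, he, hx, hy, hxy⟩
    obtain ⟨c₀, r, a, b, htar⟩ := F.target_eq e he
    have hmem : ∀ q ∈ e.source, (e q).1 ∈ ball c₀ r ∧ (e q).2 ∈ Ioo a b := by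
      intro q hq
      have := e.map_source hq
      rw [htar] at this
      exact this
    set ξ := (e x).2 with hξ
    have hxi : ξ ∈ Ioo a b := (hmem x hx).2
    have key := (convex_ball c₀ r).isPreconnected.induction₂'
      (fun z w => e.symm (z, ξ) ∈ A → e.symm (w, ξ) ∈ A) ?_
      (fun _ _ _ _ _ _ h1 h2 h => h2 (h1 h)) (hmem x hx).1 (hmem y hy).1
    · have h1 : e.symm ((e x).1, ξ) = x := e.left_inv hx
      have h2 : e.symm ((e y).1, ξ) = y := by rw [hxy]; exact e.left_inv hy
      rw [h1, h2] at key
      exact key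
    · intro z hz
      have hzt : (z, ξ) ∈ e.target := by rw [htar]; exact ⟨hz, hxi⟩
      obtain ⟨e', he', hz'⟩ := hCov (e.symm (z, ξ))
      refine eventually_nhdsWithin_of_eventually_nhds ?_
      filter_upwards [eventually_transverse_eq he (hCa _ he') hzt hz'] with w hw
      have h1 := hA e' he' _ hz'
      have h2 := hA e' he' _ hw.2.1
      rw [hw.2.2] at h2
      exact ⟨fun h => h2.2 (h1.1 h), fun h => h1.2 (h2.1 h)⟩
  refine ⟨⋃ k, N k, countable_iUnion fun k => (hN k).1, ?_, ?_⟩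
  · intro n hn
    obtain ⟨k, hk⟩ := mem_iUnion.1 hn
    exact hCa _ ((hN k).2 n hk)
  · have hp : p ∈ A := by
      obtain ⟨e, he, hp⟩ := hCov p
      exact (hA e he p hp).2 (mem_iUnion.2 ⟨0, e, he, rfl⟩)
    have : ∀ x y, Relation.EqvGen F.SamePlaque x y → (x ∈ A ↔ y ∈ A) := by
      intro x y h
      induction h with
      | rel x y h => exact ⟨hplaque x y h, hplaque y x h.symm⟩
      | refl x => exact Iff.rfl
      | symm x y _ ih => exact ih.symm
      | trans x y z _ _ h1 h2 => exact h1.trans h2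
    intro q hq
    exact (this p q hq).1 hp

theorem countable_transverse_leaf [CompactSpace M] (F : ComplexFoliation M) (p : M)
    {e : OpenPartialHomeomorph M (ℂ × ℝ)} (he : e ∈ F.atlas) :
    ((fun q => (e q).2) '' (F.leaf p ∩ e.source)).Countable := by
  obtain ⟨N, hN, hNa, hcov⟩ := exists_countable_plaques_cover F p
  refine (hN.biUnion fun n hn => countable_transverse_plaque (hNa n hn) he n.2).mono ?_
  rintro _ ⟨q, ⟨hq, hqe⟩, rfl⟩
  obtain ⟨n, hn, hqn⟩ := mem_iUnion₂.1 (hcov hq)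
  exact mem_iUnion₂.2 ⟨n, hn, q, ⟨hqn, hqe⟩, rfl⟩

/-- A leaf-preserving flow maps small plaques into plaques. -/
theorem exists_flowBox [CompactSpace M] {φ : Flow ℝ M}
    (hφ : ∀ (t : ℝ) (p : M), φ t '' F.leaf p = F.leaf (φ t p))
    {e e' : OpenPartialHomeomorph M (ℂ × ℝ)} (he : e ∈ F.atlas) (he' : e' ∈ F.atlas)
    {p : M} {t₀ : ℝ} (hp : p ∈ e.source) (hp' : φ t₀ p ∈ e'.source) :
    ∃ r > 0, ∀ z ∈ ball (e p).1 r, ∀ ξ ∈ ball (e p).2 r, ∀ t ∈ ball t₀ r,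
      (z, ξ) ∈ e.target ∧ φ t (e.symm (z, ξ)) ∈ e'.source ∧
      (e' (φ t (e.symm (z, ξ)))).2 = (e' (φ t (e.symm ((e p).1, ξ)))).2 := by
  have hcont : ContinuousAt (fun x : (ℂ × ℝ) × ℝ => φ x.2 (e.symm x.1)) (e p, t₀) := by
    have h1 : ContinuousAt (fun x : (ℂ × ℝ) × ℝ => (x.2, e.symm x.1)) (e p, t₀) := by
      refine ContinuousAt.prodMk continuousAt_snd ?_
      exact ContinuousAt.comp (g := e.symm) (e.symm.continuousAt (e.map_source hp))
        continuousAt_fst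
    exact ContinuousAt.comp (g := fun x : ℝ × M => φ x.1 x.2) φ.cont'.continuousAt h1
  have hmem : ∀ᶠ x : (ℂ × ℝ) × ℝ in 𝓝 (e p, t₀),
      x.1 ∈ e.target ∧ φ x.2 (e.symm x.1) ∈ e'.source := by
    refine (continuousAt_fst.eventually (e.open_target.mem_nhds (e.map_source hp))).and ?_
    refine hcont.eventually (e'.open_source.mem_nhds ?_)
    simpa [e.left_inv hp] using hp'
  obtain ⟨r, hr, hball⟩ := Metric.eventually_nhds_iff_ball.1 hmem
  have hin : ∀ z ∈ ball (e p).1 r, ∀ ξ ∈ ball (e p).2 r, ∀ t ∈ ball t₀ r,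
      (z, ξ) ∈ e.target ∧ φ t (e.symm (z, ξ)) ∈ e'.source := by
    intro z hz ξ hξ t ht
    refine hball ((z, ξ), t) ?_
    rw [← ball_prod_same]
    refine ⟨?_, ht⟩
    show (z, ξ) ∈ ball ((e p).1, (e p).2) r
    rw [← ball_prod_same]
    exact ⟨hz, hξ⟩
  refine ⟨r, hr, fun z hz ξ hξ t ht => ⟨(hin z hz ξ hξ t ht).1, (hin z hz ξ hξ t ht).2, ?_⟩⟩
  have hz0 : (e p).1 ∈ ball (e p).1 r := mem_ball_self hr
  set g : ℂ → ℝ := fun w => (e' (φ t (e.symm (w, ξ)))).2 with hg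
  have hgc : ContinuousOn g (ball (e p).1 r) := by
    intro w hw
    obtain ⟨h1, h2⟩ := hin w hw ξ hξ t ht
    have c1 : ContinuousAt (fun w : ℂ => e.symm (w, ξ)) w :=
      ContinuousAt.comp (g := e.symm) (f := fun w : ℂ => (w, ξ)) (e.symm.continuousAt h1)
        (by fun_prop)
    have c2 : ContinuousAt (fun w : ℂ => φ t (e.symm (w, ξ))) w :=
      ContinuousAt.comp (g := φ t) (f := fun w : ℂ => e.symm (w, ξ))
        (φ.continuous continuous_const continuous_id).continuousAt c1
    have c3 : ContinuousAt (fun w : ℂ => e' (φ t (e.symm (w, ξ)))) w :=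
      ContinuousAt.comp (g := e') (f := fun w : ℂ => φ t (e.symm (w, ξ)))
        (e'.continuousAt h2) c2
    exact (continuousAt_snd.comp c3).continuousWithinAt
  -- The heights over the ball form a connected set, and they are heights of a single leaf, hence
  -- countable in number: only one value occurs.
  have hpre := (convex_ball (e p).1 r).isPreconnected.image g hgc
  have hct : (g '' ball (e p).1 r).Countable := by
    refine (countable_transverse_leaf F (φ t (e.symm ((e p).1, ξ))) he').mono ?_
    rintro _ ⟨w, hw, rfl⟩
    refine ⟨φ t (e.symm (w, ξ)), ⟨?_, (hin w hw ξ hξ t ht).2⟩, rfl⟩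
    rw [← hφ]
    refine ⟨_, SamePlaque.mem_leaf ?_, rfl⟩
    have h0 := (hin _ hz0 ξ hξ t ht).1
    have h1 := (hin w hw ξ hξ t ht).1
    refine ⟨e, he, e.map_target h0, e.map_target h1, ?_⟩
    rw [e.right_inv h0, e.right_inv h1]
  exact hpre.subsingleton_of_countable hct ⟨z, hz, rfl⟩ ⟨_, hz0, rfl⟩

end ComplexFoliation

/-! ### The transverse speed of a leaf-preserving flow. -/

section

variable {M : Type*} [TopologicalSpace M] [ChartedSpace (EuclideanSpace ℝ (Fin 3)) M]

/-- The differential of a real function. -/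
def realDeriv (X : M → ℝ) (p : M) : TangentSpace (𝓡 3) p →L[ℝ] ℝ :=
  mfderiv (𝓡 3) 𝓘(ℝ, ℝ) X p

/-- The differential of the transverse coordinate of a chart. -/
def heightDeriv (e : OpenPartialHomeomorph M (ℂ × ℝ)) (p : M) :
    TangentSpace (𝓡 3) p →L[ℝ] ℝ :=
  realDeriv (fun q => (e q).2) p

theorem IsSmoothFlow.contMDiff_curve {φ : Flow ℝ M} (hφ : IsSmoothFlow φ) (p : M) :
    ContMDiff 𝓘(ℝ, ℝ) (𝓡 3) ∞ (fun t : ℝ => φ t p) := by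
  have h : ContMDiff 𝓘(ℝ, ℝ) (𝓘(ℝ, ℝ).prod (𝓡 3)) ∞ (fun t : ℝ => (t, p)) :=
    contMDiff_id.prodMk contMDiff_const
  exact ContMDiff.comp (I' := 𝓘(ℝ, ℝ).prod (𝓡 3)) (g := fun x : ℝ × M => φ x.1 x.2) hφ h

theorem IsSmoothFlow.hasDerivAt_comp {φ : Flow ℝ M} (hφ : IsSmoothFlow φ) {X : M → ℝ} {t : ℝ}
    {q : M} (hX : MDifferentiableAt (𝓡 3) 𝓘(ℝ, ℝ) X (φ t q)) :
    HasDerivAt (fun s => X (φ s q)) (realDeriv X (φ t q) (velocity φ (φ t q))) t := by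
  have h0 : HasDerivAt (fun s => X (φ s (φ t q)))
      (realDeriv X (φ t q) (velocity φ (φ t q))) (t - t) := by
    rw [sub_self]
    have hc : MDifferentiableAt 𝓘(ℝ, ℝ) (𝓡 3) (fun s : ℝ => φ s (φ t q)) 0 :=
      (hφ.contMDiff_curve (φ t q)).mdifferentiableAt (by simp)
    have hX' : ∀ p', p' = φ t q → HasMFDerivAt (𝓡 3) 𝓘(ℝ, ℝ) X p'
        (realDeriv X (φ t q) : EuclideanSpace ℝ (Fin 3) →L[ℝ] ℝ) := by
      rintro _ rfl
      exact hX.hasMFDerivAt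
    have h : HasFDerivAt (fun s => X (φ s (φ t q)))
        ((realDeriv X (φ t q) : EuclideanSpace ℝ (Fin 3) →L[ℝ] ℝ).comp
          (mfderiv 𝓘(ℝ, ℝ) (𝓡 3) (fun s : ℝ => φ s (φ t q)) 0 :
            ℝ →L[ℝ] EuclideanSpace ℝ (Fin 3))) 0 := (HasMFDerivAt.comp (f := fun s : ℝ => φ s (φ t q)) (0 : ℝ)
      (hX' _ (φ.map_zero_apply _)) hc.hasMFDerivAt).hasFDerivAt
    exact h.hasDerivAt
  have h1 := h0.comp_sub_const t t
  have h2 : (fun s => X (φ s q)) = fun s => X (φ (s - t) (φ t q)) := by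
    funext s
    rw [← φ.map_add, sub_add_cancel]
  rw [h2]
  exact h1

namespace ComplexFoliation

variable {F : ComplexFoliation M}

theorem mdifferentiableAt_height {e : OpenPartialHomeomorph M (ℂ × ℝ)} (he : e ∈ F.atlas) {p : M}
    (hp : p ∈ e.source) : MDifferentiableAt (𝓡 3) 𝓘(ℝ, ℝ) (fun q => (e q).2) p := by
  have h : ContMDiffAt (𝓡 3) 𝓘(ℝ, ℂ × ℝ) ∞ e p :=
    (F.smooth e he).contMDiffAt (e.open_source.mem_nhds hp)
  have h2 : ContMDiffAt 𝓘(ℝ, ℂ × ℝ) 𝓘(ℝ, ℝ) ∞ (Prod.snd : ℂ × ℝ → ℝ) (e p) :=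
    contDiff_snd.contMDiff.contMDiffAt
  exact (ContMDiffAt.comp p h2 h).mdifferentiableAt (by simp)

theorem heightDeriv_apply {e : OpenPartialHomeomorph M (ℂ × ℝ)} (he : e ∈ F.atlas) {p : M}
    (hp : p ∈ e.source) (v : TangentSpace (𝓡 3) p) :
    heightDeriv e p v = (show ℂ × ℝ from mfderiv (𝓡 3) 𝓘(ℝ, ℂ × ℝ) e p v).2 := by
  have h : MDifferentiableAt (𝓡 3) 𝓘(ℝ, ℂ × ℝ) e p :=
    ((F.smooth e he).contMDiffAt (e.open_source.mem_nhds hp)).mdifferentiableAt (by simp)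
  have h2 : HasMFDerivAt 𝓘(ℝ, ℂ × ℝ) 𝓘(ℝ, ℝ) (Prod.snd : ℂ × ℝ → ℝ) (e p)
      (ContinuousLinearMap.snd ℝ ℂ ℝ) := hasFDerivAt_snd.hasMFDerivAt
  have h3 := (HasMFDerivAt.comp p h2 h.hasMFDerivAt).mfderiv
  have h4 : heightDeriv e p =
      (ContinuousLinearMap.snd ℝ ℂ ℝ).comp (mfderiv (𝓡 3) 𝓘(ℝ, ℂ × ℝ) e p) := h3
  rw [h4]
  rfl

theorem contDiffAt_chart_flow {φ : Flow ℝ M} (hφ : IsSmoothFlow φ)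
    {e e' : OpenPartialHomeomorph M (ℂ × ℝ)} (he : e ∈ F.atlas) (he' : e' ∈ F.atlas)
    {t : ℝ} {y : ℂ × ℝ} (hy : y ∈ e.target) (hy' : φ t (e.symm y) ∈ e'.source) :
    ContDiffAt ℝ ∞ (fun x : ℝ × (ℂ × ℝ) => e' (φ x.1 (e.symm x.2))) (t, y) := by
  rw [← contMDiffAt_iff_contDiffAt]
  have h1 : ContMDiffAt 𝓘(ℝ, ℝ × (ℂ × ℝ)) (𝓡 3) ∞ (fun x : ℝ × (ℂ × ℝ) => e.symm x.2) (t, y) := by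
    have h : ContMDiffAt 𝓘(ℝ, ℂ × ℝ) (𝓡 3) ∞ e.symm ((t, y) : ℝ × (ℂ × ℝ)).2 :=
      (F.smooth_symm e he).contMDiffAt (e.open_target.mem_nhds hy)
    exact ContMDiffAt.comp (t, y) h contDiff_snd.contMDiff.contMDiffAt
  have h2 : ContMDiffAt 𝓘(ℝ, ℝ × (ℂ × ℝ)) 𝓘(ℝ, ℝ) ∞ (fun x : ℝ × (ℂ × ℝ) => x.1) (t, y) :=
    contDiff_fst.contMDiff.contMDiffAt
  have h3 : ContMDiffAt 𝓘(ℝ, ℝ × (ℂ × ℝ)) (𝓡 3) ∞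
      (fun x : ℝ × (ℂ × ℝ) => φ x.1 (e.symm x.2)) (t, y) :=
    ContMDiffAt.comp (I' := 𝓘(ℝ, ℝ).prod (𝓡 3)) (t, y) hφ.contMDiffAt (h2.prodMk h1)
  have h4 : ContMDiffAt (𝓡 3) 𝓘(ℝ, ℂ × ℝ) ∞ e' (φ t (e.symm y)) :=
    (F.smooth e' he').contMDiffAt (e'.open_source.mem_nhds hy')
  exact ContMDiffAt.comp (t, y) h4 h3

/-- The transverse coordinate after time `t`, as a function of time and of the transverse
coordinate before. -/
def transverseTransition (φ : Flow ℝ M) (e e' : OpenPartialHomeomorph M (ℂ × ℝ)) (z₀ : ℂ)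
    (x : ℝ × ℝ) : ℝ :=
  (e' (φ x.1 (e.symm (z₀, x.2)))).2

theorem contDiffAt_transverseTransition {φ : Flow ℝ M} (hφ : IsSmoothFlow φ)
    {e e' : OpenPartialHomeomorph M (ℂ × ℝ)} (he : e ∈ F.atlas) (he' : e' ∈ F.atlas)
    {t : ℝ} {z₀ : ℂ} {ξ : ℝ} (hy : (z₀, ξ) ∈ e.target)
    (hy' : φ t (e.symm (z₀, ξ)) ∈ e'.source) :
    ContDiffAt ℝ ∞ (transverseTransition φ e e' z₀) (t, ξ) := by
  have h := contDiffAt_chart_flow hφ he he' hy hy'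
  have h2 : ContDiffAt ℝ ∞ (fun x : ℝ × ℝ => (x.1, (z₀, x.2))) (t, ξ) := by fun_prop
  exact contDiffAt_snd.comp (t, ξ) (ContDiffAt.comp
    (g := fun x : ℝ × (ℂ × ℝ) => e' (φ x.1 (e.symm x.2))) (t, ξ) h h2)

/-- The flow box makes the height after the flow independent of the leaf coordinate, so that
coordinate may be frozen at its value at `p`; this exhibits a smooth `k`. -/
theorem exists_transverse_eq [CompactSpace M] {φ : Flow ℝ M} (hφs : IsSmoothFlow φ)
    (hφ : ∀ (t : ℝ) (p : M), φ t '' F.leaf p = F.leaf (φ t p))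
    {e e' : OpenPartialHomeomorph M (ℂ × ℝ)} (he : e ∈ F.atlas) (he' : e' ∈ F.atlas)
    {p : M} {t₀ : ℝ} (hp : p ∈ e.source) (hp' : φ t₀ p ∈ e'.source) :
    ∃ k : ℝ × ℝ → ℝ, (∀ᶠ x in 𝓝 (t₀, (e p).2), ContDiffAt ℝ ∞ k x) ∧
      ∀ᶠ y : ℝ × M in 𝓝 (t₀, p), y.2 ∈ e.source ∧ φ y.1 y.2 ∈ e'.source ∧
        (e' (φ y.1 y.2)).2 = k (y.1, (e y.2).2) := by
  obtain ⟨r, hr, h⟩ := exists_flowBox hφ he he' hp hp'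
  refine ⟨transverseTransition φ e e' (e p).1, ?_, ?_⟩
  · have : ∀ᶠ x : ℝ × ℝ in 𝓝 (t₀, (e p).2), x.1 ∈ ball t₀ r ∧ x.2 ∈ ball (e p).2 r :=
      (continuousAt_fst.eventually (ball_mem_nhds _ hr)).and
        (continuousAt_snd.eventually (ball_mem_nhds _ hr))
    filter_upwards [this] with x hx
    obtain ⟨h1, h2, -⟩ := h (e p).1 (mem_ball_self hr) x.2 hx.2 x.1 hx.1
    exact contDiffAt_transverseTransition hφs he he' h1 h2
  · have h1 : ∀ᶠ y : ℝ × M in 𝓝 (t₀, p), y.1 ∈ ball t₀ r :=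
      continuousAt_fst.eventually (ball_mem_nhds _ hr)
    have h2 : ∀ᶠ y : ℝ × M in 𝓝 (t₀, p), y.2 ∈ e.source :=
      continuousAt_snd.eventually (e.open_source.mem_nhds hp)
    have hc : ContinuousAt (fun y : ℝ × M => e y.2) (t₀, p) :=
      ContinuousAt.comp (g := e) (f := fun y : ℝ × M => y.2) (e.continuousAt hp) continuousAt_snd
    have h3 : ∀ᶠ y : ℝ × M in 𝓝 (t₀, p), (e y.2).1 ∈ ball (e p).1 r :=
      (continuousAt_fst.comp hc).eventually (ball_mem_nhds _ hr)
    have h4 : ∀ᶠ y : ℝ × M in 𝓝 (t₀, p), (e y.2).2 ∈ ball (e p).2 r :=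
      (continuousAt_snd.comp hc).eventually (ball_mem_nhds _ hr)
    filter_upwards [h1, h2, h3, h4] with y h1 h2 h3 h4
    obtain ⟨-, g2, g3⟩ := h _ h3 _ h4 _ h1
    have : e.symm ((e y.2).1, (e y.2).2) = y.2 := e.left_inv h2
    rw [this] at g2 g3
    exact ⟨h2, g2, g3⟩

/-- At time `0` the flow is the identity, so one height is a differentiable function of the other
near `p`, and the chain rule applies. -/
theorem exists_heightDeriv_eq_smul [CompactSpace M] {φ : Flow ℝ M} (hφs : IsSmoothFlow φ)
    (hφ : ∀ (t : ℝ) (p : M), φ t '' F.leaf p = F.leaf (φ t p))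
    {e e' : OpenPartialHomeomorph M (ℂ × ℝ)} (he : e ∈ F.atlas) (he' : e' ∈ F.atlas)
    {p : M} (hp : p ∈ e.source) (hp' : p ∈ e'.source) :
    ∃ c : ℝ, heightDeriv e' p = c • heightDeriv e p := by
  have hp'' : φ 0 p ∈ e'.source := by rwa [φ.map_zero_apply]
  obtain ⟨k, hk, hev⟩ := exists_transverse_eq hφs hφ he he' hp hp''
  have hkd : DifferentiableAt ℝ (fun ξ => k (0, ξ)) (e p).2 := by
    have h1 : DifferentiableAt ℝ k (0, (e p).2) := hk.self_of_nhds.differentiableAt (by simp)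
    exact DifferentiableAt.comp (g := k) (f := fun ξ => ((0 : ℝ), ξ)) _ h1 (by fun_prop)
  have hc : ContinuousAt (fun q : M => ((0 : ℝ), q)) p := by fun_prop
  have heq : (fun q => (e' q).2) =ᶠ[𝓝 p] (fun ξ => k (0, ξ)) ∘ fun q => (e q).2 := by
    filter_upwards [hc.eventually hev] with q hq
    simpa [φ.map_zero_apply] using hq.2.2
  refine ⟨deriv (fun ξ => k (0, ξ)) (e p).2, ?_⟩
  have h1 := hkd.hasFDerivAt.hasMFDerivAt
  have h2 := (mdifferentiableAt_height he hp).hasMFDerivAt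
  have h3 := (HasMFDerivAt.comp (f := fun q => (e q).2) p h1 h2).mfderiv
  have h4 : heightDeriv e' p =
      (fderiv ℝ (fun ξ => k (0, ξ)) (e p).2).comp (heightDeriv e p) :=
    heq.mfderiv_eq.trans h3
  rw [h4]
  ext v
  rw [ContinuousLinearMap.comp_apply, fderiv_eq_smul_deriv]
  simp [mul_comm]

/-- Tangency refers to all charts around `p`; the differentials of their heights are multiples of
each other, so one chart decides. -/
theorem isTangent_iff [CompactSpace M] {φ : Flow ℝ M} (hφs : IsSmoothFlow φ)
    (hφ : ∀ (t : ℝ) (p : M), φ t '' F.leaf p = F.leaf (φ t p))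
    {e : OpenPartialHomeomorph M (ℂ × ℝ)} (he : e ∈ F.atlas)
    {p : M} (hp : p ∈ e.source) (v : TangentSpace (𝓡 3) p) :
    F.IsTangent p v ↔ heightDeriv e p v = 0 := by
  constructor
  · intro h
    rw [heightDeriv_apply he hp]
    exact h e he hp
  · intro h e' he' hp'
    rw [← heightDeriv_apply he' hp']
    obtain ⟨c, hc⟩ := exists_heightDeriv_eq_smul hφs hφ he he' hp hp'
    rw [hc]
    simp [h]

/-- The transverse speed of a leaf-preserving flow only depends on the transverse coordinate. -/
theorem exists_transverseSpeed [CompactSpace M] {φ : Flow ℝ M} (hφs : IsSmoothFlow φ)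
    (hφ : ∀ (t : ℝ) (p : M), φ t '' F.leaf p = F.leaf (φ t p))
    {e : OpenPartialHomeomorph M (ℂ × ℝ)} (he : e ∈ F.atlas) {p : M} (hp : p ∈ e.source) :
    ∃ a : ℝ → ℝ, (∀ᶠ ξ in 𝓝 (e p).2, ContDiffAt ℝ ∞ a ξ) ∧
      ∀ᶠ q in 𝓝 p, q ∈ e.source ∧ heightDeriv e q (velocity φ q) = a (e q).2 := by
  have hp' : φ 0 p ∈ e.source := by rwa [φ.map_zero_apply]
  obtain ⟨k, hk, hev⟩ := exists_transverse_eq hφs hφ he he hp hp'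
  -- The height at time `s` is `k (s, ξ)`, where `ξ` is the height at time `0`; the speed is the
  -- time derivative at `s = 0`.
  refine ⟨fun ξ => fderiv ℝ k (0, ξ) (1, 0), ?_, ?_⟩
  · have hc : ContinuousAt (fun ξ : ℝ => ((0 : ℝ), ξ)) (e p).2 := by fun_prop
    filter_upwards [hc.eventually hk] with ξ hξ
    have h1 : ContDiffAt ℝ ∞ (fderiv ℝ k) (0, ξ) := hξ.fderiv_right (by simp)
    have h2 : ContDiffAt ℝ ∞ (fun ξ : ℝ => fderiv ℝ k (0, ξ)) ξ :=
      ContDiffAt.comp (g := fderiv ℝ k) (f := fun ξ : ℝ => ((0 : ℝ), ξ)) ξ h1 (by fun_prop)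
    exact h2.clm_apply contDiffAt_const
  · rw [nhds_prod_eq] at hev
    obtain ⟨P, hP, Q, hQ, hPQ⟩ := eventually_prod_iff.1 hev
    have hc : ContinuousAt (fun q : M => ((0 : ℝ), (e q).2)) p :=
      continuousAt_const.prodMk (continuousAt_snd.comp (e.continuousAt hp))
    filter_upwards [hQ, e.open_source.mem_nhds hp, hc.eventually hk] with q hq hqe hkq
    refine ⟨hqe, ?_⟩
    have h1 : HasDerivAt (fun s => (e (φ s q)).2) (heightDeriv e q (velocity φ q)) 0 := by
      have := hφs.hasDerivAt_comp (t := 0) (q := q) (X := fun q => (e q).2)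
        (by rw [φ.map_zero_apply]; exact mdifferentiableAt_height he hqe)
      rw [φ.map_zero_apply] at this
      exact this
    have h2 : HasDerivAt (fun s : ℝ => k (s, (e q).2)) (fderiv ℝ k (0, (e q).2) (1, 0)) 0 := by
      have h3 := (hkq.differentiableAt (by simp)).hasFDerivAt
      have h4 : HasDerivAt (fun s : ℝ => (s, (e q).2)) ((1 : ℝ), (0 : ℝ)) 0 :=
        (hasDerivAt_id (0 : ℝ)).prodMk (hasDerivAt_const _ _)
      exact HasFDerivAt.comp_hasDerivAt (0 : ℝ) h3 h4
    have h5 : (fun s => (e (φ s q)).2) =ᶠ[𝓝 0] fun s : ℝ => k (s, (e q).2) := by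
      filter_upwards [hP] with s hs
      exact (hPQ hs hq).2.2
    exact h1.unique (h2.congr_of_eventuallyEq h5)

end ComplexFoliation

end

/-! ### Two flows with the same transverse speed. -/

namespace ComplexFoliation

variable {M : Type*} [TopologicalSpace M] [CompactSpace M]
  [ChartedSpace (EuclideanSpace ℝ (Fin 3)) M] {F : ComplexFoliation M}

section Compare

variable {φ φ' : Flow ℝ M} (hφs : IsSmoothFlow φ) (hφs' : IsSmoothFlow φ')
  (hφ : ∀ (t : ℝ) (p : M), φ t '' F.leaf p = F.leaf (φ t p))
  (hv : ∀ e ∈ F.atlas, ∀ p ∈ e.source,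
    heightDeriv e p (velocity φ' p) = heightDeriv e p (velocity φ p))

include hφs hφs' hφ hv

/-- The heights along both orbits solve `ξ' = a ξ` with the same initial value, and `a` is locally
Lipschitz. Neighbourhoods are shrunk so that both orbits stay in the region where this equation
holds. -/
theorem eventually_samePlaque (p : M) :
    ∀ᶠ y : ℝ × M in 𝓝 (0, p), F.SamePlaque (φ y.1 y.2) (φ' y.1 y.2) := by
  obtain ⟨e, he, hp⟩ := F.cover p
  obtain ⟨a, ha, hev⟩ := exists_transverseSpeed hφs hφ he hp
  obtain ⟨K, u, hu, hK⟩ := (ha.self_of_nhds.of_le (by simp :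
    (1 : WithTop ℕ∞) ≤ ∞)).exists_lipschitzOnWith
  have hgood : ∀ᶠ q in 𝓝 p, (q ∈ e.source ∧ heightDeriv e q (velocity φ q) = a (e q).2) ∧
      (e q).2 ∈ u :=
    hev.and ((continuousAt_snd.comp (e.continuousAt hp)).eventually hu)
  have h0 : ∀ ψ : Flow ℝ M, Tendsto (fun y : ℝ × M => ψ y.1 y.2) (𝓝 (0, p)) (𝓝 p) := by
    intro ψ
    have : ContinuousAt (fun y : ℝ × M => ψ y.1 y.2) (0, p) := ψ.cont'.continuousAt
    simpa only [ContinuousAt, ψ.map_zero_apply] using this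
  have hboth := ((h0 φ).eventually hgood).and ((h0 φ').eventually hgood)
  rw [nhds_prod_eq] at hboth ⊢
  obtain ⟨P, hP, Q, hQ, hPQ⟩ := eventually_prod_iff.1 hboth
  obtain ⟨ε, hε, hball⟩ := Metric.eventually_nhds_iff_ball.1 hP
  have hev0 : ∀ᶠ t : ℝ in 𝓝 0, t ∈ Ioo (-ε) ε := Ioo_mem_nhds (by linarith) hε
  filter_upwards [hev0.prod_mk hQ] with y hy
  obtain ⟨ht, hq⟩ := hy
  have hin : ∀ s ∈ Ioo (-ε) ε, P s := by
    intro s hs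
    apply hball
    rw [Real.ball_eq_Ioo]
    simpa using hs
  have key : EqOn (fun s => (e (φ s y.2)).2) (fun s => (e (φ' s y.2)).2) (Ioo (-ε) ε) := by
    refine ODE_solution_unique_of_mem_Ioo (v := fun _ => a) (s := fun _ => u) (K := K) (t₀ := 0)
      (fun _ _ => hK) ⟨by linarith, hε⟩ ?_ ?_ ?_
    · intro s hs
      obtain ⟨⟨h1, h2⟩, h3⟩ := (hPQ (hin s hs) hq).1
      refine ⟨?_, h3⟩
      have := hφs.hasDerivAt_comp (t := s) (q := y.2) (mdifferentiableAt_height he h1)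
      show HasDerivAt _ (a (e (φ s y.2)).2) s
      rw [← h2]
      exact this
    · intro s hs
      obtain ⟨⟨h1, h2⟩, h3⟩ := (hPQ (hin s hs) hq).2
      refine ⟨?_, h3⟩
      have := hφs'.hasDerivAt_comp (t := s) (q := y.2) (mdifferentiableAt_height he h1)
      show HasDerivAt _ (a (e (φ' s y.2)).2) s
      rw [← h2, ← hv e he _ h1]
      exact this
    · simp only [φ.map_zero_apply, φ'.map_zero_apply]
  obtain ⟨h1, h2⟩ := hPQ (hin _ ht) hq
  exact ⟨e, he, h1.1.1, h2.1.1, key ht⟩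

/-- By compactness the comparison for short times holds at all points at once. A time `t` is cut
into `n` equal short steps; since `φ` maps leaves to leaves, the errors along the leaves do not
accumulate transversally. -/
theorem flow_mem_leaf_flow (t : ℝ) (q : M) : φ' t q ∈ F.leaf (φ t q) := by
  have h := isCompact_univ.eventually_forall_of_forall_eventually (x₀ := (0 : ℝ))
    (P := fun t q => F.SamePlaque (φ t q) (φ' t q))
    (fun p _ => eventually_samePlaque hφs hφs' hφ hv p)
  have hsmall : ∀ s : ℝ, (∀ q ∈ univ, F.SamePlaque (φ s q) (φ' s q)) →
      ∀ (n : ℕ) (q : M), φ' (n * s) q ∈ F.leaf (φ (n * s) q) := by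
    intro s hs n
    induction n with
    | zero => intro q; simpa [φ.map_zero_apply, φ'.map_zero_apply] using mem_leaf_self q
    | succ n ih =>
      intro q
      have e1 : ((n + 1 : ℕ) : ℝ) * s = s + n * s := by push_cast; ring
      rw [e1, φ'.map_add, φ.map_add]
      have h1 := (hs (φ' (n * s) q) (mem_univ _)).mem_leaf
      rw [← hφ, leaf_eq_of_mem (ih q), hφ] at h1
      exact h1
  have htend : Tendsto (fun n : ℕ => t / n) atTop (𝓝 0) := tendsto_const_div_atTop_nhds_zero_nat t
  obtain ⟨n, hn, hn0⟩ := ((htend.eventually h).and (eventually_gt_atTop 0)).exists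
  have := hsmall _ hn n q
  have hne : (n : ℝ) ≠ 0 := by positivity
  rwa [mul_div_cancel₀ _ hne] at this

theorem flow_image_leaf (t : ℝ) (p : M) : φ' t '' F.leaf p = F.leaf (φ' t p) := by
  have hsub : ∀ (t : ℝ) (p q : M), q ∈ F.leaf p → φ' t q ∈ F.leaf (φ' t p) := by
    intro t p q hq
    rw [leaf_eq_of_mem (flow_mem_leaf_flow hφs hφs' hφ hv t p), ← hφ, ← leaf_eq_of_mem hq, hφ]
    exact flow_mem_leaf_flow hφs hφs' hφ hv t q
  refine Subset.antisymm ?_ ?_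
  · rintro _ ⟨q, hq, rfl⟩
    exact hsub t p q hq
  · intro y hy
    refine ⟨φ' (-t) y, ?_, ?_⟩
    · have := hsub (-t) _ _ hy
      rwa [← φ'.map_add, neg_add_cancel, φ'.map_zero_apply] at this
    · rw [← φ'.map_add, add_neg_cancel, φ'.map_zero_apply]

theorem isTangent_velocity_iff (p : M) :
    F.IsTangent p (velocity φ' p) ↔ F.IsTangent p (velocity φ p) := by
  obtain ⟨e, he, hp⟩ := F.cover p
  rw [isTangent_iff hφs hφ he hp, isTangent_iff hφs hφ he hp, hv e he p hp]

theorem nonTransverseLeaves_eq : nonTransverseLeaves F φ' = nonTransverseLeaves F φ := by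
  ext L
  simp only [nonTransverseLeaves, isTangent_velocity_iff hφs hφs' hφ hv]

theorem transverseRegion_eq : transverseRegion F φ' = transverseRegion F φ := by
  rw [transverseRegion, transverseRegion, nonTransverseLeaves_eq hφs hφs' hφ hv]

end Compare

omit [CompactSpace M] in
theorem not_isTangent_of_mem_transverseRegion {φ : Flow ℝ M} (hS : IsFDS F φ) {p : M}
    (hp : p ∈ transverseRegion F φ) : ¬ F.IsTangent p (velocity φ p) := by
  intro h
  obtain ⟨P, -, hP, hP'⟩ := hS.transverse
  by_cases hmem : p ∈ ⋃₀ P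
  · obtain ⟨L, hL, hpL⟩ := hmem
    exact hp ⟨L, ⟨(hP L hL).1, (hP L hL).2.1, p, hpL, h⟩, hpL⟩
  · exact hP' p hmem h

omit [CompactSpace M] in
-- Tangencies occur only on `⋃₀ P`, and two leaves that meet coincide.
theorem exists_invariant_of_mem_nonTransverseLeaves {φ : Flow ℝ M}
    {P : Set (Set M)} (hP : ∀ L ∈ P, (∃ p, L = F.leaf p) ∧ IsCompact L ∧ ∀ t : ℝ, φ t '' L = L)
    (hP' : ∀ p, p ∉ ⋃₀ P → ¬ F.IsTangent p (velocity φ p)) :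
    nonTransverseLeaves F φ ⊆ P := by
  rintro L ⟨⟨p, rfl⟩, hc, q, hq, hqt⟩
  have hmem : q ∈ ⋃₀ P := by
    by_contra h
    exact hP' q h hqt
  obtain ⟨L', hL', hqL'⟩ := hmem
  obtain ⟨p', rfl⟩ := (hP L' hL').1
  rwa [← leaf_eq_of_mem hq, leaf_eq_of_mem hqL']

omit [CompactSpace M] in
theorem image_eq_of_mem_nonTransverseLeaves {φ : Flow ℝ M} (hS : IsFDS F φ) {L : Set M}
    (hL : L ∈ nonTransverseLeaves F φ) (t : ℝ) : φ t '' L = L := by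
  obtain ⟨P, -, hP, hP'⟩ := hS.transverse
  exact (hP L (exists_invariant_of_mem_nonTransverseLeaves hP hP' hL)).2.2 t

omit [CompactSpace M] in
theorem finite_nonTransverseLeaves {φ : Flow ℝ M} (hS : IsFDS F φ) :
    (nonTransverseLeaves F φ).Finite := by
  obtain ⟨P, hf, hP, hP'⟩ := hS.transverse
  exact hf.subset (exists_invariant_of_mem_nonTransverseLeaves hP hP')

theorem flow_mem_transverseRegion {φ : Flow ℝ M} (hS : IsFDS F φ) {p : M}
    (hp : p ∈ transverseRegion F φ) (t : ℝ) : φ t p ∈ transverseRegion F φ := by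
  rintro ⟨L, hL, hpL⟩
  refine hp ⟨L, hL, ?_⟩
  rw [← image_eq_of_mem_nonTransverseLeaves hS hL (-t)]
  refine ⟨_, hpL, ?_⟩
  rw [← φ.map_add, neg_add_cancel, φ.map_zero_apply]

/-- A smooth flow with the same transverse speed as a foliated dynamical system is one too. -/
theorem _root_.IsFDS.of_heightDeriv_velocity_eq {φ φ' : Flow ℝ M} (hS : IsFDS F φ)
    (hφs' : IsSmoothFlow φ')
    (hv : ∀ e ∈ F.atlas, ∀ p ∈ e.source,
      heightDeriv e p (velocity φ' p) = heightDeriv e p (velocity φ p)) : IsFDS F φ' where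
  smooth := hφs'
  leaf_to_leaf := flow_image_leaf hS.smooth hφs' hS.leaf_to_leaf hv
  transverse := by
    refine ⟨nonTransverseLeaves F φ, finite_nonTransverseLeaves hS, ?_, ?_⟩
    · intro L hL
      refine ⟨hL.1, hL.2.1, ?_⟩
      intro t
      obtain ⟨p, rfl⟩ := hL.1
      have h1 : φ t p ∈ F.leaf p := by
        rw [← image_eq_of_mem_nonTransverseLeaves hS hL t]
        exact ⟨p, mem_leaf_self p, rfl⟩
      rw [flow_image_leaf hS.smooth hφs' hS.leaf_to_leaf hv,
        leaf_eq_of_mem (flow_mem_leaf_flow hS.smooth hφs' hS.leaf_to_leaf hv t p),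
        leaf_eq_of_mem h1]
    · intro p hp h
      rw [isTangent_velocity_iff hS.smooth hφs' hS.leaf_to_leaf hv] at h
      exact not_isTangent_of_mem_transverseRegion hS hp h

/-! ### The canonical form, locally `dξ / a ξ`. -/

section CanonicalForm

/-- The form that vanishes along the leaves and is `1` on the generating vector field. -/
def canonicalForm (F : ComplexFoliation M) (φ : Flow ℝ M) (p : M) :
    TangentSpace (𝓡 3) p →L[ℝ] ℝ :=
  (heightDeriv (F.cover p).choose p (velocity φ p))⁻¹ • heightDeriv (F.cover p).choose p

theorem heightDeriv_velocity_ne_zero {φ : Flow ℝ M} (hS : IsFDS F φ) {p : M}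
    (hp : p ∈ transverseRegion F φ) {e : OpenPartialHomeomorph M (ℂ × ℝ)} (he : e ∈ F.atlas)
    (hpe : p ∈ e.source) : heightDeriv e p (velocity φ p) ≠ 0 := by
  rw [Ne, ← isTangent_iff hS.smooth hS.leaf_to_leaf he hpe]
  exact not_isTangent_of_mem_transverseRegion hS hp

theorem canonicalForm_eq {φ : Flow ℝ M} (hS : IsFDS F φ) {p : M}
    {e : OpenPartialHomeomorph M (ℂ × ℝ)} (he : e ∈ F.atlas)
    (hpe : p ∈ e.source) (h0 : heightDeriv e p (velocity φ p) ≠ 0) :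
    canonicalForm F φ p = (heightDeriv e p (velocity φ p))⁻¹ • heightDeriv e p := by
  obtain ⟨he', hp'⟩ := (F.cover p).choose_spec
  unfold canonicalForm
  set e' := (F.cover p).choose
  obtain ⟨c, hc⟩ := exists_heightDeriv_eq_smul hS.smooth hS.leaf_to_leaf he he' hpe hp'
  have hne : heightDeriv e' p (velocity φ p) ≠ 0 := by
    rwa [Ne, ← isTangent_iff hS.smooth hS.leaf_to_leaf he' hp',
      isTangent_iff hS.smooth hS.leaf_to_leaf he hpe]
  rw [hc] at hne ⊢
  have hc0 : c ≠ 0 := by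
    rintro rfl
    simp at hne
  ext v
  simp only [_root_.smul_apply, smul_eq_mul]
  field_simp

/-- Subtracting the right multiple of the velocity makes `v` tangent to the leaves, where `η`
vanishes. The flow `ψ` only supplies `isTangent_iff`; keeping it apart from `φ` allows the formula
to be used for the new flow as well. -/
theorem eq_div_of_isCanonicalForm {φ ψ : Flow ℝ M} (hS : IsFDS F ψ)
    {η : ∀ p : M, TangentSpace (𝓡 3) p →L[ℝ] ℝ} (hη : IsCanonicalForm F φ η) {p : M}
    (hp : p ∈ transverseRegion F φ) {e : OpenPartialHomeomorph M (ℂ × ℝ)} (he : e ∈ F.atlas)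
    (hpe : p ∈ e.source) (h0 : heightDeriv e p (velocity φ p) ≠ 0)
    (v : TangentSpace (𝓡 3) p) :
    η p v = heightDeriv e p v / heightDeriv e p (velocity φ p) := by
  have h := hη.tangent p hp
    (v - (heightDeriv e p v / heightDeriv e p (velocity φ p)) • velocity φ p) (by
      rw [isTangent_iff hS.smooth hS.leaf_to_leaf he hpe, map_sub, map_smul, smul_eq_mul,
        div_mul_cancel₀ _ h0, sub_self])
  rw [map_sub, map_smul, hη.velocity p hp, smul_eq_mul, mul_one, sub_eq_zero] at h
  exact h

variable [IsManifold (𝓡 3) ∞ M]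

/-- Here `X` is the height read in the chart of `M` and `b = 1 / a`, where `a` is the transverse
speed as a function of the height. -/
theorem exists_formInChart_canonicalForm_eq {φ : Flow ℝ M} (hS : IsFDS F φ) (x : M)
    {y : EuclideanSpace ℝ (Fin 3)} (hy : y ∈ chartDomain (transverseRegion F φ) x) :
    ∃ (b : ℝ → ℝ) (X : EuclideanSpace ℝ (Fin 3) → ℝ), ContDiffAt ℝ ∞ b (X y) ∧
      ContDiffAt ℝ ∞ X y ∧
      formInChart (canonicalForm F φ) x =ᶠ[𝓝 y] fun y' => b (X y') • fderiv ℝ X y' := by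
  obtain ⟨hy1, hy2⟩ := hy
  set c := chartAt (EuclideanSpace ℝ (Fin 3)) x with hc
  obtain ⟨e, he, hpe⟩ := F.cover (c.symm y)
  obtain ⟨a, ha, hev⟩ := exists_transverseSpeed hS.smooth hS.leaf_to_leaf he hpe
  have hsymm : ∀ y' ∈ c.target, ContMDiffAt 𝓘(ℝ, EuclideanSpace ℝ (Fin 3)) (𝓡 3) ∞ c.symm y' := by
    intro y' hy'
    exact (contMDiffOn_symm_of_mem_maximalAtlas
      (IsManifold.chart_mem_maximalAtlas x)).contMDiffAt (c.open_target.mem_nhds hy')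
  have ha0 : a (e (c.symm y)).2 ≠ 0 := by
    rw [← hev.self_of_nhds.2]
    exact heightDeriv_velocity_ne_zero hS hy2 he hpe
  have hcont : ContinuousAt c.symm y := c.symm.continuousAt hy1
  refine ⟨fun ξ => (a ξ)⁻¹, fun y' => (e (c.symm y')).2, ha.self_of_nhds.inv ha0, ?_, ?_⟩
  · rw [← contMDiffAt_iff_contDiffAt]
    have h1 : ContMDiffAt (𝓡 3) 𝓘(ℝ, ℂ × ℝ) ∞ e (c.symm y) :=
      (F.smooth e he).contMDiffAt (e.open_source.mem_nhds hpe)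
    have h2 : ContMDiffAt 𝓘(ℝ, ℂ × ℝ) 𝓘(ℝ, ℝ) ∞ (Prod.snd : ℂ × ℝ → ℝ) (e (c.symm y)) :=
      contDiff_snd.contMDiff.contMDiffAt
    have h3 : ContMDiffAt 𝓘(ℝ, EuclideanSpace ℝ (Fin 3)) 𝓘(ℝ, ℂ × ℝ) ∞
        (fun y' => e (c.symm y')) y := ContMDiffAt.comp y h1 (hsymm y hy1)
    exact ContMDiffAt.comp y h2 h3
  · have hane : ∀ᶠ q in 𝓝 (c.symm y), a (e q).2 ≠ 0 :=
      (ContinuousAt.comp (g := a) (f := fun q => (e q).2) ha.self_of_nhds.continuousAt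
        (continuousAt_snd.comp (e.continuousAt hpe))).eventually_ne ha0
    filter_upwards [c.open_target.mem_nhds hy1, hcont.eventually hev, hcont.eventually hane]
      with y' hy' hq hne
    have h0 : heightDeriv e (c.symm y') (velocity φ (c.symm y')) ≠ 0 := by rwa [hq.2]
    have h1 : fderiv ℝ (fun y' => (e (c.symm y')).2) y' =
        (heightDeriv e (c.symm y')).comp
          (mfderiv 𝓘(ℝ, EuclideanSpace ℝ (Fin 3)) (𝓡 3) c.symm y') := by
      rw [← mfderiv_eq_fderiv]
      exact (HasMFDerivAt.comp y' (mdifferentiableAt_height he hq.1).hasMFDerivAt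
        ((hsymm y' hy').mdifferentiableAt (by simp)).hasMFDerivAt).mfderiv
    show (canonicalForm F φ (c.symm y')).comp
      (mfderiv 𝓘(ℝ, EuclideanSpace ℝ (Fin 3)) (𝓡 3) c.symm y') = _
    rw [canonicalForm_eq hS he hq.1 h0, h1, hq.2]
    rfl

/-- The derivative of `b (X) dX` is `b' (X) dX ⊗ dX + b (X) D²X`, and both terms are symmetric; so
the form is closed. -/
theorem isCanonicalForm_canonicalForm {φ : Flow ℝ M} (hS : IsFDS F φ) :
    IsCanonicalForm F φ (canonicalForm F φ) where
  smooth := by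
    intro x y hy
    obtain ⟨b, X, hb, hX, heq⟩ := exists_formInChart_canonicalForm_eq hS x hy
    refine ContDiffAt.contDiffWithinAt ?_
    refine ContDiffAt.congr_of_eventuallyEq ?_ heq
    exact (ContDiffAt.comp y hb hX).smul (hX.fderiv_right (by simp))
  closed := by
    intro x y hy u v
    obtain ⟨b, X, hb, hX, heq⟩ := exists_formInChart_canonicalForm_eq hS x hy
    rw [heq.fderiv_eq]
    have h1 : HasFDerivAt (fderiv ℝ X) (fderiv ℝ (fderiv ℝ X) y) y :=
      ((hX.fderiv_right (m := ∞) (by simp)).differentiableAt (by simp)).hasFDerivAt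
    have h2 : HasFDerivAt (fun y' => b (X y')) ((fderiv ℝ b (X y)).comp (fderiv ℝ X y)) y :=
      (hb.differentiableAt (by simp)).hasFDerivAt.comp y
        (hX.differentiableAt (by simp)).hasFDerivAt
    have h3 := (h2.smul h1).fderiv
    have h4 : IsSymmSndFDerivAt ℝ X y := hX.isSymmSndFDerivAt (by
      simp only [minSmoothness_of_isRCLikeNormedField]
      exact ENat.LEInfty.out)
    have h5 : fderiv ℝ (fun y' => b (X y') • fderiv ℝ X y') y = _ := h3
    rw [h5]
    simp only [_root_.add_apply, _root_.smul_apply,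
      ContinuousLinearMap.smulRight_apply, ContinuousLinearMap.comp_apply]
    rw [h4.eq u v, fderiv_eq_smul_deriv, fderiv_eq_smul_deriv]
    simp only [smul_eq_mul]
    ring
  tangent := by
    intro p hp v hv
    obtain ⟨e, he, hpe⟩ := F.cover p
    rw [canonicalForm_eq hS he hpe (heightDeriv_velocity_ne_zero hS hp he hpe)]
    rw [isTangent_iff hS.smooth hS.leaf_to_leaf he hpe] at hv
    simp [hv]
  velocity := by
    intro p hp
    obtain ⟨e, he, hpe⟩ := F.cover p
    have h0 := heightDeriv_velocity_ne_zero hS hp he hpe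
    rw [canonicalForm_eq hS he hpe h0]
    simp [h0]

omit [IsManifold (𝓡 3) ∞ M] in
theorem _root_.IsCanonicalForm.of_heightDeriv_velocity_eq {φ φ' : Flow ℝ M} (hS : IsFDS F φ)
    (hφs' : IsSmoothFlow φ')
    (hv : ∀ e ∈ F.atlas, ∀ p ∈ e.source,
      heightDeriv e p (velocity φ' p) = heightDeriv e p (velocity φ p))
    {η : ∀ p : M, TangentSpace (𝓡 3) p →L[ℝ] ℝ} (hη : IsCanonicalForm F φ η) :
    IsCanonicalForm F φ' η := by
  have hreg := transverseRegion_eq hS.smooth hφs' hS.leaf_to_leaf hv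
  refine ⟨?_, ?_, ?_, ?_⟩
  · rw [hreg]; exact hη.smooth
  · rw [hreg]; exact hη.closed
  · rw [hreg]; exact hη.tangent
  · rw [hreg]
    intro p hp
    obtain ⟨e, he, hpe⟩ := F.cover p
    have h0 := heightDeriv_velocity_ne_zero hS hp he hpe
    rw [eq_div_of_isCanonicalForm hS hη hp he hpe h0, hv e he p hpe, div_self h0]

omit [IsManifold (𝓡 3) ∞ M] in
theorem _root_.IsCanonicalForm.eq_of_heightDeriv_velocity_eq {φ φ' : Flow ℝ M} (hS : IsFDS F φ)
    (hφs' : IsSmoothFlow φ')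
    (hv : ∀ e ∈ F.atlas, ∀ p ∈ e.source,
      heightDeriv e p (velocity φ' p) = heightDeriv e p (velocity φ p))
    {η η' : ∀ p : M, TangentSpace (𝓡 3) p →L[ℝ] ℝ} (hη : IsCanonicalForm F φ η)
    (hη' : IsCanonicalForm F φ' η') {p : M} (hp : p ∈ transverseRegion F φ) : η p = η' p := by
  obtain ⟨e, he, hpe⟩ := F.cover p
  have h0 := heightDeriv_velocity_ne_zero hS hp he hpe
  have hp' : p ∈ transverseRegion F φ' := by
    rwa [transverseRegion_eq hS.smooth hφs' hS.leaf_to_leaf hv]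
  ext v
  rw [eq_div_of_isCanonicalForm hS hη hp he hpe h0,
    eq_div_of_isCanonicalForm hS hη' hp' he hpe (by rwa [hv e he p hpe]), hv e he p hpe]

end CanonicalForm

end ComplexFoliation

/-! ### The contraction tube: phase, period, convergence to the core. -/

/-- The norms decrease to some `ℓ`. A limit point `w` of the iterates satisfies `‖w‖ = ℓ = ‖R w‖`,
and strictness leaves only `w = 0`. Compactness replaces a uniform contraction factor. -/
theorem tendsto_iterate_zero_of_norm_lt {E : Type*} [NormedAddCommGroup E] [ProperSpace E]
    {R : E → E} {ρ : ℝ} (hc : ContinuousOn R (closedBall 0 ρ))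
    (hm : MapsTo R (closedBall 0 ρ) (closedBall 0 ρ)) (h0 : R 0 = 0)
    (hlt : ∀ z ∈ closedBall (0 : E) ρ, z ≠ 0 → ‖R z‖ < ‖z‖) {z : E}
    (hz : z ∈ closedBall (0 : E) ρ) : Tendsto (fun n : ℕ => R^[n] z) atTop (𝓝 0) := by
  have hmem : ∀ n : ℕ, R^[n] z ∈ closedBall (0 : E) ρ := fun n => hm.iterate n hz
  have hle : ∀ w ∈ closedBall (0 : E) ρ, ‖R w‖ ≤ ‖w‖ := by
    intro w hw
    by_cases h : w = 0
    · simp [h, h0]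
    · exact (hlt w hw h).le
  have hanti : Antitone fun n : ℕ => ‖R^[n] z‖ := by
    refine antitone_nat_of_succ_le fun n => ?_
    rw [Function.iterate_succ_apply']
    exact hle _ (hmem n)
  have hconv := tendsto_atTop_ciInf hanti ⟨0, by rintro _ ⟨n, rfl⟩; exact norm_nonneg _⟩
  set ℓ := ⨅ n : ℕ, ‖R^[n] z‖
  obtain ⟨w, hw, ψ, hψ, hlim⟩ := (isCompact_closedBall (0 : E) ρ).tendsto_subseq hmem
  have h1 : ‖w‖ = ℓ :=
    tendsto_nhds_unique hlim.norm (hconv.comp hψ.tendsto_atTop)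
  have h2 : Tendsto (fun n => R (R^[ψ n] z)) atTop (𝓝 (R w)) :=
    (hc w hw).tendsto.comp (tendsto_nhdsWithin_iff.2 ⟨hlim, Eventually.of_forall fun n => hmem _⟩)
  have h3 : ‖R w‖ = ℓ := by
    refine tendsto_nhds_unique h2.norm ?_
    have := hconv.comp ((tendsto_add_atTop_nat 1).comp hψ.tendsto_atTop)
    refine this.congr fun n => ?_
    simp only [Function.comp_apply]
    rw [Function.iterate_succ_apply']
  have hw0 : w = 0 := by
    by_contra h
    exact absurd (h3.trans h1.symm) (hlt w hw h).ne
  rw [tendsto_zero_iff_norm_tendsto_zero]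
  rwa [← h1, hw0, norm_zero] at hconv

namespace IsContractionTube

variable {M : Type*} [TopologicalSpace M] [ChartedSpace (EuclideanSpace ℝ (Fin 3)) M]
  {F : ComplexFoliation M} {φ : Flow ℝ M} {γ : Set M}
  {τ : OpenPartialHomeomorph (ℂ × Circle) M}

theorem mem_source (hτ : IsContractionTube φ γ τ) {z : ℂ} (hz : ‖z‖ ≤ 1) (θ : Circle) :
    (z, θ) ∈ τ.source :=
  hτ.subset_source ⟨by simpa using hz, mem_univ _⟩

theorem mem_core (hτ : IsContractionTube φ γ τ) (θ : Circle) : τ (0, θ) ∈ γ := by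
  rw [hτ.core]
  exact ⟨(0, θ), ⟨rfl, mem_univ _⟩, rfl⟩

theorem flow_core (hγ : γ ∈ closedOrbits F φ) (hτ : IsContractionTube φ γ τ) (t : ℝ)
    (θ : Circle) : φ t (τ (0, θ)) = τ (0, phase φ τ t θ) := by
  have h1 : φ t (τ (0, θ)) ∈ γ := by
    have h := hτ.mem_core θ
    obtain ⟨p, -, -, rfl⟩ := hγ
    obtain ⟨s, hs⟩ := h
    exact ⟨t + s, by rw [← hs]; exact φ.map_add _ _ _⟩
  rw [hτ.core] at h1
  obtain ⟨⟨z, θ'⟩, ⟨hz, -⟩, h⟩ := h1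
  obtain rfl : z = 0 := hz
  have h2 : phase φ τ t θ = θ' := by
    rw [phase, ← h, τ.left_inv (hτ.mem_source (by simp) θ')]
  rw [h2, h]

theorem phase_zero (hτ : IsContractionTube φ γ τ) (θ : Circle) : phase φ τ 0 θ = θ := by
  rw [phase, φ.map_zero_apply, τ.left_inv (hτ.mem_source (by simp) θ)]

theorem phase_add (hγ : γ ∈ closedOrbits F φ) (hτ : IsContractionTube φ γ τ) (s t : ℝ)
    (θ : Circle) : phase φ τ (s + t) θ = phase φ τ s (phase φ τ t θ) := by
  rw [phase, φ.map_add, hτ.flow_core hγ, phase]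
  rfl

theorem continuous_phase (hγ : γ ∈ closedOrbits F φ) (hτ : IsContractionTube φ γ τ) :
    Continuous fun x : ℝ × Circle => phase φ τ x.1 x.2 := by
  rw [continuous_iff_continuousAt]
  rintro ⟨t, θ⟩
  have h1 : ContinuousAt (fun x : ℝ × Circle => τ ((0 : ℂ), x.2)) (t, θ) :=
    ContinuousAt.comp (g := τ) (f := fun x : ℝ × Circle => ((0 : ℂ), x.2))
      (τ.continuousAt (hτ.mem_source (by simp) θ)) (by fun_prop)
  have h2 : ContinuousAt (fun x : ℝ × Circle => φ x.1 (τ ((0 : ℂ), x.2))) (t, θ) :=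
    ContinuousAt.comp (g := fun y : ℝ × M => φ y.1 y.2) φ.cont'.continuousAt
      (continuousAt_fst.prodMk h1)
  have h3 : φ t (τ (0, θ)) ∈ τ.target := by
    rw [hτ.flow_core hγ]
    exact τ.map_source (hτ.mem_source (by simp) _)
  exact continuousAt_snd.comp (ContinuousAt.comp (g := τ.symm)
    (f := fun x : ℝ × Circle => φ x.1 (τ ((0 : ℂ), x.2))) (τ.symm.continuousAt h3) h2)

theorem phase_injective (hγ : γ ∈ closedOrbits F φ) (hτ : IsContractionTube φ γ τ) (t : ℝ) :
    Function.Injective (phase φ τ t) := by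
  intro θ θ' h
  have := congrArg (phase φ τ (-t)) h
  rwa [← hτ.phase_add hγ, ← hτ.phase_add hγ, neg_add_cancel, hτ.phase_zero, hτ.phase_zero] at this

theorem exists_phase_eq (hγ : γ ∈ closedOrbits F φ) (hτ : IsContractionTube φ γ τ)
    (θ θ' : Circle) : ∃ t : ℝ, 0 ≤ t ∧ phase φ τ t θ = θ' := by
  have h := hτ.mem_core θ
  have h' := hτ.mem_core θ'
  have hγ' := hγ
  obtain ⟨p, -, ⟨T, hT, hTp⟩, rfl⟩ := hγ'
  obtain ⟨s, hs⟩ := h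
  obtain ⟨s', hs'⟩ := h'
  dsimp only at hs hs'
  have hper : ∀ n : ℕ, φ (n * T) p = p := by
    intro n
    induction n with
    | zero => simp [φ.map_zero_apply]
    | succ n ih =>
      have : ((n + 1 : ℕ) : ℝ) * T = n * T + T := by push_cast; ring
      rw [this, φ.map_add, hTp, ih]
  obtain ⟨n, hn⟩ := exists_nat_gt ((s - s') / T)
  rw [div_lt_iff₀ hT] at hn
  refine ⟨s' - s + n * T, by linarith, ?_⟩
  have : φ (s' - s + n * T) (τ (0, θ)) = τ (0, θ') := by
    rw [← hs, ← hs', ← φ.map_add]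
    have e : s' - s + n * T + s = s' + n * T := by ring
    rw [e, φ.map_add, hper]
  rw [phase, this, τ.left_inv (hτ.mem_source (by simp) θ')]

/-- `T` is the minimal period of the core of the tube. -/
def IsPeriod (φ : Flow ℝ M) (τ : OpenPartialHomeomorph (ℂ × Circle) M) (T : ℝ) : Prop :=
  0 < T ∧ ∀ θ t, phase φ τ t θ = θ ↔ ∃ k : ℤ, t = k * T

theorem phase_eq_self_iff (hγ : γ ∈ closedOrbits F φ) (hτ : IsContractionTube φ γ τ)
    (θ θ' : Circle) (t : ℝ) : phase φ τ t θ = θ ↔ phase φ τ t θ' = θ' := by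
  obtain ⟨s, -, rfl⟩ := hτ.exists_phase_eq hγ θ θ'
  rw [← hτ.phase_add hγ, add_comm, hτ.phase_add hγ]
  exact (hτ.phase_injective hγ s).eq_iff.symm

/-- The times that fix the phase `1` form a closed subgroup of `ℝ`. It is not dense, since the phase
also reaches the point `-1` of the circle, and not trivial, since the core returns after a positive
time; so it is cyclic. -/
theorem exists_isPeriod (hγ : γ ∈ closedOrbits F φ) (hτ : IsContractionTube φ γ τ) :
    ∃ T, IsPeriod φ τ T := by
  let H : AddSubgroup ℝ :=
    { carrier := {t | phase φ τ t 1 = 1}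
      zero_mem' := hτ.phase_zero 1
      add_mem' := by
        intro s t hs ht
        show phase φ τ (s + t) 1 = 1
        rw [hτ.phase_add hγ, ht, hs]
      neg_mem' := by
        intro t ht
        show phase φ τ (-t) 1 = 1
        have ht' : phase φ τ t 1 = 1 := ht
        calc phase φ τ (-t) 1 = phase φ τ (-t) (phase φ τ t 1) := by rw [ht']
          _ = 1 := by rw [← hτ.phase_add hγ, neg_add_cancel, hτ.phase_zero] }
  have hH : ∀ t, t ∈ H ↔ phase φ τ t 1 = 1 := fun t => Iff.rfl
  have hcl : IsClosed (H : Set ℝ) := by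
    have : Continuous fun t : ℝ => phase φ τ t 1 :=
      (hτ.continuous_phase hγ).comp (continuous_id.prodMk continuous_const)
    exact isClosed_eq this continuous_const
  have hne : ¬ Dense (H : Set ℝ) := by
    intro hd
    obtain ⟨t, -, ht⟩ := hτ.exists_phase_eq hγ 1 (Circle.exp Real.pi)
    have hmem : t ∈ (H : Set ℝ) := by
      rw [← hcl.closure_eq]; exact hd t
    have h1 : phase φ τ t 1 = 1 := hmem
    rw [h1] at ht
    have := congrArg (fun c : Circle => (c : ℂ)) ht
    simp [Circle.coe_exp] at this
    norm_num at this
  rcases H.dense_or_cyclic with h | ⟨a, ha⟩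
  · exact absurd h hne
  · have hmemH : ∀ t, t ∈ H ↔ ∃ k : ℤ, t = k * a := by
      intro t
      rw [ha, AddSubgroup.mem_closure_singleton]
      simp only [zsmul_eq_mul, eq_comm]
    have ha0 : a ≠ 0 := by
      rintro rfl
      obtain ⟨t, ht, h1⟩ := hτ.exists_phase_eq hγ (phase φ τ 1 1) 1
      rw [← hτ.phase_add hγ] at h1
      obtain ⟨k, hk⟩ := (hmemH _).1 h1
      simp at hk
      linarith
    refine ⟨|a|, abs_pos.2 ha0, fun θ t => ?_⟩
    rw [hτ.phase_eq_self_iff hγ θ 1, ← hH, hmemH]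
    rcases abs_choice a with h | h
    · rw [h]
    · rw [h]
      constructor
      · rintro ⟨k, rfl⟩
        exact ⟨-k, by push_cast; ring⟩
      · rintro ⟨k, rfl⟩
        exact ⟨-k, by push_cast; ring⟩

theorem flow_tube (hτ : IsContractionTube φ γ τ) {t : ℝ} (ht : 0 ≤ t) (θ : Circle) {z : ℂ}
    (hz : ‖z‖ ≤ 1) :
    φ t (τ (z, θ)) = τ (sliceMap φ τ t θ z, phase φ τ t θ) ∧ ‖sliceMap φ τ t θ z‖ ≤ 1 := by
  obtain ⟨z', hz', h⟩ := hτ.mapsTo t ht θ z (by simpa using hz)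
  have hz'' : ‖z'‖ ≤ 1 := by simpa using hz'
  have h2 : sliceMap φ τ t θ z = z' := by
    rw [sliceMap, h, τ.left_inv (hτ.mem_source hz'' _)]
  rw [h2]
  exact ⟨h, hz''⟩

theorem sliceMap_zero_right (hγ : γ ∈ closedOrbits F φ) (hτ : IsContractionTube φ γ τ) (t : ℝ)
    (θ : Circle) : sliceMap φ τ t θ 0 = 0 := by
  rw [sliceMap, hτ.flow_core hγ, τ.left_inv (hτ.mem_source (by simp) _)]

theorem norm_sliceMap_lt (hγ : γ ∈ closedOrbits F φ) (hτ : IsContractionTube φ γ τ) {t : ℝ}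
    (ht : 0 < t) (θ : Circle) {z : ℂ} (hz : ‖z‖ ≤ 1) (hz0 : z ≠ 0) :
    ‖sliceMap φ τ t θ z‖ < ‖z‖ := by
  have := hτ.contraction t ht θ z (by simpa using hz) 0 (by simp) hz0
  rwa [hτ.sliceMap_zero_right hγ, dist_zero_right, dist_zero_right] at this

theorem norm_sliceMap_le (hγ : γ ∈ closedOrbits F φ) (hτ : IsContractionTube φ γ τ) {t : ℝ}
    (ht : 0 ≤ t) (θ : Circle) {z : ℂ} (hz : ‖z‖ ≤ 1) : ‖sliceMap φ τ t θ z‖ ≤ ‖z‖ := by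
  rcases ht.eq_or_lt with rfl | ht
  · rw [sliceMap, φ.map_zero_apply, τ.left_inv (hτ.mem_source hz _)]
  · by_cases hz0 : z = 0
    · rw [hz0, hτ.sliceMap_zero_right hγ]
    · exact (hτ.norm_sliceMap_lt hγ ht θ hz hz0).le

theorem norm_sliceMap_lt_one (hγ : γ ∈ closedOrbits F φ) (hτ : IsContractionTube φ γ τ) {t : ℝ}
    (ht : 0 < t) (θ : Circle) {z : ℂ} (hz : ‖z‖ ≤ 1) : ‖sliceMap φ τ t θ z‖ < 1 := by
  by_cases hz0 : z = 0
  · rw [hz0, hτ.sliceMap_zero_right hγ]; simp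
  · exact (hτ.norm_sliceMap_lt hγ ht θ hz hz0).trans_le hz

theorem flow_slices (hγ : γ ∈ closedOrbits F φ) (hτ : IsContractionTube φ γ τ) {t : ℝ}
    (ht : 0 ≤ t) (θ : Circle) {z : ℂ} (hz : z ∈ ball (0 : ℂ) 1) :
    ∃ z' ∈ ball (0 : ℂ) 1, φ t (τ (z, θ)) = τ (z', phase φ τ t θ) := by
  rw [mem_ball_zero_iff] at hz
  refine ⟨_, ?_, (hτ.flow_tube ht θ hz.le).1⟩
  rw [mem_ball_zero_iff]
  exact (hτ.norm_sliceMap_le hγ ht θ hz.le).trans_lt hz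

theorem continuousAt_sliceMap (hτ : IsContractionTube φ γ τ) {t : ℝ} (ht : 0 ≤ t) (θ : Circle)
    {z : ℂ} (hz : ‖z‖ ≤ 1) : ContinuousAt (sliceMap φ τ t θ) z := by
  have h1 : ContinuousAt (fun w : ℂ => τ (w, θ)) z :=
    ContinuousAt.comp (g := τ) (f := fun w : ℂ => (w, θ)) (τ.continuousAt (hτ.mem_source hz θ))
      (by fun_prop)
  have h2 : ContinuousAt (fun w : ℂ => φ t (τ (w, θ))) z :=
    ContinuousAt.comp (g := φ t) (f := fun w : ℂ => τ (w, θ))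
      (φ.continuous continuous_const continuous_id).continuousAt h1
  have h3 : φ t (τ (z, θ)) ∈ τ.target := by
    obtain ⟨h, h'⟩ := hτ.flow_tube ht θ hz
    rw [h]
    exact τ.map_source (hτ.mem_source h' _)
  exact continuousAt_fst.comp (ContinuousAt.comp (g := τ.symm)
    (f := fun w : ℂ => φ t (τ (w, θ))) (τ.symm.continuousAt h3) h2)

section Return

variable {T : ℝ}

omit [ChartedSpace (EuclideanSpace ℝ (Fin 3)) M] in
theorem IsPeriod.phase_eq (hT : IsPeriod φ τ T) (θ : Circle) : phase φ τ T θ = θ :=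
  (hT.2 θ T).2 ⟨1, by simp⟩

theorem norm_iterate_sliceMap_le (hτ : IsContractionTube φ γ τ) (hT : IsPeriod φ τ T)
    (θ : Circle) {z : ℂ} (hz : ‖z‖ ≤ 1) (n : ℕ) : ‖(sliceMap φ τ T θ)^[n] z‖ ≤ 1 := by
  induction n with
  | zero => exact hz
  | succ n ih =>
    rw [Function.iterate_succ_apply']
    exact (hτ.flow_tube hT.1.le θ ih).2

theorem flow_nat_mul_period (hτ : IsContractionTube φ γ τ) (hT : IsPeriod φ τ T)
    (θ : Circle) {z : ℂ} (hz : ‖z‖ ≤ 1) (n : ℕ) :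
    φ (n * T) (τ (z, θ)) = τ ((sliceMap φ τ T θ)^[n] z, θ) := by
  induction n with
  | zero => simp [φ.map_zero_apply]
  | succ n ih =>
    have : ((n + 1 : ℕ) : ℝ) * T = T + n * T := by push_cast; ring
    rw [this, φ.map_add, ih, Function.iterate_succ_apply',
      (hτ.flow_tube hT.1.le θ (hτ.norm_iterate_sliceMap_le hT θ hz n)).1, hT.phase_eq]

theorem tendsto_iterate_sliceMap (hγ : γ ∈ closedOrbits F φ) (hτ : IsContractionTube φ γ τ)
    (hT : IsPeriod φ τ T) (θ : Circle) {z : ℂ} (hz : ‖z‖ ≤ 1) :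
    Tendsto (fun n : ℕ => (sliceMap φ τ T θ)^[n] z) atTop (𝓝 0) := by
  refine tendsto_iterate_zero_of_norm_lt (ρ := 1) ?_ ?_ (hτ.sliceMap_zero_right hγ T θ) ?_
    (by simpa using hz)
  · intro w hw
    exact (hτ.continuousAt_sliceMap hT.1.le θ (by simpa using hw)).continuousWithinAt
  · intro w hw
    simpa using (hτ.flow_tube hT.1.le θ (by simpa using hw)).2
  · intro w hw hw0
    exact hτ.norm_sliceMap_lt hγ hT.1 θ (by simpa using hw) hw0

theorem tendsto_flow_nat_mul_period (hγ : γ ∈ closedOrbits F φ) (hτ : IsContractionTube φ γ τ)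
    (hT : IsPeriod φ τ T) (θ : Circle) {z : ℂ} (hz : ‖z‖ ≤ 1) :
    Tendsto (fun n : ℕ => φ (n * T) (τ (z, θ))) atTop (𝓝 (τ (0, θ))) := by
  have h1 : ContinuousAt (fun w : ℂ => τ (w, θ)) 0 :=
    ContinuousAt.comp (g := τ) (f := fun w : ℂ => (w, θ))
      (τ.continuousAt (hτ.mem_source (by simp) θ)) (by fun_prop)
  refine (h1.tendsto.comp (hτ.tendsto_iterate_sliceMap hγ hT θ hz)).congr fun n => ?_
  exact (hτ.flow_nat_mul_period hT θ hz n).symm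

end Return

variable [T2Space M] [CompactSpace M]

/-- A non-transverse compact leaf is closed and invariant. If it met a disc, it would contain the
limit of the returns, a point of the core, but the core lies in `M₀`. -/
theorem mem_transverseRegion (hS : IsFDS F φ) (hγ : γ ∈ closedOrbits F φ)
    (hτ : IsContractionTube φ γ τ) {z : ℂ} (hz : ‖z‖ ≤ 1) (θ : Circle) :
    τ (z, θ) ∈ transverseRegion F φ := by
  have hcore : τ (0, θ) ∈ transverseRegion F φ := by
    have h := hτ.mem_core θ
    obtain ⟨p, hp, -, rfl⟩ := hγ
    obtain ⟨s, hs⟩ := h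
    rw [← hs]
    exact ComplexFoliation.flow_mem_transverseRegion hS hp s
  rintro ⟨L, hL, hmem⟩
  refine hcore ⟨L, hL, ?_⟩
  obtain ⟨T, hT⟩ := hτ.exists_isPeriod hγ
  refine hL.2.1.isClosed.mem_of_tendsto (hτ.tendsto_flow_nat_mul_period hγ hT θ hz)
    (Eventually.of_forall fun n => ?_)
  rw [← ComplexFoliation.image_eq_of_mem_nonTransverseLeaves hS hL (n * T)]
  exact ⟨_, hmem, rfl⟩

end IsContractionTube

/-! ### The discs of the tube are tangent to the foliation. -/

namespace ComplexFoliation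

variable {M : Type*} [TopologicalSpace M] [CompactSpace M]
  [ChartedSpace (EuclideanSpace ℝ (Fin 3)) M] {F : ComplexFoliation M} {φ : Flow ℝ M}

omit [CompactSpace M] in
theorem contDiffAt_height_flow (hφs : IsSmoothFlow φ) {e : OpenPartialHomeomorph M (ℂ × ℝ)}
    (he : e ∈ F.atlas) {p : M} {t : ℝ} (hp : φ t p ∈ e.source) :
    ContDiffAt ℝ ∞ (fun s => (e (φ s p)).2) t := by
  rw [← contMDiffAt_iff_contDiffAt]
  have h4 : ContMDiffAt (𝓡 3) 𝓘(ℝ, ℂ × ℝ) ∞ e (φ t p) :=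
    (F.smooth e he).contMDiffAt (e.open_source.mem_nhds hp)
  have h5 : ContMDiffAt 𝓘(ℝ, ℝ) 𝓘(ℝ, ℂ × ℝ) ∞ (fun s => e (φ s p)) t :=
    ContMDiffAt.comp t h4 (hφs.contMDiff_curve p).contMDiffAt
  have h6 : ContMDiffAt 𝓘(ℝ, ℂ × ℝ) 𝓘(ℝ, ℝ) ∞ (Prod.snd : ℂ × ℝ → ℝ) (e (φ t p)) :=
    contDiff_snd.contMDiff.contMDiffAt
  exact ContMDiffAt.comp t h6 h5

/-- Near a transverse closed orbit, the first return preserves the plaques. -/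
theorem eventually_height_flow_period (hS : IsFDS F φ) {p : M} (hp : p ∈ transverseRegion F φ)
    {T : ℝ} (hT : φ T p = p) {e : OpenPartialHomeomorph M (ℂ × ℝ)} (he : e ∈ F.atlas)
    (hpe : p ∈ e.source) :
    ∀ᶠ q in 𝓝 p, q ∈ e.source ∧ (e (φ T q)).2 = (e q).2 := by
  have hp' : φ T p ∈ e.source := by rwa [hT]
  obtain ⟨k, -, hev⟩ := exists_transverse_eq hS.smooth hS.leaf_to_leaf he he hpe hp'
  have hc : ContinuousAt (fun q : M => (T, q)) p := by fun_prop
  have hev' := hc.eventually hev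
  have hp0 : φ 0 p ∈ e.source := by rwa [φ.map_zero_apply]
  have hstrict := (contDiffAt_height_flow hS.smooth he hp0).hasStrictDerivAt (by simp)
  have hderiv := hS.smooth.hasDerivAt_comp (t := 0) (q := p) (mdifferentiableAt_height he hp0)
  rw [φ.map_zero_apply] at hderiv
  have hne : deriv (fun s => (e (φ s p)).2) 0 ≠ 0 := by
    rw [hderiv.deriv]
    exact heightDeriv_velocity_ne_zero hS hp he hpe
  have hmap := hstrict.map_nhds_eq hne
  have hflow : Tendsto (fun s => φ s p) (𝓝 0) (𝓝 p) := by
    have : ContinuousAt (fun s => φ s p) 0 := (hS.smooth.contMDiff_curve p).continuous.continuousAt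
    simpa only [ContinuousAt, φ.map_zero_apply] using this
  -- Along the orbit of `p` the height has nonzero speed, so it takes all values near that of `p`.
  -- The points of this orbit are fixed by `φ T`, hence their heights are fixed by `k (T, ·)`.
  have hk : ∀ᶠ ξ in 𝓝 (e p).2, k (T, ξ) = ξ := by
    have h0 : (e p).2 = (fun s => (e (φ s p)).2) 0 := by simp only [φ.map_zero_apply]
    rw [h0, ← hmap, eventually_map]
    filter_upwards [hflow.eventually hev'] with s hs
    rw [← hs.2.2, ← φ.map_add, add_comm, φ.map_add, hT]
  filter_upwards [hev', (continuousAt_snd.comp (e.continuousAt hpe)).eventually hk] with q h1 h2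
  refine ⟨h1.1, ?_⟩
  rw [h1.2.2]
  exact h2

end ComplexFoliation

namespace IsContractionTube

open ComplexFoliation

variable {M : Type*} [TopologicalSpace M] [ChartedSpace (EuclideanSpace ℝ (Fin 3)) M]
  {F : ComplexFoliation M} {φ : Flow ℝ M} {γ : Set M}
  {τ : OpenPartialHomeomorph (ℂ × Circle) M}

theorem continuousAt_tube_left (hτ : IsContractionTube φ γ τ) {z : ℂ} (hz : ‖z‖ ≤ 1) (θ : Circle) :
    ContinuousAt (fun w : ℂ => τ (w, θ)) z :=
  ContinuousAt.comp (g := τ) (f := fun w : ℂ => (w, θ)) (τ.continuousAt (hτ.mem_source hz θ))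
    (by fun_prop)

variable [T2Space M] [CompactSpace M]

/-- Near the centre the return map keeps the height and does not increase the norm, so all iterates
of `w` have the height of `w`; they converge to the centre. -/
theorem eventually_height_tube_core (hS : IsFDS F φ) (hγ : γ ∈ closedOrbits F φ)
    (hτ : IsContractionTube φ γ τ) (θ : Circle) {e : OpenPartialHomeomorph M (ℂ × ℝ)}
    (he : e ∈ F.atlas) (h : τ (0, θ) ∈ e.source) :
    ∀ᶠ w in 𝓝 (0 : ℂ), τ (w, θ) ∈ e.source ∧ (e (τ (w, θ))).2 = (e (τ (0, θ))).2 := by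
  obtain ⟨T, hT⟩ := hτ.exists_isPeriod hγ
  have hper : φ T (τ (0, θ)) = τ (0, θ) := by rw [hτ.flow_core hγ, hT.phase_eq]
  have hev := eventually_height_flow_period hS (hτ.mem_transverseRegion hS hγ (by simp) θ) hper
    he h
  have hc := hτ.continuousAt_tube_left (z := 0) (by simp) θ
  obtain ⟨r, hr, hball⟩ := Metric.eventually_nhds_iff_ball.1 (hc.eventually hev)
  filter_upwards [ball_mem_nhds (0 : ℂ) hr, ball_mem_nhds (0 : ℂ) one_pos] with w hwr hw1
  refine ⟨(hball w hwr).1, ?_⟩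
  rw [mem_ball_zero_iff] at hwr hw1
  have hsmall : ∀ n : ℕ, ‖(sliceMap φ τ T θ)^[n] w‖ < r := by
    intro n
    induction n with
    | zero => exact hwr
    | succ n ih =>
      rw [Function.iterate_succ_apply']
      exact (hτ.norm_sliceMap_le hγ hT.1.le θ
        (hτ.norm_iterate_sliceMap_le hT θ hw1.le n)).trans_lt ih
  have hconst : ∀ n : ℕ, (e (φ (n * T) (τ (w, θ)))).2 = (e (τ (w, θ))).2 := by
    intro n
    induction n with
    | zero => simp [φ.map_zero_apply]
    | succ n ih =>
      have e1 : ((n + 1 : ℕ) : ℝ) * T = T + n * T := by push_cast; ring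
      rw [e1, φ.map_add, ← ih, hτ.flow_nat_mul_period hT θ hw1.le]
      exact (hball _ (by rw [mem_ball_zero_iff]; exact hsmall n)).2
  have hlim := (continuousAt_snd.comp (e.continuousAt h)).tendsto.comp
    (hτ.tendsto_flow_nat_mul_period hγ hT θ hw1.le)
  refine tendsto_nhds_unique (tendsto_const_nhds.congr fun n => ?_) hlim
  exact (hconst n).symm

/-- The discs of the tube are tangent to the foliation. -/
theorem eventually_height_tube (hS : IsFDS F φ) (hγ : γ ∈ closedOrbits F φ)
    (hτ : IsContractionTube φ γ τ) {z : ℂ} (hz : ‖z‖ < 1) (θ : Circle)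
    {e : OpenPartialHomeomorph M (ℂ × ℝ)} (he : e ∈ F.atlas) (h : τ (z, θ) ∈ e.source) :
    ∀ᶠ w in 𝓝 z, (e (τ (w, θ))).2 = (e (τ (z, θ))).2 := by
  obtain ⟨T, hT⟩ := hτ.exists_isPeriod hγ
  obtain ⟨e₀, he₀, h₀⟩ := F.cover (τ (0, θ))
  have hcore := hτ.eventually_height_tube_core hS hγ θ he₀ h₀
  -- After `n` periods the point is so close to the core that `eventually_height_tube_core` applies
  -- around it. Flowing back by `-(n * T)` carries plaques into plaques, which transfers the
  -- statement to `z`.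
  obtain ⟨n, hn⟩ := ((hτ.tendsto_iterate_sliceMap hγ hT θ hz.le).eventually
    (eventually_eventually_nhds.2 hcore)).exists
  have hq : φ (n * T) (τ (z, θ)) = τ ((sliceMap φ τ T θ)^[n] z, θ) :=
    hτ.flow_nat_mul_period hT θ hz.le n
  have hback : φ (-(n * T)) (φ (n * T) (τ (z, θ))) = τ (z, θ) := by
    rw [← φ.map_add, neg_add_cancel, φ.map_zero_apply]
  have hq0 : φ (n * T) (τ (z, θ)) ∈ e₀.source := by
    rw [hq]; exact hn.self_of_nhds.1
  obtain ⟨k, -, hk⟩ := exists_transverse_eq hS.smooth hS.leaf_to_leaf he₀ he hq0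
    (by rwa [hback] : φ (-(n * T)) (φ (n * T) (τ (z, θ))) ∈ e.source)
  have hnT : (0 : ℝ) ≤ n * T := mul_nonneg n.cast_nonneg hT.1.le
  have hc1 : ContinuousAt (fun w : ℂ => φ (n * T) (τ (w, θ))) z :=
    ContinuousAt.comp (g := φ (n * T)) (f := fun w : ℂ => τ (w, θ))
      (φ.continuous continuous_const continuous_id).continuousAt
      (hτ.continuousAt_tube_left hz.le θ)
  have hc2 : ContinuousAt (fun w : ℂ => (-(n * T), φ (n * T) (τ (w, θ)))) z :=
    continuousAt_const.prodMk hc1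
  have hit : Tendsto (fun w : ℂ => (sliceMap φ τ T θ)^[n] w) (𝓝 z)
      (𝓝 ((sliceMap φ τ T θ)^[n] z)) := by
    have hmem : τ.symm (φ (n * T) (τ (z, θ))) = ((sliceMap φ τ T θ)^[n] z, θ) := by
      rw [hq, τ.left_inv (hτ.mem_source (hτ.norm_iterate_sliceMap_le hT θ hz.le n) θ)]
    have ht : φ (n * T) (τ (z, θ)) ∈ τ.target := by
      rw [hq]
      exact τ.map_source (hτ.mem_source (hτ.norm_iterate_sliceMap_le hT θ hz.le n) θ)
    have h3 : ContinuousAt (fun w : ℂ => (τ.symm (φ (n * T) (τ (w, θ)))).1) z :=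
      continuousAt_fst.comp (ContinuousAt.comp (g := τ.symm)
        (f := fun w : ℂ => φ (n * T) (τ (w, θ))) (τ.symm.continuousAt ht) hc1)
    have h4 := h3.tendsto
    rw [hmem] at h4
    refine h4.congr' ?_
    filter_upwards [isOpen_ball.mem_nhds (mem_ball_zero_iff.2 hz)] with w hw
    rw [mem_ball_zero_iff] at hw
    rw [hτ.flow_nat_mul_period hT θ hw.le,
      τ.left_inv (hτ.mem_source (hτ.norm_iterate_sliceMap_le hT θ hw.le n) θ)]
  have hval : ∀ᶠ w in 𝓝 z, (e (τ (w, θ))).2 = k (-(n * T), (e₀ (τ (0, θ))).2) := by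
    filter_upwards [hc2.eventually hk, hit.eventually hn,
      isOpen_ball.mem_nhds (mem_ball_zero_iff.2 hz)] with w h1 h2 h3
    rw [mem_ball_zero_iff] at h3
    have h4 := h1.2.2
    rw [← φ.map_add, neg_add_cancel, φ.map_zero_apply, hτ.flow_nat_mul_period hT θ h3.le,
      h2.2] at h4
    exact h4
  filter_upwards [hval] with w hw
  rw [hw, hval.self_of_nhds]

/-- The neighbourhood found in `eventually_height_tube` depends on the phase. A uniform ball is
obtained from connectedness: for each phase nearby, the height is locally constant on the ball. -/
theorem eventually_height_tube_prod (hS : IsFDS F φ) (hγ : γ ∈ closedOrbits F φ)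
    (hτ : IsContractionTube φ γ τ) {z : ℂ} (hz : ‖z‖ < 1) (θ : Circle)
    {e : OpenPartialHomeomorph M (ℂ × ℝ)} (he : e ∈ F.atlas) (h : τ (z, θ) ∈ e.source) :
    ∀ᶠ y : ℂ × Circle in 𝓝 (z, θ), τ y ∈ e.source ∧ (e (τ y)).2 = (e (τ (z, y.2))).2 := by
  have hsrc : ∀ᶠ y : ℂ × Circle in 𝓝 (z, θ), τ y ∈ e.source :=
    (τ.continuousAt (hτ.mem_source hz.le θ)).eventually (e.open_source.mem_nhds h)
  rw [nhds_prod_eq] at hsrc ⊢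
  obtain ⟨P, hP, Q, hQ, hPQ⟩ := eventually_prod_iff.1 hsrc
  obtain ⟨r, hr, hball⟩ := Metric.eventually_nhds_iff_ball.1
    (hP.and (isOpen_ball.mem_nhds (mem_ball_zero_iff.2 hz)))
  have hr' : ∀ᶠ w in 𝓝 z, w ∈ ball z r := ball_mem_nhds z hr
  filter_upwards [hr'.prod_mk hQ] with y hy
  obtain ⟨hy1, hy2⟩ := hy
  refine ⟨hPQ (hball _ hy1).1 hy2, ?_⟩
  refine (convex_ball z r).isPreconnected.induction₂'
    (fun w w' => (e (τ (w, y.2))).2 = (e (τ (w', y.2))).2) ?_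
    (fun _ _ _ _ _ _ h1 h2 => h1.trans h2) hy1 (mem_ball_self hr)
  intro w hw
  have hw1 : ‖w‖ < 1 := mem_ball_zero_iff.1 (hball w hw).2
  refine eventually_nhdsWithin_of_eventually_nhds ?_
  filter_upwards [hτ.eventually_height_tube hS hγ hw1 y.2 he (hPQ (hball w hw).1 hy2)] with w' hw'
  exact ⟨hw'.symm, hw'⟩

/-- A flow that carries discs of the tube into discs with the phase of `φ` has the transverse
speed of `φ`. -/
theorem heightDeriv_velocity_eq_of_slices (hS : IsFDS F φ) (hγ : γ ∈ closedOrbits F φ)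
    (hτ : IsContractionTube φ γ τ) {φ' : Flow ℝ M} (hφs' : IsSmoothFlow φ')
    (hsl : ∀ t : ℝ, 0 ≤ t → ∀ θ : Circle, ∀ z ∈ ball (0 : ℂ) 1,
      ∃ z' ∈ ball (0 : ℂ) 1, φ' t (τ (z, θ)) = τ (z', phase φ τ t θ))
    {z : ℂ} (hz : ‖z‖ < 1) (θ : Circle)
    {e : OpenPartialHomeomorph M (ℂ × ℝ)} (he : e ∈ F.atlas) (h : τ (z, θ) ∈ e.source) :
    heightDeriv e (τ (z, θ)) (velocity φ' (τ (z, θ))) =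
      heightDeriv e (τ (z, θ)) (velocity φ (τ (z, θ))) := by
  have hprod := hτ.eventually_height_tube_prod hS hγ hz θ he h
  have hev : ∀ ψ : Flow ℝ M, (∀ t : ℝ, 0 ≤ t → ∀ θ : Circle, ∀ z ∈ ball (0 : ℂ) 1,
      ∃ z' ∈ ball (0 : ℂ) 1, ψ t (τ (z, θ)) = τ (z', phase φ τ t θ)) →
      ∀ᶠ t in 𝓝[≥] (0 : ℝ), (e (ψ t (τ (z, θ)))).2 = (e (τ (z, phase φ τ t θ))).2 := by
    intro ψ hψ
    have hc : Tendsto (fun t : ℝ => τ.symm (ψ t (τ (z, θ)))) (𝓝 0) (𝓝 (z, θ)) := by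
      have h1 : Tendsto (fun t : ℝ => ψ t (τ (z, θ))) (𝓝 0) (𝓝 (τ (z, θ))) := by
        have : ContinuousAt (fun t : ℝ => ψ t (τ (z, θ))) 0 :=
          (ψ.continuous continuous_id continuous_const).continuousAt
        simpa only [ContinuousAt, ψ.map_zero_apply] using this
      have h2 := (τ.symm.continuousAt (τ.map_source (hτ.mem_source hz.le θ))).tendsto.comp h1
      rwa [τ.left_inv (hτ.mem_source hz.le θ)] at h2
    filter_upwards [nhdsWithin_le_nhds (hc.eventually hprod), self_mem_nhdsWithin] with t h1 h2
    obtain ⟨z', hz', hψz⟩ := hψ t h2 θ z (mem_ball_zero_iff.2 hz)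
    rw [hψz, τ.left_inv (hτ.mem_source (mem_ball_zero_iff.1 hz').le _)] at h1
    rw [hψz]
    exact h1.2
  -- The discs are controlled for nonnegative times only, so the velocities are compared through
  -- one-sided derivatives at `0`.
  have hd : ∀ ψ : Flow ℝ M, IsSmoothFlow ψ → HasDerivWithinAt (fun t => (e (ψ t (τ (z, θ)))).2)
      (heightDeriv e (τ (z, θ)) (velocity ψ (τ (z, θ)))) (Ici 0) 0 := by
    intro ψ hψ
    have := hψ.hasDerivAt_comp (t := 0) (q := τ (z, θ)) (X := fun q => (e q).2)
      (by rw [ψ.map_zero_apply]; exact mdifferentiableAt_height he h)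
    rw [ψ.map_zero_apply] at this
    exact this.hasDerivWithinAt
  have hsl' := fun t (ht : (0 : ℝ) ≤ t) θ z hz => hτ.flow_slices hγ ht θ (z := z) hz
  have heq : (fun t => (e (φ' t (τ (z, θ)))).2) =ᶠ[𝓝[≥] 0] fun t => (e (φ t (τ (z, θ)))).2 := by
    filter_upwards [hev φ' hsl, hev φ hsl'] with t h1 h2
    rw [h1, h2]
  have h1 := (hd φ hS.smooth).congr_of_eventuallyEq heq
    (by simp only [φ.map_zero_apply, φ'.map_zero_apply])
  exact (uniqueDiffWithinAt_Ici (0 : ℝ)).eq_deriv _ (hd φ' hφs') h1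

end IsContractionTube

theorem IsSuspensionReplacement.heightDeriv_velocity_eq {M : Type*} [TopologicalSpace M]
    [ChartedSpace (EuclideanSpace ℝ (Fin 3)) M] [T2Space M] [CompactSpace M]
    {F : ComplexFoliation M} {φ : Flow ℝ M} {γ : Set M}
    {τ : OpenPartialHomeomorph (ℂ × Circle) M} {h : ℂ → ℂ} {φ' : Flow ℝ M} (hS : IsFDS F φ)
    (hγ : γ ∈ closedOrbits F φ) (hτ : IsContractionTube φ γ τ)
    (h' : IsSuspensionReplacement φ τ h φ') (e : OpenPartialHomeomorph M (ℂ × ℝ))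
    (he : e ∈ F.atlas) (p : M) (hp : p ∈ e.source) :
    heightDeriv e p (velocity φ' p) = heightDeriv e p (velocity φ p) := by
  by_cases hmem : p ∈ openTube τ
  · obtain ⟨⟨z, θ⟩, ⟨hz, -⟩, rfl⟩ := hmem
    exact hτ.heightDeriv_velocity_eq_of_slices hS hγ h'.smooth h'.slices
      (mem_ball_zero_iff.1 hz) θ he hp
  · rw [h'.outside p hmem]

/-! ### Periodic points of the horseshoe. -/

/-- The periodic points of `h` in the open unit disc. -/
def discPeriodicPts (h : ℂ → ℂ) : Set ℂ :=
  {z | z ∈ ball (0 : ℂ) 1 ∧ ∃ k : ℕ, 0 < k ∧ h^[k] z = z}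

namespace IsHorseshoe

variable {h : ℂ → ℂ}

theorem mem_ball_of_iterate_eq (hh : IsHorseshoe h) {z : ℂ} (hz : z ∈ closedBall (0 : ℂ) 1)
    {k : ℕ} (hk : 0 < k) (hkz : h^[k] z = z) : z ∈ ball (0 : ℂ) 1 := by
  obtain ⟨m, rfl⟩ := Nat.exists_eq_succ_of_ne_zero hk.ne'
  rw [← hkz, Function.iterate_succ_apply']
  have hm : MapsTo h (closedBall (0 : ℂ) 1) (closedBall (0 : ℂ) 1) :=
    fun w hw => ball_subset_closedBall (hh.mapsTo hw)
  exact hh.mapsTo (hm.iterate m hz)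

/-- In the square the horseshoe is a product on each strip, so a point with the itinerary "`n` times
the first strip, once the second" can be found coordinate by coordinate, as fixed points of interval
maps: the horizontal coordinate forwards in time, the vertical one backwards. -/
theorem infinite_discPeriodicPts (hh : IsHorseshoe h) : (discPeriodicPts h).Infinite := by
  obtain ⟨κ, A, B, s, a, b, x₀, x₁, y₀, y₁, -, hκi, -, hκm, -, -, ha, hb, hy0, hy01, hy1, hx0,
    hx0', hx1, hx1', -, hs0, hs1, -⟩ := hh.horseshoe
  have hb' : 0 < b⁻¹ := inv_pos.2 hb
  -- `f₀`, `f₁` are the horizontal actions on the two strips; `g₀`, `g₁` are the inverses of the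
  -- vertical expansions, so that all four map `[0, 1]` into itself.
  set f₀ : ℝ → ℝ := fun x => x₀ + a * x with hf₀
  set f₁ : ℝ → ℝ := fun x => x₁ + a * (1 - x) with hf₁
  set g₀ : ℝ → ℝ := fun y => y₀ + b⁻¹ * y with hg₀
  set g₁ : ℝ → ℝ := fun y => y₁ + b⁻¹ * (1 - y) with hg₁
  have f₀m : MapsTo f₀ (Icc 0 1) (Icc 0 1) := by
    rintro x ⟨h1, h2⟩
    constructor <;> simp only [hf₀] <;> nlinarith
  have f₁m : MapsTo f₁ (Icc 0 1) (Icc 0 1) := by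
    rintro x ⟨h1, h2⟩
    constructor <;> simp only [hf₁] <;> nlinarith
  have g₀m' : MapsTo g₀ (Icc 0 1) (Icc y₀ (y₀ + b⁻¹)) := by
    rintro x ⟨h1, h2⟩
    constructor <;> simp only [hg₀] <;> nlinarith
  have g₁m' : MapsTo g₁ (Icc 0 1) (Icc y₁ (y₁ + b⁻¹)) := by
    rintro x ⟨h1, h2⟩
    constructor <;> simp only [hg₁] <;> nlinarith
  have g₀m : MapsTo g₀ (Icc 0 1) (Icc 0 1) := fun y hy => by
    obtain ⟨h1, h2⟩ := g₀m' hy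
    constructor <;> linarith
  have g₁m : MapsTo g₁ (Icc 0 1) (Icc 0 1) := fun y hy => by
    obtain ⟨h1, h2⟩ := g₁m' hy
    constructor <;> linarith
  have H₀ : ∀ x ∈ Icc (0 : ℝ) 1, ∀ y ∈ Icc (0 : ℝ) 1, h (κ (x, g₀ y)) = κ (f₀ x, y) := by
    intro x hx y hy
    rw [hs0 x hx _ (g₀m' hy)]
    congr 2
    simp only [hg₀]
    field_simp
    ring
  have H₁ : ∀ x ∈ Icc (0 : ℝ) 1, ∀ y ∈ Icc (0 : ℝ) 1, h (κ (x, g₁ y)) = κ (f₁ x, y) := by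
    intro x hx y hy
    rw [hs1 x hx _ (g₁m' hy)]
    congr 2
    simp only [hg₁]
    field_simp
    ring
  have Hit : ∀ (j m : ℕ), ∀ x ∈ Icc (0 : ℝ) 1, ∀ y ∈ Icc (0 : ℝ) 1,
      h^[j] (κ (x, g₀^[j + m] y)) = κ (f₀^[j] x, g₀^[m] y) := by
    intro j
    induction j with
    | zero => intro m x _ y _; simp
    | succ j ih =>
      intro m x hx y hy
      have e1 : j + 1 + m = (j + m) + 1 := by ring
      rw [Function.iterate_succ_apply, e1, Function.iterate_succ_apply',
        H₀ x hx _ (g₀m.iterate _ hy), ih m _ (f₀m hx) y hy, Function.iterate_succ_apply]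
  have f₀c : Continuous f₀ := by fun_prop
  have f₁c : Continuous f₁ := by fun_prop
  have g₀c : Continuous g₀ := by fun_prop
  have g₁c : Continuous g₁ := by fun_prop
  have hx : ∀ n : ℕ, ∃ x ∈ Icc (0 : ℝ) 1, f₁ (f₀^[n] x) = x := by
    intro n
    obtain ⟨x, hx, hfix⟩ := exists_mem_Icc_isFixedPt_of_mapsTo
      (f₁c.comp (f₀c.iterate n)).continuousOn zero_le_one (f₁m.comp (f₀m.iterate n))
    exact ⟨x, hx, hfix⟩
  have hy : ∀ n : ℕ, ∃ y ∈ Icc (0 : ℝ) 1, g₀^[n] (g₁ y) = y := by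
    intro n
    obtain ⟨x, hx, hfix⟩ := exists_mem_Icc_isFixedPt_of_mapsTo
      ((g₀c.iterate n).comp g₁c).continuousOn zero_le_one ((g₀m.iterate n).comp g₁m)
    exact ⟨x, hx, hfix⟩
  choose X hX hXf using hx
  choose Y hY hYf using hy
  have hiter : ∀ n j m : ℕ, j + m = n → h^[j] (κ (X n, Y n)) = κ (f₀^[j] (X n), g₀^[m] (g₁ (Y n))) := by
    rintro n j m rfl
    have := Hit j m (X _) (hX (j + m)) (g₁ (Y (j + m))) (g₁m (hY _))
    rwa [hYf] at this
  -- At time `n` the point with index `n` lies in the second strip, whereas a point with larger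
  -- index still lies in the first.
  have hne : ∀ n m : ℕ, n < m → κ (X n, Y n) ≠ κ (X m, Y m) := by
    intro n m hnm heq
    obtain ⟨d, rfl⟩ := Nat.exists_eq_add_of_lt hnm
    have h1 := hiter n n 0 rfl
    have h2 := hiter (n + d + 1) n (d + 1) (by ring)
    rw [heq, h2, Function.iterate_succ_apply'] at h1
    have hm1 : g₀^[d] (g₁ (Y (n + d + 1))) ∈ Icc (0 : ℝ) 1 := g₀m.iterate _ (g₁m (hY _))
    have h3 := hκi (x₁ := (f₀^[n] (X (n + d + 1)), g₀ (g₀^[d] (g₁ (Y (n + d + 1))))))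
      (x₂ := (f₀^[n] (X n), g₁ (Y n)))
      ⟨f₀m.iterate _ (hX _), g₀m hm1⟩ ⟨f₀m.iterate _ (hX _), g₁m (hY _)⟩ h1
    have h4 : g₀ (g₀^[d] (g₁ (Y (n + d + 1)))) = g₁ (Y n) := congrArg Prod.snd h3
    have h5 := (g₀m' hm1).2
    have h6 := (g₁m' (hY n)).1
    rw [h4] at h5
    linarith
  refine Set.infinite_of_injective_forall_mem (f := fun n => κ (X n, Y n)) ?_ ?_
  · intro n m hnm
    rcases lt_trichotomy n m with hlt | heq | hlt
    · exact absurd hnm (hne n m hlt)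
    · exact heq
    · exact absurd hnm.symm (hne m n hlt)
  · intro n
    have hfix : h^[n + 1] (κ (X n, Y n)) = κ (X n, Y n) := by
      rw [Function.iterate_succ_apply', hiter n n 0 rfl, Function.iterate_zero, id,
        H₁ _ (f₀m.iterate _ (hX _)) _ (hY _), hXf]
    exact ⟨hh.mem_ball_of_iterate_eq (hκm ⟨hX n, hY n⟩) n.succ_pos hfix, n + 1, n.succ_pos, hfix⟩

/-- A periodic orbit that leaves the square enters `A`, where it converges to `s`, so it is `s`.
Otherwise it stays in the two strips; for two points of period `k` with the same itinerary, `k`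
steps multiply the horizontal difference by `a ^ k` and the vertical one by `b ^ k`, and both
differences return to their old values, so they vanish. -/
theorem countable_discPeriodicPts (hh : IsHorseshoe h) : (discPeriodicPts h).Countable := by
  obtain ⟨κ, A, B, s, a, b, x₀, x₁, y₀, y₁, -, hκi, -, hκm, hAB, -, ha, hb, hy0, hy01, hy1, hx0,
    hx0', hx1, hx1', -, hs0, hs1, hout, hA, -, -, hlim⟩ := hh.horseshoe
  have hb' : 0 < b⁻¹ := inv_pos.2 hb
  have hb1 : 1 < b := by
    by_contra hle
    have : 1 ≤ b⁻¹ := (one_le_inv₀ hb).2 (not_lt.1 hle)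
    linarith
  have ha1 : a < 1 := by linarith
  have hm : MapsTo h (closedBall (0 : ℂ) 1) (closedBall (0 : ℂ) 1) :=
    fun w hw => ball_subset_closedBall (hh.mapsTo hw)
  have hsub : discPeriodicPts h ⊆ ⋃ k : ℕ, ({s} ∪ {z | 0 < k ∧ h^[k] z = z ∧
      ∀ j : ℕ, h^[j] z ∈ κ '' unitSquare}) := by
    rintro z ⟨hz, k, hk, hkz⟩
    refine mem_iUnion.2 ⟨k, ?_⟩
    by_cases hall : ∀ j : ℕ, h^[j] z ∈ κ '' unitSquare
    · exact Or.inr ⟨hk, hkz, hall⟩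
    · left
      push Not at hall
      obtain ⟨j, hj⟩ := hall
      have hzc := ball_subset_closedBall hz
      have hjAB : h^[j] z ∈ A ∪ B := by
        rw [← hAB]
        exact ⟨hm.iterate j hzc, hj⟩
      have hAA : MapsTo h A A := fun w hw => hA (Or.inl hw)
      have hper : ∀ m : ℕ, h^[m * k] z = z := by
        intro m
        rw [mul_comm, Function.iterate_mul]
        exact Function.iterate_fixed hkz m
      have hzA : z ∈ A := by
        have h1 : h^[j + 1] z ∈ A := by
          rw [Function.iterate_succ_apply']
          exact hA hjAB
        -- The orbit is in `A` from time `j + 1` on, and `(j + 1) * k` is a multiple of the period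
        -- that is at least as large; so `z` itself is in `A`.
        obtain ⟨d, hd⟩ := Nat.exists_eq_add_of_le (Nat.le_mul_of_pos_right (j + 1) hk)
        rw [← hper (j + 1), hd, add_comm, Function.iterate_add_apply]
        exact hAA.iterate d h1
      have h2 : Tendsto (fun m : ℕ => h^[m * k] z) atTop (𝓝 s) :=
        (hlim z hzA).comp (tendsto_id.atTop_mul_const' hk)
      refine tendsto_nhds_unique ?_ h2
      simp only [hper]
      exact tendsto_const_nhds
  refine Countable.mono hsub (countable_iUnion fun k => (countable_singleton s).union ?_)
  -- The itinerary: at which of the first `k` times the orbit is in the first strip. It takes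
  -- finitely many values.
  let I : ℂ → Fin k → Prop := fun z j => ∃ q ∈ unitSquare, κ q = h^[j] z ∧ q.2 ∈ Icc y₀ (y₀ + b⁻¹)
  refine Set.countable_of_injective_of_countable_image (f := I) ?_ (Set.to_countable _)
  rintro z ⟨hk, hkz, hz⟩ z' ⟨-, hkz', hz'⟩ hI
  choose q hq hqz using hz
  choose q' hq' hqz' using hz'
  have hstrip : ∀ p ∈ unitSquare, h (κ p) ∈ κ '' unitSquare →
      p.2 ∉ Icc y₀ (y₀ + b⁻¹) → p.2 ∈ Icc y₁ (y₁ + b⁻¹) := by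
    intro p hp h1 h2
    by_contra h3
    exact hout p hp h2 h3 h1
  have hsucc : ∀ (w : ℂ) (r : ℕ → ℝ × ℝ), (∀ j, r j ∈ unitSquare) → (∀ j, κ (r j) = h^[j] w) →
      ∀ j, ((r j).2 ∈ Icc y₀ (y₀ + b⁻¹) → r (j + 1) = (x₀ + a * (r j).1, b * ((r j).2 - y₀))) ∧
        ((r j).2 ∉ Icc y₀ (y₀ + b⁻¹) →
          r (j + 1) = (x₁ + a * (1 - (r j).1), 1 - b * ((r j).2 - y₁))) := by
    intro w r hr hrw j
    have hstep : h (κ (r j)) = κ (r (j + 1)) := by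
      rw [hrw, hrw, Function.iterate_succ_apply']
    have hr1 := (hr j).1
    have hbb : b * b⁻¹ = 1 := mul_inv_cancel₀ hb.ne'
    constructor
    · intro h1
      have h2 := hs0 _ hr1 _ h1
      refine hκi (hr _) ?_ (hstep.symm.trans h2)
      obtain ⟨u1, u2⟩ := hr1
      obtain ⟨v1, v2⟩ := h1
      refine ⟨⟨?_, ?_⟩, ⟨?_, ?_⟩⟩ <;> dsimp only <;> nlinarith
    · intro h1
      have h1' := hstrip _ (hr j) (by rw [hstep]; exact ⟨_, hr _, rfl⟩) h1
      have h2 := hs1 _ hr1 _ h1'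
      refine hκi (hr _) ?_ (hstep.symm.trans h2)
      obtain ⟨u1, u2⟩ := hr1
      obtain ⟨v1, v2⟩ := h1'
      refine ⟨⟨?_, ?_⟩, ⟨?_, ?_⟩⟩ <;> dsimp only <;> nlinarith
  have hIiff : ∀ j < k, ((q j).2 ∈ Icc y₀ (y₀ + b⁻¹) ↔ (q' j).2 ∈ Icc y₀ (y₀ + b⁻¹)) := by
    intro j hj
    have h1 : I z ⟨j, hj⟩ = I z' ⟨j, hj⟩ := congrFun hI _
    have h2 : ∀ (w : ℂ) (r : ℕ → ℝ × ℝ), (∀ j, r j ∈ unitSquare) → (∀ j, κ (r j) = h^[j] w) →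
        (I w ⟨j, hj⟩ ↔ (r j).2 ∈ Icc y₀ (y₀ + b⁻¹)) := by
      intro w r hr hrw
      constructor
      · rintro ⟨p, hp, hpw, hp2⟩
        rwa [hκi (hr j) hp ((hrw j).trans hpw.symm)]
      · intro h3
        exact ⟨r j, hr j, hrw j, h3⟩
    rw [← h2 z q hq hqz, ← h2 z' q' hq' hqz', h1]
  -- Both orbits use the same branch at each step; the half turn of the second branch only changes
  -- the signs of the differences.
  have hdiff : ∀ j ≤ k, |(q j).1 - (q' j).1| = a ^ j * |(q 0).1 - (q' 0).1| ∧
      |(q j).2 - (q' j).2| = b ^ j * |(q 0).2 - (q' 0).2| := by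
    intro j
    induction j with
    | zero => intro _; simp
    | succ j ih =>
      intro hj
      obtain ⟨ih1, ih2⟩ := ih (by omega)
      have hi := hIiff j (by omega)
      have g1 := hsucc z q hq hqz j
      have g2 := hsucc z' q' hq' hqz' j
      by_cases hc : (q j).2 ∈ Icc y₀ (y₀ + b⁻¹)
      · rw [g1.1 hc, g2.1 (hi.1 hc)]
        constructor
        · rw [pow_succ', mul_assoc, ← ih1, ← abs_of_pos ha, ← abs_mul, abs_of_pos ha]
          congr 1; ring
        · rw [pow_succ', mul_assoc, ← ih2, ← abs_of_pos hb, ← abs_mul, abs_of_pos hb]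
          congr 1; ring
      · rw [g1.2 hc, g2.2 (fun h => hc (hi.2 h))]
        constructor
        · rw [pow_succ', mul_assoc, ← ih1, ← abs_of_pos ha, ← abs_mul, abs_of_pos ha, ← abs_neg]
          congr 1; ring
        · rw [pow_succ', mul_assoc, ← ih2, ← abs_of_pos hb, ← abs_mul, abs_of_pos hb, ← abs_neg]
          congr 1; ring
  have hqk : q k = q 0 := hκi (hq _) (hq _) (by rw [hqz, hqz, hkz]; rfl)
  have hqk' : q' k = q' 0 := hκi (hq' _) (hq' _) (by rw [hqz', hqz', hkz']; rfl)
  obtain ⟨hd1, hd2⟩ := hdiff k le_rfl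
  rw [hqk, hqk'] at hd1 hd2
  have hak : a ^ k < 1 := pow_lt_one₀ ha.le ha1 hk.ne'
  have hbk : 1 < b ^ k := one_lt_pow₀ hb1 hk.ne'
  have e1 : (q 0).1 = (q' 0).1 := by
    rw [← sub_eq_zero, ← abs_eq_zero]
    nlinarith [abs_nonneg ((q 0).1 - (q' 0).1)]
  have e2 : (q 0).2 = (q' 0).2 := by
    rw [← sub_eq_zero, ← abs_eq_zero]
    nlinarith [abs_nonneg ((q 0).2 - (q' 0).2)]
  have e3 := hqz 0
  have e4 := hqz' 0
  rw [Prod.ext e1 e2, e4] at e3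
  exact e3.symm

end IsHorseshoe

/-! ### Closed orbits in the tube and periodic points of `h`. -/

namespace IsSuspensionReplacement

variable {M : Type*} [TopologicalSpace M] [ChartedSpace (EuclideanSpace ℝ (Fin 3)) M]
  {F : ComplexFoliation M} {φ : Flow ℝ M} {γ : Set M}
  {τ : OpenPartialHomeomorph (ℂ × Circle) M} {h : ℂ → ℂ} {φ' : Flow ℝ M}

/-- The map `ρ` is the coordinate of the disc over `θ` in which the return map is `h` itself rather
than a conjugate of it. The return time is the minimal period of the core, since the phase does not
come back earlier. -/
theorem exists_return_coordinate (hγ : γ ∈ closedOrbits F φ) (hτ : IsContractionTube φ γ τ)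
    (hh : IsHorseshoe h) (h' : IsSuspensionReplacement φ τ h φ') :
    ∃ (θ : Circle) (T : ℝ) (ρ : ℂ → M), IsContractionTube.IsPeriod φ τ T ∧
      InjOn ρ (ball 0 1) ∧ (∀ z ∈ ball (0 : ℂ) 1, ∃ w ∈ ball (0 : ℂ) 1, ρ z = τ (w, θ)) ∧
      (∀ w ∈ ball (0 : ℂ) 1, ∃ z ∈ ball (0 : ℂ) 1, ρ z = τ (w, θ)) ∧
      ∀ k : ℕ, ∀ z ∈ ball (0 : ℂ) 1, φ' (k * T) (ρ z) = ρ (h^[k] z) := by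
  obtain ⟨θ, T, c, hT0, hT, hTmin, hcs, hct, -, -, hret⟩ := h'.firstReturn
  obtain ⟨T₀, hT₀⟩ := hτ.exists_isPeriod hγ
  have hmem : ∀ w ∈ ball (0 : ℂ) 1, (w, θ) ∈ τ.source := fun w hw =>
    hτ.mem_source (mem_ball_zero_iff.1 hw).le θ
  have hcm : ∀ z ∈ ball (0 : ℂ) 1, c z ∈ ball (0 : ℂ) 1 := by
    intro z hz
    rw [← hct]
    exact c.map_source (by rwa [hcs])
  refine ⟨θ, T, fun z => τ (c z, θ), ?_, ?_, ?_, ?_, ?_⟩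
  · obtain ⟨k, hk⟩ := (hT₀.2 θ T).1 hT
    have hle : T ≤ T₀ := by
      by_contra hlt
      exact hTmin T₀ ⟨hT₀.1, not_le.1 hlt⟩ (hT₀.phase_eq θ)
    have hge : T₀ ≤ T := by
      have hk1 : (0 : ℝ) < k := by
        by_contra hk0
        have := mul_nonpos_of_nonpos_of_nonneg (not_lt.1 hk0) hT₀.1.le
        linarith
      have hk2 : (1 : ℝ) ≤ k := by exact_mod_cast (by exact_mod_cast hk1 : (0 : ℤ) < k)
      nlinarith [hT₀.1]
    rwa [le_antisymm hle hge]
  · intro z hz z' hz' heq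
    have h1 := τ.injOn (hmem _ (hcm z hz)) (hmem _ (hcm z' hz')) heq
    exact c.injOn (by rwa [hcs]) (by rwa [hcs]) (congrArg Prod.fst h1)
  · intro z hz
    exact ⟨c z, hcm z hz, rfl⟩
  · intro w hw
    rw [← hct] at hw
    refine ⟨c.symm w, by rw [← hcs]; exact c.map_target hw, ?_⟩
    simp only [c.right_inv hw]
  · intro k
    induction k with
    | zero => intro z _; simp [φ'.map_zero_apply]
    | succ k ih =>
      intro z hz
      have e1 : ((k + 1 : ℕ) : ℝ) * T = k * T + T := by push_cast; ring
      rw [e1, φ'.map_add, hret z hz, Function.iterate_succ_apply]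
      exact ih (h z) (hh.mapsTo (ball_subset_closedBall hz))

variable [T2Space M] [CompactSpace M]

/-- Every orbit in the tube crosses the disc over `θ`, and there a closed orbit meets a periodic
point of `h`. Conversely the orbit of a periodic point is closed, and only the finitely many points
of one cycle of `h` give the same orbit. -/
theorem countable_infinite_closedOrbits (hS : IsFDS F φ) (hγ : γ ∈ closedOrbits F φ)
    (hτ : IsContractionTube φ γ τ) (hh : IsHorseshoe h) (h' : IsSuspensionReplacement φ τ h φ') :
    {γ' ∈ closedOrbits F φ' | γ' ⊆ openTube τ}.Countable ∧
      {γ' ∈ closedOrbits F φ' | γ' ⊆ openTube τ}.Infinite := by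
  obtain ⟨θ, T, ρ, hT, hinj, hρ, hρ', hret⟩ := h'.exists_return_coordinate hγ hτ hh
  have hregion : transverseRegion F φ' = transverseRegion F φ :=
    ComplexFoliation.transverseRegion_eq hS.smooth h'.smooth hS.leaf_to_leaf
      (h'.heightDeriv_velocity_eq hS hγ hτ)
  have hmaps : MapsTo h (ball (0 : ℂ) 1) (ball 0 1) :=
    fun z hz => hh.mapsTo (ball_subset_closedBall hz)
  have hphase : ∀ t : ℝ, 0 ≤ t → ∀ θ₁ θ₂ : Circle, ∀ w ∈ ball (0 : ℂ) 1, ∀ w' ∈ ball (0 : ℂ) 1,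
      φ' t (τ (w, θ₁)) = τ (w', θ₂) → phase φ τ t θ₁ = θ₂ := by
    intro t ht θ₁ θ₂ w hw w' hw' heq
    obtain ⟨w'', hw'', h1⟩ := h'.slices t ht θ₁ w hw
    rw [h1] at heq
    have := τ.injOn (hτ.mem_source (mem_ball_zero_iff.1 hw'').le _)
      (hτ.mem_source (mem_ball_zero_iff.1 hw').le _) heq
    exact congrArg Prod.snd this
  have hreturn : ∀ t : ℝ, 0 ≤ t → ∀ z ∈ ball (0 : ℂ) 1, ∀ z' ∈ ball (0 : ℂ) 1,
      φ' t (ρ z) = ρ z' → ∃ k : ℕ, t = k * T ∧ h^[k] z = z' := by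
    intro t ht z hz z' hz' heq
    obtain ⟨w, hw, hzw⟩ := hρ z hz
    obtain ⟨w', hw', hzw'⟩ := hρ z' hz'
    have h1 := hphase t ht θ θ w hw w' hw' (by rw [← hzw, heq, hzw'])
    obtain ⟨k, hk⟩ := (hT.2 θ t).1 h1
    have hk0 : 0 ≤ k := by
      by_contra hneg
      have : (k : ℝ) < 0 := by exact_mod_cast not_le.1 hneg
      nlinarith [hT.1]
    lift k to ℕ using hk0
    rw [Int.cast_natCast] at hk
    refine ⟨k, hk, ?_⟩
    rw [hk, hret k z hz] at heq
    exact hinj (hmaps.iterate k hz) hz' heq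
  let Ψ : ℂ → Set M := fun z => Set.range fun t : ℝ => φ' t (ρ z)
  -- The discs are controlled for nonnegative times only; on a closed orbit, adding periods makes
  -- every time nonnegative.
  have hshift : ∀ z ∈ ball (0 : ℂ) 1, ∀ k : ℕ, 0 < k → h^[k] z = z → ∀ t : ℝ,
      ∃ t' : ℝ, 0 ≤ t' ∧ φ' t' (ρ z) = φ' t (ρ z) := by
    intro z hz k hk hkz t
    have hkT : (0 : ℝ) < k * T := mul_pos (by exact_mod_cast hk) hT.1
    obtain ⟨n, hn⟩ := exists_nat_gt (-t / (k * T))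
    rw [div_lt_iff₀ hkT] at hn
    refine ⟨t + n * (k * T), by linarith, ?_⟩
    rw [φ'.map_add]
    congr 1
    have e1 : (n : ℝ) * (k * T) = ((n * k : ℕ) : ℝ) * T := by push_cast; ring
    rw [e1, hret _ z hz, mul_comm n k, Function.iterate_mul, Function.iterate_fixed hkz]
  have hΨ : ∀ z ∈ discPeriodicPts h, Ψ z ∈ {γ' ∈ closedOrbits F φ' | γ' ⊆ openTube τ} := by
    rintro z ⟨hz, k, hk, hkz⟩
    obtain ⟨w, hw, hzw⟩ := hρ z hz
    refine ⟨⟨ρ z, ?_, ⟨k * T, mul_pos (by exact_mod_cast hk) hT.1, ?_⟩, rfl⟩, ?_⟩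
    · rw [hregion, hzw]
      exact hτ.mem_transverseRegion hS hγ (mem_ball_zero_iff.1 hw).le θ
    · rw [hret k z hz, hkz]
    · rintro _ ⟨t, rfl⟩
      obtain ⟨t', ht', heq⟩ := hshift z hz k hk hkz t
      dsimp only
      rw [← heq, hzw]
      obtain ⟨w', hw', h1⟩ := h'.slices t' ht' θ w hw
      rw [h1]
      exact ⟨_, ⟨hw', mem_univ _⟩, rfl⟩
  constructor
  · refine (hh.countable_discPeriodicPts.image Ψ).mono ?_
    rintro γ' ⟨⟨p, -, ⟨T', hT', hp⟩, rfl⟩, hsub⟩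
    obtain ⟨⟨w₀, θ'⟩, ⟨hw₀, -⟩, hpw⟩ := hsub ⟨0, φ'.map_zero_apply p⟩
    obtain ⟨t, ht, htθ⟩ := hτ.exists_phase_eq hγ θ' θ
    obtain ⟨w, hw, h1⟩ := h'.slices t ht θ' w₀ hw₀
    rw [htθ] at h1
    obtain ⟨z, hz, hzw⟩ := hρ' w hw
    have h2 : φ' t p = ρ z := by rw [← hpw, h1, hzw]
    have h3 : φ' T' (ρ z) = ρ z := by
      rw [← h2, ← φ'.map_add, add_comm, φ'.map_add, hp]
    obtain ⟨k, hk, hkz⟩ := hreturn T' hT'.le z hz z hz h3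
    have hk0 : 0 < k := by
      rcases Nat.eq_zero_or_pos k with rfl | hk0
      · simp at hk; linarith
      · exact hk0
    refine ⟨z, ⟨hz, k, hk0, hkz⟩, ?_⟩
    ext y
    constructor
    · rintro ⟨s, rfl⟩
      exact ⟨s + t, by simp only [← h2, φ'.map_add]⟩
    · rintro ⟨s, rfl⟩
      refine ⟨s - t, ?_⟩
      simp only [← h2]
      rw [← φ'.map_add, sub_add_cancel]
  · intro hfin
    refine hh.infinite_discPeriodicPts (Set.Finite.of_finite_fibers Ψ
      (hfin.subset (by rintro _ ⟨z, hz, rfl⟩; exact hΨ z hz)) ?_)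
    rintro _ ⟨z, ⟨hz, k, hk, hkz⟩, rfl⟩
    refine ((Set.finite_lt_nat k).image fun m => h^[m] z).subset ?_
    rintro z' ⟨⟨hz', -⟩, heq⟩
    have hmem : ρ z' ∈ Ψ z := by
      rw [← (heq : Ψ z' = Ψ z)]
      exact ⟨0, φ'.map_zero_apply _⟩
    obtain ⟨t, ht⟩ := hmem
    obtain ⟨t', ht', heq'⟩ := hshift z hz k hk hkz t
    obtain ⟨m, -, hm⟩ := hreturn t' ht' z hz z' hz' (heq'.trans ht)
    refine ⟨m % k, Nat.mod_lt _ hk, ?_⟩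
    have hper : Function.IsPeriodicPt h k z := hkz
    rw [← hm]
    exact hper.iterate_mod_apply m

end IsSuspensionReplacement

/-! ### Ambient isotopies between nearby disc embeddings. -/

section LocalInverse

variable {E : Type*} [NormedAddCommGroup E] [NormedSpace ℝ E] [FiniteDimensional ℝ E]

theorem ContDiffAt.exists_local_inverse {f : E → E} {a : E} (hf : ContDiffAt ℝ ∞ f a)
    (hinj : Function.Injective (fderiv ℝ f a)) :
    ∃ g : E → E, ContDiffAt ℝ ∞ g (f a) ∧ g (f a) = a ∧
      (∀ᶠ y in 𝓝 (f a), f (g y) = y) ∧ ∀ᶠ x in 𝓝 a, g (f x) = x := by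
  have : CompleteSpace E := FiniteDimensional.complete ℝ E
  let L : E ≃L[ℝ] E := (LinearEquiv.ofInjectiveEndo (fderiv ℝ f a : E →ₗ[ℝ] E)
    hinj).toContinuousLinearEquiv
  have hL : HasFDerivAt f (L : E →L[ℝ] E) a := by
    have h1 : (L : E →L[ℝ] E) = fderiv ℝ f a := by ext x; rfl
    rw [h1]
    exact (hf.differentiableAt (by simp)).hasFDerivAt
  have hs := hf.hasStrictFDerivAt' hL (by simp)
  exact ⟨hf.localInverse hL (by simp), hf.to_localInverse hL (by simp),
    hf.localInverse_apply_image hL (by simp), hs.eventually_right_inverse,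
    hs.eventually_left_inverse⟩

theorem ContDiff.of_inverse {f finv : E → E} (hf : ContDiff ℝ ∞ f)
    (hl : Function.LeftInverse finv f) (hr : Function.RightInverse finv f)
    (hinj : ∀ x, Function.Injective (fderiv ℝ f x)) : ContDiff ℝ ∞ finv := by
  rw [contDiff_iff_contDiffAt]
  intro y
  obtain ⟨g, hg, -, hg', -⟩ := (hf.contDiffAt (x := finv y)).exists_local_inverse (hinj _)
  rw [hr y] at hg hg'
  refine hg.congr_of_eventuallyEq ?_
  filter_upwards [hg'] with y' hy'
  conv_lhs => rw [← hy']
  exact hl _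

end LocalInverse

/-- A smooth isotopy of diffeomorphisms of the plane, with compact support in the open unit disc,
that is the identity for nonpositive times and constant for times at least `1`. -/
structure DiscIsotopy where
  toFun : ℝ → ℂ → ℂ
  invFun : ℝ → ℂ → ℂ
  contDiff : ContDiff ℝ ∞ fun x : ℝ × ℂ => toFun x.1 x.2
  contDiff_inv : ContDiff ℝ ∞ fun x : ℝ × ℂ => invFun x.1 x.2
  left_inv : ∀ s z, invFun s (toFun s z) = z
  right_inv : ∀ s z, toFun s (invFun s z) = z
  radius : ℝ
  radius_lt_one : radius < 1
  support : ∀ s z, radius ≤ ‖z‖ → toFun s z = z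
  of_nonpos : ∀ s ≤ 0, ∀ z, toFun s z = z
  of_one_le : ∀ s, 1 ≤ s → ∀ z, toFun s z = toFun 1 z

namespace DiscIsotopy

theorem support_inv (G : DiscIsotopy) (s : ℝ) (z : ℂ) (hz : G.radius ≤ ‖z‖) :
    G.invFun s z = z := by
  conv_lhs => rw [← G.support s z hz]
  exact G.left_inv s z

/-- The isotopy of the inverse diffeomorphisms. -/
def symm (G : DiscIsotopy) : DiscIsotopy where
  toFun := G.invFun
  invFun := G.toFun
  contDiff := G.contDiff_inv
  contDiff_inv := G.contDiff
  left_inv := G.right_inv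
  right_inv := G.left_inv
  radius := G.radius
  radius_lt_one := G.radius_lt_one
  support := G.support_inv
  of_nonpos s hs z := by
    conv_lhs => rw [← G.of_nonpos s hs z]
    exact G.left_inv s z
  of_one_le s hs z := by
    have h := G.of_one_le s hs (G.invFun 1 z)
    rw [G.right_inv] at h
    conv_lhs => rw [← h]
    exact G.left_inv s _

/-- The pointwise composition of two isotopies. -/
def trans (G H : DiscIsotopy) : DiscIsotopy where
  toFun s z := H.toFun s (G.toFun s z)
  invFun s z := G.invFun s (H.invFun s z)
  contDiff := H.contDiff.comp (contDiff_fst.prodMk G.contDiff)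
  contDiff_inv := G.contDiff_inv.comp (contDiff_fst.prodMk H.contDiff_inv)
  left_inv s z := by rw [H.left_inv, G.left_inv]
  right_inv s z := by rw [G.right_inv, H.right_inv]
  radius := max G.radius H.radius
  radius_lt_one := max_lt G.radius_lt_one H.radius_lt_one
  support s z hz := by
    rw [G.support s z ((le_max_left _ _).trans hz), H.support s z ((le_max_right _ _).trans hz)]
  of_nonpos s hs z := by rw [G.of_nonpos s hs, H.of_nonpos s hs]
  of_one_le s hs z := by rw [G.of_one_le s hs, H.of_one_le s hs]

theorem eq_zero_of_add_smul_fderiv_eq_zero {u : ℂ → ℂ} (hu' : ∀ z, ‖fderiv ℝ u z‖ ≤ 1 / 2) {c : ℝ} (hc0 : 0 ≤ c)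
    (hc1 : c ≤ 1) (z ζ : ℂ) (hζ : ζ + c • fderiv ℝ u z ζ = 0) : ζ = 0 := by
  have h1 : ‖fderiv ℝ u z ζ‖ ≤ 1 / 2 * ‖ζ‖ := (fderiv ℝ u z).le_of_opNorm_le (hu' z) ζ
  have h2 : ‖ζ‖ = c * ‖fderiv ℝ u z ζ‖ := by
    rw [eq_neg_of_add_eq_zero_left hζ, norm_neg, norm_smul, Real.norm_of_nonneg hc0,
      ← eq_neg_of_add_eq_zero_left hζ]
  have h3 : ‖ζ‖ ≤ 0 := by nlinarith [norm_nonneg ζ, norm_nonneg (fderiv ℝ u z ζ)]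
  exact norm_le_zero_iff.1 h3

/-- A displacement with small derivative gives an isotopy. -/
theorem exists_of_displacement {u : ℂ → ℂ} (hu : ContDiff ℝ ∞ u)
    (hu' : ∀ z, ‖fderiv ℝ u z‖ ≤ 1 / 2) {r : ℝ} (hr : r < 1) (hur : ∀ z, r ≤ ‖z‖ → u z = 0) :
    ∃ G : DiscIsotopy, ∀ z, G.toFun 1 z = z + u z := by
  have hlip : ∀ z w, ‖u z - u w‖ ≤ 1 / 2 * ‖z - w‖ := fun z w =>
    Convex.norm_image_sub_le_of_norm_fderiv_le (𝕜 := ℝ)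
      (fun x _ => hu.differentiable (by simp) x) (fun x _ => hu' x) convex_univ
      (mem_univ w) (mem_univ z)
  let χ : ℝ → ℝ := Real.smoothTransition
  have hχ0 : ∀ s, 0 ≤ χ s := Real.smoothTransition.nonneg
  have hχ1 : ∀ s, χ s ≤ 1 := Real.smoothTransition.le_one
  have hχ : ContDiff ℝ ∞ χ := Real.smoothTransition.contDiff
  -- The displacement `χ s • u` is `1/2`-Lipschitz. This gives injectivity, and a preimage of `y` is
  -- the fixed point of the contraction `z ↦ y - χ s • u z`.
  have hbij : ∀ s, Function.Bijective fun z : ℂ => z + χ s • u z := by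
    intro s
    constructor
    · intro z w hzw
      have h1 : z - w = χ s • (u w - u z) := by
        rw [smul_sub]
        linear_combination (hzw : z + χ s • u z = w + χ s • u w)
      have h2 : ‖z - w‖ = χ s * ‖u w - u z‖ := by
        conv_lhs => rw [h1]
        rw [norm_smul, Real.norm_of_nonneg (hχ0 s)]
      have h3 := hlip w z
      rw [norm_sub_rev w z] at h3
      have h4 : ‖z - w‖ ≤ 0 := by
        nlinarith [norm_nonneg (z - w), norm_nonneg (u w - u z), hχ0 s, hχ1 s]
      exact sub_eq_zero.1 (norm_le_zero_iff.1 h4)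
    · intro y
      have hcontr : ContractingWith (1 / 2) fun z : ℂ => y - χ s • u z := by
        refine ⟨by rw [← NNReal.coe_lt_coe]; norm_num, LipschitzWith.of_dist_le_mul fun z w => ?_⟩
        rw [dist_eq_norm, dist_eq_norm, sub_sub_sub_cancel_left, ← smul_sub, norm_smul,
          Real.norm_of_nonneg (hχ0 s)]
        have h3 := hlip w z
        rw [norm_sub_rev w z] at h3
        have h4 : ((1 / 2 : NNReal) : ℝ) = 1 / 2 := by norm_num
        rw [h4]
        nlinarith [norm_nonneg (z - w), norm_nonneg (u w - u z), hχ0 s, hχ1 s]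
      refine ⟨ContractingWith.fixedPoint _ hcontr, ?_⟩
      have := hcontr.fixedPoint_isFixedPt
      have h5 : y - χ s • u (ContractingWith.fixedPoint _ hcontr) =
        ContractingWith.fixedPoint _ hcontr := this
      show ContractingWith.fixedPoint _ hcontr + χ s • u (ContractingWith.fixedPoint _ hcontr) = y
      linear_combination -h5
  let e : ℝ → ℂ ≃ ℂ := fun s => Equiv.ofBijective _ (hbij s)
  have he : ∀ s z, e s z = z + χ s • u z := fun s z => rfl
  have hsm : ContDiff ℝ ∞ fun x : ℝ × ℂ => x.2 + χ x.1 • u x.2 :=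
    contDiff_snd.add ((hχ.comp contDiff_fst).smul (hu.comp contDiff_snd))
  have hF : ContDiff ℝ ∞ fun x : ℝ × ℂ => (x.1, e x.1 x.2) := contDiff_fst.prodMk hsm
  -- Joint smoothness of the inverses comes from the inverse function theorem for `(s, z) ↦ (s, e s
  -- z)`, whose derivative is block triangular with injective diagonal blocks.
  have hFinv : ContDiff ℝ ∞ fun x : ℝ × ℂ => (x.1, (e x.1).symm x.2) := by
    refine hF.of_inverse (fun x => ?_) (fun x => ?_) ?_
    · simp
    · simp
    · intro x
      rw [injective_iff_map_eq_zero]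
      rintro ⟨σ, ζ⟩ h0
      have hd : HasFDerivAt (fun x : ℝ × ℂ => (x.1, e x.1 x.2))
          ((ContinuousLinearMap.fst ℝ ℝ ℂ).prod (ContinuousLinearMap.snd ℝ ℝ ℂ +
            (χ x.1 • (fderiv ℝ u x.2).comp (ContinuousLinearMap.snd ℝ ℝ ℂ) +
            ((fderiv ℝ χ x.1).comp (ContinuousLinearMap.fst ℝ ℝ ℂ)).smulRight (u x.2)))) x := by
        refine hasFDerivAt_fst.prodMk (hasFDerivAt_snd.add ?_)
        refine HasFDerivAt.smul (c := fun x : ℝ × ℂ => χ x.1) (f := fun x : ℝ × ℂ => u x.2) ?_ ?_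
        · exact ((hχ.differentiable (by simp)) x.1).hasFDerivAt.comp x hasFDerivAt_fst
        · exact ((hu.differentiable (by simp)) x.2).hasFDerivAt.comp x hasFDerivAt_snd
      rw [hd.fderiv] at h0
      have hσ : σ = 0 := congrArg Prod.fst h0
      subst hσ
      have hζ := congrArg Prod.snd h0
      simp only [ContinuousLinearMap.prod_apply, _root_.add_apply, _root_.smul_apply,
        ContinuousLinearMap.comp_apply, ContinuousLinearMap.coe_snd', ContinuousLinearMap.coe_fst',
        ContinuousLinearMap.smulRight_apply, map_zero, zero_smul, add_zero, Prod.snd_zero] at hζ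
      rw [eq_zero_of_add_smul_fderiv_eq_zero hu' (hχ0 x.1) (hχ1 x.1) x.2 ζ hζ]
      rfl
  refine ⟨{ toFun := fun s => e s
            invFun := fun s => (e s).symm
            contDiff := hsm
            contDiff_inv := contDiff_snd.comp hFinv
            left_inv := fun s z => (e s).symm_apply_apply z
            right_inv := fun s z => (e s).apply_symm_apply z
            radius := r
            radius_lt_one := hr
            support := fun s z hz => by rw [he, hur z hz, smul_zero, add_zero]
            of_nonpos := fun s hs z => by
              rw [he, show χ s = 0 from Real.smoothTransition.zero_of_nonpos hs, zero_smul,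
                add_zero]
            of_one_le := fun s hs z => by
              rw [he, he, show χ s = 1 from Real.smoothTransition.one_of_one_le hs,
                show χ 1 = 1 from Real.smoothTransition.one] }, fun z => ?_⟩
  show e 1 z = z + u z
  rw [he, show χ 1 = 1 from Real.smoothTransition.one, one_smul]

end DiscIsotopy

/-- `f` restricts to an orientation-preserving embedding of the closed unit disc into the open
unit disc. -/
structure IsDiscEmbedding (f : ℂ → ℂ) : Prop where
  contDiff : ContDiff ℝ ∞ f
  injOn : InjOn f (closedBall 0 1)
  mapsTo : MapsTo f (closedBall 0 1) (ball 0 1)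
  det_pos : ∀ z ∈ closedBall (0 : ℂ) 1, 0 < (fderiv ℝ f z).det

/-- An ambient isotopy of the open disc carries `f` to `g`. -/
def DiscIsotopic (f g : ℂ → ℂ) : Prop :=
  ∃ G : DiscIsotopy, ∀ z ∈ closedBall (0 : ℂ) 1, g z = G.toFun 1 (f z)

theorem DiscIsotopic.symm {f g : ℂ → ℂ} (h : DiscIsotopic f g) : DiscIsotopic g f := by
  obtain ⟨G, hG⟩ := h
  exact ⟨G.symm, fun z hz => by rw [hG z hz]; exact (G.left_inv 1 _).symm⟩

theorem DiscIsotopic.trans {f g k : ℂ → ℂ} (h : DiscIsotopic f g) (h' : DiscIsotopic g k) :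
    DiscIsotopic f k := by
  obtain ⟨G, hG⟩ := h
  obtain ⟨H, hH⟩ := h'
  exact ⟨G.trans H, fun z hz => by rw [hH z hz, hG z hz]; rfl⟩

theorem injective_of_det_ne_zero {A : ℂ →L[ℝ] ℂ} (h : A.det ≠ 0) : Function.Injective A := by
  have := (LinearMap.equivOfDetNeZero (A : ℂ →ₗ[ℝ] ℂ) h).injective
  exact this

namespace IsDiscEmbedding

variable {f : ℂ → ℂ}

/-- All conditions are open around the compact disc; injectivity extends because `f` is injective on
the compact disc and locally injective at its points. The collar leaves room for cutting off
displacements outside the disc. -/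
theorem exists_collar (hf : IsDiscEmbedding f) : ∃ δ > 0, InjOn f (closedBall 0 (1 + δ)) ∧
    MapsTo f (closedBall 0 (1 + δ)) (ball 0 1) ∧
    ∀ z ∈ closedBall (0 : ℂ) (1 + δ), Function.Injective (fderiv ℝ f z) := by
  have hc : Continuous (fderiv ℝ f) := hf.contDiff.continuous_fderiv (by simp)
  obtain ⟨t, ht, htinj⟩ := hf.injOn.exists_mem_nhdsSet (isCompact_closedBall (0 : ℂ) 1)
    (fun x _ => hf.contDiff.continuous.continuousAt) (fun x hx => by
      obtain ⟨g, -, -, -, hg⟩ := (hf.contDiff.contDiffAt (x := x)).exists_local_inverse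
        (injective_of_det_ne_zero (hf.det_pos x hx).ne')
      exact ⟨_, hg, fun a ha b hb hab => by
        have ha' : g (f a) = a := ha
        have hb' : g (f b) = b := hb
        rw [← ha', ← hb', hab]⟩)
  obtain ⟨U, hU, hKU, hUt⟩ := mem_nhdsSet_iff_exists.1 ht
  have hV : IsOpen (U ∩ (f ⁻¹' ball 0 1 ∩ {z | 0 < (fderiv ℝ f z).det})) :=
    hU.inter ((isOpen_ball.preimage hf.contDiff.continuous).inter
      (isOpen_lt continuous_const (ContinuousLinearMap.continuous_det.comp hc)))
  obtain ⟨δ, hδ, hsub⟩ := (isCompact_closedBall (0 : ℂ) 1).exists_cthickening_subset_open hV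
    (fun z hz => ⟨hKU hz, hf.mapsTo hz, hf.det_pos z hz⟩)
  rw [cthickening_closedBall hδ.le zero_le_one, add_comm] at hsub
  exact ⟨δ, hδ, fun a ha b hb => htinj (hUt (hsub ha).1) (hUt (hsub hb).1),
    fun z hz => (hsub hz).2.1, fun z hz => injective_of_det_ne_zero (hsub hz).2.2.ne'⟩

theorem exists_norm_fderiv_lower_bound (hf : ContDiff ℝ ∞ f) {K : Set ℂ} (hK : IsCompact K)
    (hKne : K.Nonempty) (hinj : ∀ z ∈ K, Function.Injective (fderiv ℝ f z)) :
    ∃ m > 0, ∀ z ∈ K, ∀ x, m * ‖x‖ ≤ ‖fderiv ℝ f z x‖ := by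
  have hc : Continuous (fderiv ℝ f) := hf.continuous_fderiv (by simp)
  have hsc : IsCompact (K ×ˢ sphere (0 : ℂ) 1) := hK.prod (isCompact_sphere 0 1)
  obtain ⟨⟨z₀, x₀⟩, ⟨hz₀, hx₀⟩, hmin⟩ := hsc.exists_isMinOn
    (hKne.prod ⟨1, by simp⟩) (f := fun y : ℂ × ℂ => ‖fderiv ℝ f y.1 y.2‖)
    (((hc.comp continuous_fst).clm_apply continuous_snd).norm.continuousOn)
  have hx₀' : x₀ ≠ 0 := by
    rintro rfl
    simp at hx₀
  refine ⟨‖fderiv ℝ f z₀ x₀‖, norm_pos_iff.2 fun h => hx₀' (hinj z₀ hz₀ (by rw [h, map_zero])), ?_⟩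
  intro z hz x
  by_cases hx : x = 0
  · simp [hx]
  · have hxn : 0 < ‖x‖ := norm_pos_iff.2 hx
    have h1 : ‖fderiv ℝ f z₀ x₀‖ ≤ ‖fderiv ℝ f z (‖x‖⁻¹ • x)‖ :=
      hmin (show (z, ‖x‖⁻¹ • x) ∈ _ from ⟨hz, by
        rw [mem_sphere_zero_iff_norm, norm_smul, norm_inv, norm_norm, inv_mul_cancel₀ hxn.ne']⟩)
    rw [map_smul, norm_smul, norm_inv, norm_norm, ← div_eq_inv_mul, le_div_iff₀ hxn] at h1
    exact h1

/-- A displacement along the image of an embedding extends to the plane. -/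
theorem exists_extension (hf : ContDiff ℝ ∞ f) {ρ R : ℝ} (hρR : ρ < R)
    (hinj : InjOn f (closedBall 0 R)) (hd : ∀ z ∈ closedBall (0 : ℂ) R,
      Function.Injective (fderiv ℝ f z))
    {v : ℂ → ℂ} (hv : ContDiff ℝ ∞ v) (hv0 : ∀ w, w ∉ closedBall (0 : ℂ) ρ → v w = 0) :
    ∃ u : ℂ → ℂ, ContDiff ℝ ∞ u ∧ (∀ w ∈ ball (0 : ℂ) R, u (f w) = v w) ∧
      ∀ z, z ∉ f '' closedBall (0 : ℂ) ρ → u =ᶠ[𝓝 z] 0 := by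
  classical
  let W := ball (0 : ℂ) R
  let u : ℂ → ℂ := fun z => if z ∈ f '' W then v (Function.invFunOn f W z) else 0
  have hWc : W ⊆ closedBall 0 R := ball_subset_closedBall
  have huf : ∀ w ∈ W, u (f w) = v w := by
    intro w hw
    have hmem : f w ∈ f '' W := ⟨w, hw, rfl⟩
    have h1 : Function.invFunOn f W (f w) = w :=
      hinj (hWc (Function.invFunOn_mem hmem)) (hWc hw) (Function.invFunOn_eq hmem)
    show (if f w ∈ f '' W then v (Function.invFunOn f W (f w)) else 0) = v w
    rw [if_pos hmem, h1]
  have hout : ∀ z, z ∉ f '' closedBall (0 : ℂ) ρ → u z = 0 := by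
    intro z hz
    by_cases hmem : z ∈ f '' W
    · obtain ⟨w, hw, rfl⟩ := hmem
      rw [huf w hw]
      exact hv0 w fun h => hz ⟨w, h, rfl⟩
    · show (if z ∈ f '' W then v (Function.invFunOn f W z) else 0) = 0
      rw [if_neg hmem]
  have hout' : ∀ z, z ∉ f '' closedBall (0 : ℂ) ρ → u =ᶠ[𝓝 z] 0 := by
    intro z hz
    have hopen : IsOpen (f '' closedBall (0 : ℂ) ρ)ᶜ :=
      ((isCompact_closedBall (0 : ℂ) ρ).image hf.continuous).isClosed.isOpen_compl
    filter_upwards [hopen.mem_nhds hz] with y hy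
    exact hout y hy
  refine ⟨u, ?_, huf, hout'⟩
  rw [contDiff_iff_contDiffAt]
  intro z
  by_cases hz : z ∈ f '' closedBall (0 : ℂ) ρ
  · obtain ⟨w, hw, rfl⟩ := hz
    have hwW : w ∈ W := closedBall_subset_ball hρR hw
    obtain ⟨g, hg, hgw, hfg, -⟩ := (hf.contDiffAt (x := w)).exists_local_inverse (hd w (hWc hwW))
    have h1 : ContDiffAt ℝ ∞ (v ∘ g) (f w) := by
      refine ContDiffAt.comp _ ?_ hg
      exact hv.contDiffAt
    refine h1.congr_of_eventuallyEq ?_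
    have h2 : ∀ᶠ y in 𝓝 (f w), g y ∈ W :=
      hg.continuousAt.eventually (isOpen_ball.mem_nhds (by rwa [hgw]))
    filter_upwards [hfg, h2] with y hy1 hy2
    conv_lhs => rw [← hy1]
    exact huf _ hy2
  · exact contDiffAt_const.congr_of_eventuallyEq (hout' z hz)

/-- Embeddings that are `C¹`-close are ambient isotopic. -/
theorem exists_isotopic_of_close (hf : IsDiscEmbedding f) :
    ∃ ε > 0, ∃ R > 0, ∀ g : ℂ → ℂ, ContDiff ℝ ∞ g →
      (∀ w ∈ closedBall (0 : ℂ) R, ‖g w - f w‖ < ε ∧ ‖fderiv ℝ g w - fderiv ℝ f w‖ < ε) →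
      DiscIsotopic f g := by
  obtain ⟨δ, hδ, hinj, hmaps, hd⟩ := hf.exists_collar
  set R := 1 + δ with hR
  have hR0 : 0 < R := by linarith
  obtain ⟨m, hm, hlow⟩ := exists_norm_fderiv_lower_bound hf.contDiff
    (isCompact_closedBall (0 : ℂ) R) ⟨0, by simp [hR0.le]⟩ hd
  -- The cutoff is `1` on the unit disc, so the displaced map is `g` there, and its support stays
  -- inside the collar.
  let b : ContDiffBump (0 : ℂ) := ⟨1, 1 + δ / 2, one_pos, by linarith⟩
  have hb : ContDiff ℝ ∞ b := b.contDiff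
  obtain ⟨C, hC⟩ := (isCompact_closedBall (0 : ℂ) R).exists_bound_of_continuousOn
    (f := fderiv ℝ b) (hb.continuous_fderiv (by simp)).continuousOn
  have hC0 : 0 ≤ C := (norm_nonneg _).trans (hC 0 (by simp [hR0.le]))
  -- With this bound `‖Dv‖ ≤ (1 + C) ε = m / 2`. As `Dv = Du ∘ Df` and `‖Df x‖ ≥ m ‖x‖`, it follows
  -- that `‖Du‖ ≤ 1 / 2`, as required of a displacement.
  refine ⟨m / (2 * (C + 1)), by positivity, R, hR0, fun g hg hclose => ?_⟩
  set ε := m / (2 * (C + 1)) with hε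
  have hεC : (C + 1) * ε = m / 2 := by rw [hε]; field_simp
  let v : ℂ → ℂ := fun w => b w • (g w - f w)
  have hv : ContDiff ℝ ∞ v := hb.smul (hg.sub hf.contDiff)
  have hv0 : ∀ w, w ∉ closedBall (0 : ℂ) (1 + δ / 2) → v w = 0 := by
    intro w hw
    have : b w = 0 := b.zero_of_le_dist (le_of_lt (by simpa using hw))
    simp only [v, this, zero_smul]
  have hv' : ∀ w ∈ closedBall (0 : ℂ) R, ‖fderiv ℝ v w‖ ≤ m / 2 := by
    intro w hw
    have h1 : HasFDerivAt v _ w := HasFDerivAt.smul (c := b) (f := fun w => g w - f w)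
      (hb.differentiable (by simp) w).hasFDerivAt
      ((hg.differentiable (by simp) w).hasFDerivAt.sub
        (hf.contDiff.differentiable (by simp) w).hasFDerivAt)
    rw [h1.fderiv]
    refine (norm_add_le _ _).trans ?_
    rw [norm_smul, Real.norm_of_nonneg b.nonneg, ContinuousLinearMap.norm_smulRight_apply]
    obtain ⟨h2, h3⟩ := hclose w hw
    have h4 := hC w hw
    have h5 : b w ≤ 1 := b.le_one
    have h6 : 0 ≤ b w := b.nonneg
    nlinarith [norm_nonneg (g w - f w), norm_nonneg (fderiv ℝ g w - fderiv ℝ f w),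
      norm_nonneg (fderiv ℝ b w)]
  obtain ⟨u, hu, huf, hu0⟩ := exists_extension hf.contDiff (by linarith : 1 + δ / 2 < R) hinj hd
    hv hv0
  have hu' : ∀ z, ‖fderiv ℝ u z‖ ≤ 1 / 2 := by
    intro z
    by_cases hz : z ∈ f '' closedBall (0 : ℂ) (1 + δ / 2)
    · obtain ⟨w, hw, rfl⟩ := hz
      have hwR : w ∈ ball (0 : ℂ) R := closedBall_subset_ball (by linarith) hw
      have hwR' := ball_subset_closedBall hwR
      have heq : (fun w => u (f w)) =ᶠ[𝓝 w] v := by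
        filter_upwards [isOpen_ball.mem_nhds hwR] with w' hw'
        exact huf w' hw'
      have hcomp : fderiv ℝ v w = (fderiv ℝ u (f w)).comp (fderiv ℝ f w) := by
        rw [← heq.fderiv_eq]
        exact ((hu.differentiable (by simp) (f w)).hasFDerivAt.comp w
          (hf.contDiff.differentiable (by simp) w).hasFDerivAt).fderiv
      refine ContinuousLinearMap.opNorm_le_bound _ (by norm_num) fun y => ?_
      obtain ⟨x, rfl⟩ := (LinearMap.injective_iff_surjective
        (f := (fderiv ℝ f w : ℂ →ₗ[ℝ] ℂ))).1 (hd w hwR') y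
      have h1 : fderiv ℝ u (f w) (fderiv ℝ f w x) = fderiv ℝ v w x := by rw [hcomp]; rfl
      have h2 : ‖fderiv ℝ v w x‖ ≤ m / 2 * ‖x‖ :=
        (fderiv ℝ v w).le_of_opNorm_le (hv' w hwR') x
      have h3 := hlow w hwR' x
      show ‖fderiv ℝ u (f w) (fderiv ℝ f w x)‖ ≤ 1 / 2 * ‖fderiv ℝ f w x‖
      rw [h1]
      linarith
    · rw [(hu0 z hz).fderiv_eq]
      simp
  -- The image of the collar is compact in the open disc, so the displacement is supported in a
  -- smaller disc.
  obtain ⟨r, hr, hrb⟩ : ∃ r < 1, ∀ z ∈ f '' closedBall (0 : ℂ) (1 + δ / 2), ‖z‖ < r := by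
    have hK : IsCompact (f '' closedBall (0 : ℂ) (1 + δ / 2)) :=
      (isCompact_closedBall _ _).image hf.contDiff.continuous
    obtain ⟨z₀, hz₀, hmax⟩ := hK.exists_isMaxOn ⟨f 0, 0, by simp; linarith, rfl⟩
      continuous_norm.continuousOn
    have hz₀' : ‖z₀‖ < 1 := by
      obtain ⟨w, hw, rfl⟩ := hz₀
      simpa using hmaps (closedBall_subset_closedBall (by linarith) hw)
    exact ⟨(‖z₀‖ + 1) / 2, by linarith, fun z hz => by
      have : ‖z‖ ≤ ‖z₀‖ := hmax hz
      linarith⟩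
  obtain ⟨G, hG⟩ := DiscIsotopy.exists_of_displacement hu hu' hr fun z hz =>
    (hu0 z fun hmem => absurd (hrb z hmem) (not_lt.2 hz)).self_of_nhds
  refine ⟨G, fun z hz => ?_⟩
  have hzR : z ∈ ball (0 : ℂ) R := closedBall_subset_ball (by linarith) hz
  have hbz : b z = 1 := b.one_of_mem_closedBall hz
  rw [hG, huf z hzR]
  simp only [v, hbz, one_smul]
  ring

/-- The two ends of a smooth family of embeddings are ambient isotopic. -/
theorem _root_.DiscIsotopic.of_family {F : ℝ → ℂ → ℂ}
    (hF : ContDiff ℝ ∞ fun x : ℝ × ℂ => F x.1 x.2)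
    (hemb : ∀ s ∈ Icc (0 : ℝ) 1, IsDiscEmbedding (F s)) : DiscIsotopic (F 0) (F 1) := by
  -- Isotopy is symmetric and transitive, and by closeness each parameter is isotopic to all
  -- parameters nearby; the interval is connected.
  refine isPreconnected_Icc.induction₂' (fun s s' => DiscIsotopic (F s) (F s')) ?_
    (fun _ _ _ _ _ _ h1 h2 => h1.trans h2) (left_mem_Icc.2 zero_le_one)
    (right_mem_Icc.2 zero_le_one)
  intro s hs
  obtain ⟨ε, hε, R, hR, hclose⟩ := (hemb s hs).exists_isotopic_of_close
  have hFs : ∀ s, ContDiff ℝ ∞ (F s) := fun s => hF.comp (contDiff_const.prodMk contDiff_id)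
  have hfd : ∀ s w, fderiv ℝ (F s) w =
      (fderiv ℝ (fun x : ℝ × ℂ => F x.1 x.2) (s, w)).comp (ContinuousLinearMap.inr ℝ ℝ ℂ) := by
    intro s w
    exact ((hF.differentiable (by simp) (s, w)).hasFDerivAt.comp w
      (hasFDerivAt_prodMk_right s w)).fderiv
  have hcd : Continuous fun x : ℝ × ℂ => fderiv ℝ (F x.1) x.2 := by
    simp only [hfd]
    exact (hF.continuous_fderiv (by simp)).clm_comp continuous_const
  have hev := (isCompact_closedBall (0 : ℂ) R).eventually_forall_of_forall_eventually (x₀ := s)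
    (P := fun s' w => ‖F s' w - F s w‖ < ε ∧ ‖fderiv ℝ (F s') w - fderiv ℝ (F s) w‖ < ε) ?_
  · refine eventually_nhdsWithin_of_eventually_nhds ?_
    filter_upwards [hev] with s' hs'
    have := hclose (F s') (hFs s') hs'
    exact ⟨this, this.symm⟩
  · intro w _
    have hc1 : Continuous fun x : ℝ × ℂ => ‖F x.1 x.2 - F s x.2‖ :=
      (hF.continuous.sub ((hFs s).continuous.comp continuous_snd)).norm
    have hc2 : Continuous fun x : ℝ × ℂ => ‖fderiv ℝ (F x.1) x.2 - fderiv ℝ (F s) x.2‖ :=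
      (hcd.sub (((hFs s).continuous_fderiv (by simp)).comp continuous_snd)).norm
    exact (hc1.continuousAt.eventually_lt continuousAt_const (by simpa using hε)).and
      (hc2.continuousAt.eventually_lt continuousAt_const (by simpa using hε))

end IsDiscEmbedding

/-! ### Deforming every disc embedding to a scaling. -/

/-- The real linear map `z ↦ α z + β z̄` of the plane. -/
def conjLinear (α β : ℂ) : ℂ →L[ℝ] ℂ :=
  α • (ContinuousLinearMap.id ℝ ℂ) + β • (Complex.conjCLE : ℂ →L[ℝ] ℂ)

theorem conjLinear_apply (α β z : ℂ) : conjLinear α β z = α * z + β * (starRingEnd ℂ) z := by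
  simp [conjLinear]

theorem det_conjLinear (α β : ℂ) : (conjLinear α β).det = ‖α‖ ^ 2 - ‖β‖ ^ 2 := by
  have h : (conjLinear α β).det = LinearMap.det (conjLinear α β : ℂ →ₗ[ℝ] ℂ) := rfl
  rw [h, ← LinearMap.det_toMatrix Complex.basisOneI, Matrix.det_fin_two]
  simp only [LinearMap.toMatrix_apply, Complex.coe_basisOneI, Complex.coe_basisOneI_repr,
    ContinuousLinearMap.coe_coe, conjLinear_apply]
  rw [← Complex.normSq_eq_norm_sq, ← Complex.normSq_eq_norm_sq, Complex.normSq_apply,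
    Complex.normSq_apply]
  simp
  ring

theorem exists_eq_conjLinear (A : ℂ →L[ℝ] ℂ) : ∃ α β : ℂ, A = conjLinear α β := by
  refine ⟨(A 1 - Complex.I * A Complex.I) / 2, (A 1 + Complex.I * A Complex.I) / 2, ?_⟩
  ext z
  have hz : z = z.re • (1 : ℂ) + z.im • Complex.I := by
    simp
  have h1 : A z = z.re * A 1 + z.im * A Complex.I := by
    conv_lhs => rw [hz]
    rw [map_add, map_smul, map_smul]
    simp
  have h2 : z = z.re + z.im * Complex.I := (Complex.re_add_im z).symm
  have h3 : (starRingEnd ℂ) z = z.re - z.im * Complex.I := by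
    apply Complex.ext <;> simp
  rw [h1, conjLinear_apply, h3]
  conv_rhs => rw [h2]
  simp only [Complex.add_re, Complex.ofReal_re, Complex.mul_re, Complex.I_re, mul_zero,
    Complex.ofReal_im, Complex.I_im, mul_one, sub_self, add_zero, Complex.add_im, Complex.mul_im,
    zero_add]
  linear_combination ((z.im : ℂ) * A Complex.I) * Complex.I_mul_I

namespace IsDiscEmbedding

theorem affine {b : ℂ} {L : ℂ →L[ℝ] ℂ} (hL : 0 < L.det)
    (hb : ∀ z ∈ closedBall (0 : ℂ) 1, ‖b + L z‖ < 1) : IsDiscEmbedding fun z => b + L z where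
  contDiff := contDiff_const.add L.contDiff
  injOn z _ w _ h := injective_of_det_ne_zero hL.ne' (add_left_cancel h)
  mapsTo z hz := by simpa using hb z hz
  det_pos z _ := by
    rw [show fderiv ℝ (fun z => b + L z) z = L by
      rw [fderiv_const_add]; exact L.fderiv]
    exact hL

theorem conjAffine {b α β : ℂ} (hαβ : ‖β‖ < ‖α‖) (hb : ‖b‖ + (‖α‖ + ‖β‖) < 1) :
    IsDiscEmbedding fun z => b + conjLinear α β z := by
  refine affine ?_ fun z hz => ?_
  · rw [det_conjLinear]
    nlinarith [norm_nonneg α, norm_nonneg β]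
  · rw [mem_closedBall_zero_iff] at hz
    rw [conjLinear_apply]
    have h1 : ‖α * z + β * (starRingEnd ℂ) z‖ ≤ ‖α‖ + ‖β‖ := by
      refine (norm_add_le _ _).trans ?_
      rw [norm_mul, norm_mul, RCLike.norm_conj]
      nlinarith [norm_nonneg α, norm_nonneg β]
    linarith [norm_add_le b (α * z + β * (starRingEnd ℂ) z)]

variable {f : ℂ → ℂ}

theorem comp_smul (hf : IsDiscEmbedding f) {c : ℝ} (hc0 : 0 < c) (hc1 : c ≤ 1) :
    IsDiscEmbedding fun z => f (c • z) := by
  have hm : ∀ z ∈ closedBall (0 : ℂ) 1, c • z ∈ closedBall (0 : ℂ) 1 := by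
    intro z hz
    rw [mem_closedBall_zero_iff] at hz ⊢
    rw [norm_smul, Real.norm_of_nonneg hc0.le]
    nlinarith [norm_nonneg z]
  refine ⟨hf.contDiff.comp (contDiff_const_smul c), ?_, fun z hz => hf.mapsTo (hm z hz), ?_⟩
  · intro z hz w hw h
    exact smul_right_injective ℂ hc0.ne' (hf.injOn (hm z hz) (hm w hw) h)
  · intro z hz
    have h1 : fderiv ℝ (fun z => f (c • z)) z =
        (fderiv ℝ f (c • z)).comp (c • ContinuousLinearMap.id ℝ ℂ) :=
      ((hf.contDiff.differentiable (by simp) (c • z)).hasFDerivAt.comp z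
        ((hasFDerivAt_id z).const_smul c)).fderiv
    have h2 : ((fderiv ℝ f (c • z)).comp (c • ContinuousLinearMap.id ℝ ℂ)).det =
        (fderiv ℝ f (c • z)).det * c ^ 2 := by
      show LinearMap.det ((fderiv ℝ f (c • z) : ℂ →ₗ[ℝ] ℂ) ∘ₗ (c • LinearMap.id)) = _
      rw [LinearMap.det_comp, LinearMap.det_smul, LinearMap.det_id, Complex.finrank_real_complex,
        mul_one]
    rw [h1, h2]
    exact mul_pos (hf.det_pos _ (hm z hz)) (by positivity)

theorem isotopic_comp_smul (hf : IsDiscEmbedding f) {c : ℝ} (hc0 : 0 < c) (hc1 : c ≤ 1) :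
    DiscIsotopic f fun z => f (c • z) := by
  have h := DiscIsotopic.of_family (F := fun s z => f ((1 - s + s * c) • z)) ?_ ?_
  · simpa using h
  · have hc : ContDiff ℝ ∞ fun x : ℝ × ℂ => 1 - x.1 + x.1 * c := by fun_prop
    exact hf.contDiff.comp (hc.smul contDiff_snd)
  · rintro s ⟨hs0, hs1⟩
    exact hf.comp_smul (by nlinarith) (by nlinarith)

/-- After shrinking the disc, an embedding is isotopic to its linear part. -/
theorem exists_isotopic_linear (hf : IsDiscEmbedding f) {C : ℝ} :
    ∃ ε : ℝ, 0 < ε ∧ ε < 1 ∧ ‖f 0‖ + ε * C < 1 ∧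
      DiscIsotopic f fun z => f 0 + (ε • fderiv ℝ f 0) z := by
  set A := fderiv ℝ f 0 with hA
  have h0mem : (0 : ℂ) ∈ closedBall (0 : ℂ) 1 := by simp
  have hAdet : 0 < A.det := hf.det_pos 0 h0mem
  have hf0 : ‖f 0‖ < 1 := by simpa using hf.mapsTo h0mem
  have hc : Continuous (fderiv ℝ f) := hf.contDiff.continuous_fderiv (by simp)
  obtain ⟨m, hm, hlow⟩ := exists_norm_fderiv_lower_bound hf.contDiff (isCompact_singleton (x := 0))
    (singleton_nonempty _) (fun z hz => by
      rw [mem_singleton_iff.1 hz]; exact injective_of_det_ne_zero hAdet.ne')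
  obtain ⟨η, hη, hdet⟩ := Metric.eventually_nhds_iff_ball.1
    (ContinuousLinearMap.continuous_det.continuousAt.eventually
      (lt_mem_nhds hAdet : ∀ᶠ x in 𝓝 A.det, 0 < x))
  -- Within `η` of `A` the determinant stays positive; within `m / 2` the lower bound `m` for `A`
  -- still gives injectivity.
  set κ := min η (m / 2) with hκ
  have hκ0 : 0 < κ := lt_min hη (by linarith)
  obtain ⟨r, hr, hclose⟩ := Metric.eventually_nhds_iff_ball.1
    (hc.continuousAt.eventually (ball_mem_nhds (fderiv ℝ f 0) hκ0))
  -- `ε * D < 1 - ‖f 0‖` keeps the deformation inside the open disc; the share of `C` is the room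
  -- asked for by later linear deformations.
  set D := ‖A‖ + m + |C| + 1 with hD
  have hD0 : 0 < D := by positivity
  obtain ⟨ε, hε0, hε⟩ := exists_between (show (0 : ℝ) < min (min r 1) ((1 - ‖f 0‖) / D) from
    lt_min (lt_min hr one_pos) (div_pos (by linarith) hD0))
  have hεr : ε < r := hε.trans_le ((min_le_left _ _).trans (min_le_left _ _))
  have hε1 : ε < 1 := hε.trans_le ((min_le_left _ _).trans (min_le_right _ _))
  have hεD : ε * D < 1 - ‖f 0‖ := by
    rw [← lt_div_iff₀ hD0]
    exact hε.trans_le (min_le_right _ _)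
  refine ⟨ε, hε0, hε1, ?_, (hf.isotopic_comp_smul hε0 hε1.le).trans ?_⟩
  · nlinarith [le_abs_self C, norm_nonneg A]
  -- The straight line from the shrunken embedding to its affine approximation. Its derivative is
  -- `ε` times a map that is `κ`-close to `A`.
  let F : ℝ → ℂ → ℂ := fun s z => (1 - s) • f (ε • z) + s • (f 0 + ε • A z)
  have hF : ContDiff ℝ ∞ fun x : ℝ × ℂ => F x.1 x.2 := by
    have hc1 : ContDiff ℝ ∞ fun x : ℝ × ℂ => 1 - x.1 := by fun_prop
    refine ContDiff.add (hc1.smul ?_) (ContDiff.smul contDiff_fst ?_)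
    · exact hf.contDiff.comp (contDiff_snd.const_smul ε)
    · exact contDiff_const.add ((A.contDiff.comp contDiff_snd).const_smul ε)
  have h := DiscIsotopic.of_family hF ?_
  · simpa [F] using h
  rintro s ⟨hs0, hs1⟩
  have hFs : ContDiff ℝ ∞ (F s) := hF.comp (contDiff_const.prodMk contDiff_id)
  have hfd : ∀ z, fderiv ℝ (F s) z = ε • (A + (1 - s) • (fderiv ℝ f (ε • z) - A)) := by
    intro z
    have h1 : HasFDerivAt (fun z => f (ε • z))
        ((fderiv ℝ f (ε • z)).comp (ε • ContinuousLinearMap.id ℝ ℂ)) z :=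
      (hf.contDiff.differentiable (by simp) (ε • z)).hasFDerivAt.comp z
        ((hasFDerivAt_id z).const_smul ε)
    have h2 : HasFDerivAt (F s) ((1 - s) •
        ((fderiv ℝ f (ε • z)).comp (ε • ContinuousLinearMap.id ℝ ℂ)) + s • (ε • A)) z :=
      (h1.const_smul (1 - s)).add (((A.hasFDerivAt.const_smul ε).const_add (f 0)).const_smul s)
    rw [h2.fderiv]
    ext x
    simp only [_root_.add_apply, _root_.smul_apply, ContinuousLinearMap.comp_apply,
      ContinuousLinearMap.id_apply, map_smul, _root_.sub_apply]
    simp only [Complex.real_smul]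
    push_cast
    ring
  have hsmall : ∀ z ∈ closedBall (0 : ℂ) 1, ‖fderiv ℝ f (ε • z) - A‖ < κ := by
    intro z hz
    rw [mem_closedBall_zero_iff] at hz
    have := hclose (ε • z) (by
      rw [mem_ball_zero_iff, norm_smul, Real.norm_of_nonneg hε0.le]
      nlinarith [norm_nonneg z])
    rwa [dist_eq_norm] at this
  have hsmall' : ∀ z ∈ closedBall (0 : ℂ) 1, ‖(1 - s) • (fderiv ℝ f (ε • z) - A)‖ < κ := by
    intro z hz
    rw [norm_smul, Real.norm_of_nonneg (by linarith)]
    have := hsmall z hz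
    nlinarith [norm_nonneg (fderiv ℝ f (ε • z) - A)]
  have hdist : ∀ z ∈ closedBall (0 : ℂ) 1, ∀ w ∈ closedBall (0 : ℂ) 1,
      ‖F s w - F s z - (ε • A) (w - z)‖ ≤ ε * (m / 2) * ‖w - z‖ := by
    intro z hz w hw
    refine Convex.norm_image_sub_le_of_norm_fderiv_le' (𝕜 := ℝ)
      (fun x _ => hFs.differentiable (by simp) x) (fun x hx => ?_) (convex_closedBall 0 1) hz hw
    rw [hfd, smul_add, add_sub_cancel_left, norm_smul, Real.norm_of_nonneg hε0.le]
    exact mul_le_mul_of_nonneg_left ((hsmall' x hx).le.trans (min_le_right _ _)) hε0.le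
  refine ⟨hFs, ?_, ?_, ?_⟩
  · intro w hw z hz hwz
    have h1 := hdist z hz w hw
    rw [hwz, sub_self, zero_sub, norm_neg, _root_.smul_apply, norm_smul,
      Real.norm_of_nonneg hε0.le, mul_assoc] at h1
    have h2 := le_of_mul_le_mul_left h1 hε0
    have h3 := hlow 0 rfl (w - z)
    have h4 : ‖w - z‖ ≤ 0 := by nlinarith [norm_nonneg (w - z)]
    exact sub_eq_zero.1 (norm_le_zero_iff.1 h4)
  · intro w hw
    have h1 := hdist 0 h0mem w hw
    have hF0 : F s 0 = f 0 := by
      simp only [F, smul_zero, map_zero, add_zero]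
      rw [← add_smul]; simp
    rw [hF0, sub_zero] at h1
    rw [mem_closedBall_zero_iff] at hw
    have h2 : ‖(ε • A) w‖ ≤ ε * ‖A‖ := by
      rw [_root_.smul_apply, norm_smul, Real.norm_of_nonneg hε0.le]
      refine mul_le_mul_of_nonneg_left ?_ hε0.le
      exact (A.le_opNorm w).trans (mul_le_of_le_one_right (norm_nonneg _) hw)
    have h3 : ‖F s w‖ ≤ ‖f 0‖ + ‖(ε • A) w‖ + ‖F s w - f 0 - (ε • A) w‖ := by
      have : F s w = f 0 + (ε • A) w + (F s w - f 0 - (ε • A) w) := by ring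
      calc ‖F s w‖ = ‖f 0 + (ε • A) w + (F s w - f 0 - (ε • A) w)‖ := by rw [← this]
        _ ≤ _ := (norm_add_le _ _).trans (by gcongr; exact norm_add_le _ _)
    have h4 : ε * (m / 2) * ‖w‖ ≤ ε * m := by
      have : 0 ≤ ε * m := by positivity
      nlinarith [norm_nonneg w]
    have h5 : 0 ≤ ε * |C| := by positivity
    rw [mem_ball_zero_iff]
    nlinarith
  · intro z hz
    rw [hfd]
    have h1 : 0 < (A + (1 - s) • (fderiv ℝ f (ε • z) - A)).det := by
      refine hdet _ ?_
      rw [mem_ball, dist_eq_norm, add_sub_cancel_left]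
      exact (hsmall' z hz).trans_le (min_le_left _ _)
    have h2 : (ε • (A + (1 - s) • (fderiv ℝ f (ε • z) - A))).det =
        ε ^ 2 * (A + (1 - s) • (fderiv ℝ f (ε • z) - A)).det := by
      show LinearMap.det (ε • ((A + (1 - s) • (fderiv ℝ f (ε • z) - A) : ℂ →L[ℝ] ℂ) :
        ℂ →ₗ[ℝ] ℂ)) = _
      rw [LinearMap.det_smul, Complex.finrank_real_complex]
    rw [h2]
    positivity

/-- The linear part is `α z + β z̄` with `‖β‖ < ‖α‖`, by positivity of the determinant. First `β` is
deformed to `0`, then `α` to `1` along `exp ((1 - s) log α)`, and finally the translation `f 0` to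
`0`. -/
theorem exists_isotopic_scaling (hf : IsDiscEmbedding f) :
    ∃ ε : ℝ, 0 < ε ∧ ε < 1 ∧ DiscIsotopic f fun z => ε • z := by
  obtain ⟨α, β, hαβ⟩ := exists_eq_conjLinear (fderiv ℝ f 0)
  have hdet := hf.det_pos 0 (by simp)
  rw [hαβ, det_conjLinear] at hdet
  have hlt : ‖β‖ < ‖α‖ := by
    nlinarith [norm_nonneg α, norm_nonneg β]
  have hα0 : α ≠ 0 := norm_pos_iff.1 ((norm_nonneg β).trans_lt hlt)
  set lam := Complex.log α with hlam
  have hexp : Complex.exp lam = α := Complex.exp_log hα0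
  -- This `C` dominates the size of the linear maps in all three deformations; `exp ‖lam‖` bounds
  -- the path from `α` to `1`.
  obtain ⟨ε, hε0, hε1, hε, hiso⟩ := hf.exists_isotopic_linear
    (C := ‖α‖ + ‖β‖ + Real.exp ‖lam‖ + 1)
  refine ⟨ε, hε0, hε1, ?_⟩
  have hexp0 := Real.exp_pos ‖lam‖
  have hf0 := norm_nonneg (f 0)
  have hεn : ‖(ε : ℂ)‖ = ε := by rw [Complex.norm_real, Real.norm_of_nonneg hε0.le]
  have hsub : ∀ c : ℝ, 0 ≤ c → c ≤ ‖α‖ + ‖β‖ + Real.exp ‖lam‖ + 1 → ‖f 0‖ + ε * c < 1 := by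
    intro c _ hc
    nlinarith
  have e1 : (fun z => f 0 + (ε • fderiv ℝ f 0) z) =
      fun z => f 0 + conjLinear (ε * α) (ε * β) z := by
    funext z
    rw [hαβ, _root_.smul_apply, conjLinear_apply, conjLinear_apply, Complex.real_smul]
    ring
  rw [e1] at hiso
  have hsm : ∀ a b c : ℝ → ℂ, ContDiff ℝ ∞ a → ContDiff ℝ ∞ b → ContDiff ℝ ∞ c →
      ContDiff ℝ ∞ fun x : ℝ × ℂ => c x.1 + conjLinear (a x.1) (b x.1) x.2 := by
    intro a b c ha hb hc
    simp only [conjLinear_apply]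
    refine (hc.comp contDiff_fst).add (((ha.comp contDiff_fst).mul contDiff_snd).add
      ((hb.comp contDiff_fst).mul ?_))
    exact Complex.conjCLE.contDiff.comp contDiff_snd
  have hofReal : ContDiff ℝ ∞ fun s : ℝ => (s : ℂ) := Complex.ofRealCLM.contDiff
  have step1 := DiscIsotopic.of_family
    (F := fun s z => f 0 + conjLinear (ε * α) (ε * β * ((1 - s : ℝ) : ℂ)) z)
    (hsm _ _ _ contDiff_const (contDiff_const.mul (hofReal.comp (by fun_prop))) contDiff_const) ?_
  have step2 := DiscIsotopic.of_family
    (F := fun s z => f 0 + conjLinear (ε * Complex.exp (((1 - s : ℝ) : ℂ) * lam)) 0 z)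
    (hsm _ _ _ (contDiff_const.mul (((hofReal.comp (by fun_prop)).mul contDiff_const).cexp))
      contDiff_const contDiff_const) ?_
  have step3 := DiscIsotopic.of_family
    (F := fun s z => ((1 - s : ℝ) : ℂ) * f 0 + conjLinear ε 0 z)
    (hsm _ _ _ contDiff_const contDiff_const
      ((hofReal.comp (by fun_prop)).mul contDiff_const)) ?_
  · have e2 : (fun z : ℂ => ε • z) = fun z => ((1 - 1 : ℝ) : ℂ) * f 0 + conjLinear ε 0 z := by
      funext z
      simp [conjLinear_apply]
    rw [e2]
    have s1 : DiscIsotopic (fun z => f 0 + conjLinear (ε * α) (ε * β) z)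
        fun z => f 0 + conjLinear (ε * α) 0 z := by simpa using step1
    have s2 : DiscIsotopic (fun z => f 0 + conjLinear (ε * α) 0 z)
        fun z => f 0 + conjLinear ε 0 z := by simpa [hexp] using step2
    have s3 : DiscIsotopic (fun z => f 0 + conjLinear ε 0 z)
        fun z => ((1 - 1 : ℝ) : ℂ) * f 0 + conjLinear ε 0 z := by simpa using step3
    exact hiso.trans (s1.trans (s2.trans s3))
  · rintro s ⟨hs0, hs1⟩
    refine conjAffine ?_ ?_
    · have := hsub 1 zero_le_one (by nlinarith [norm_nonneg α, norm_nonneg β])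
      rw [norm_zero, hεn]; exact hε0
    · rw [norm_mul, Complex.norm_real, Real.norm_of_nonneg (by linarith), norm_zero, hεn]
      have := hsub 1 zero_le_one (by nlinarith [norm_nonneg α, norm_nonneg β])
      nlinarith
  · rintro s ⟨hs0, hs1⟩
    have h1 : ‖Complex.exp (((1 - s : ℝ) : ℂ) * lam)‖ ≤ Real.exp ‖lam‖ := by
      refine (Complex.norm_exp_le_exp_norm _).trans (Real.exp_le_exp.2 ?_)
      rw [norm_mul, Complex.norm_real, Real.norm_of_nonneg (by linarith)]
      nlinarith [norm_nonneg lam]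
    refine conjAffine ?_ ?_
    · rw [norm_zero, norm_mul, hεn]
      exact mul_pos hε0 (norm_pos_iff.2 (Complex.exp_ne_zero _))
    · rw [norm_zero, norm_mul, hεn, add_zero]
      have := hsub (Real.exp ‖lam‖) hexp0.le (by nlinarith [norm_nonneg α, norm_nonneg β])
      nlinarith
  · rintro s ⟨hs0, hs1⟩
    have h1 : ‖((1 - s : ℝ) : ℂ)‖ = 1 - s := by
      rw [Complex.norm_real, Real.norm_of_nonneg (by linarith)]
    refine conjAffine ?_ ?_
    · rw [norm_mul, norm_mul, norm_mul, h1, hεn, mul_assoc]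
      refine mul_lt_mul_of_pos_left ?_ hε0
      nlinarith [norm_nonneg β]
    · rw [norm_mul, norm_mul, norm_mul, h1, hεn]
      have := hsub (‖α‖ + ‖β‖) (by positivity) (by linarith)
      have h2 : ε * ‖β‖ * (1 - s) ≤ ε * ‖β‖ :=
        mul_le_of_le_one_right (by positivity) (by linarith)
      nlinarith

/-- Any two orientation-preserving embeddings of the disc are ambient isotopic. -/
theorem isotopic {g : ℂ → ℂ} (hf : IsDiscEmbedding f) (hg : IsDiscEmbedding g) :
    DiscIsotopic f g := by
  obtain ⟨ε, hε0, hε1, h1⟩ := hf.exists_isotopic_scaling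
  obtain ⟨ε', hε0', hε1', h2⟩ := hg.exists_isotopic_scaling
  refine h1.trans (DiscIsotopic.trans ?_ h2.symm)
  have h := DiscIsotopic.of_family (F := fun s z => (ε + s * (ε' - ε)) • z)
    ((by fun_prop : ContDiff ℝ ∞ fun x : ℝ × ℂ => ε + x.1 * (ε' - ε)).smul contDiff_snd) ?_
  · simpa using h
  · rintro s ⟨hs0, hs1⟩
    have hcomb : ε + s * (ε' - ε) = (1 - s) * ε + s * ε' := by ring
    have hpos : 0 < ε + s * (ε' - ε) := by
      rw [hcomb]
      rcases hs0.eq_or_lt with rfl | hs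
      · simpa using hε0
      · have := mul_pos hs hε0'
        have := mul_nonneg (sub_nonneg.2 hs1) hε0.le
        linarith
    have hlt : ε + s * (ε' - ε) < 1 := by
      rw [hcomb]
      rcases hs0.eq_or_lt with rfl | hs
      · simpa using hε1
      · have := mul_lt_mul_of_pos_left hε1' hs
        have := mul_le_mul_of_nonneg_left hε1.le (sub_nonneg.2 hs1)
        linarith
    have h3 := conjAffine (b := 0) (α := ((ε + s * (ε' - ε) : ℝ) : ℂ)) (β := 0)
      (by rw [norm_zero, Complex.norm_real, Real.norm_of_nonneg hpos.le]; exact hpos)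
      (by rw [norm_zero, Complex.norm_real, Real.norm_of_nonneg hpos.le]; linarith)
    convert h3 using 2 with z
    rw [conjLinear_apply, Complex.real_smul]
    simp

end IsDiscEmbedding

/-! ### From a local flow with uniform existence time to a flow. -/

section LocalFlow

variable {M : Type*} [TopologicalSpace M] {ψ : ℝ → M → M} {ε : ℝ}

omit [TopologicalSpace M] in
theorem localFlow_nat_mul (h0 : ∀ p, ψ 0 p = p)
    (hadd : ∀ s t, |s| < ε → |t| < ε → |s + t| < ε → ∀ p, ψ (s + t) p = ψ s (ψ t p))
    (u : ℝ) (k : ℕ) (hk : |k * u| < ε) : ψ (k * u) = (ψ u)^[k] := by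
  induction k with
  | zero => funext p; simp [h0]
  | succ k ih =>
    have e1 : ((k + 1 : ℕ) : ℝ) * u = u + k * u := by push_cast; ring
    have habs : |((k + 1 : ℕ) : ℝ) * u| = (k + 1) * |u| := by
      rw [abs_mul, abs_of_nonneg (by positivity)]; push_cast; ring
    have hku : |(k : ℝ) * u| = k * |u| := by rw [abs_mul, abs_of_nonneg (by positivity)]
    rw [habs] at hk
    have h1 : |(k : ℝ) * u| < ε := by rw [hku]; nlinarith [abs_nonneg u]
    have h2 : |u| < ε := by
      have : 0 ≤ (k : ℝ) * |u| := by positivity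
      nlinarith
    funext p
    rw [e1, hadd u (k * u) h2 h1 (by rw [← e1, habs]; exact hk), ih h1,
      Function.iterate_succ_apply']

omit [TopologicalSpace M] in
-- Both subdivisions are compared with the common one into `n * m` steps.
theorem localFlow_iterate_eq (h0 : ∀ p, ψ 0 p = p)
    (hadd : ∀ s t, |s| < ε → |t| < ε → |s + t| < ε → ∀ p, ψ (s + t) p = ψ s (ψ t p))
    (t : ℝ) {n m : ℕ} (hn : 0 < n) (hm : 0 < m) (hn' : |t / n| < ε) (hm' : |t / m| < ε) :
    (ψ (t / n))^[n] = (ψ (t / m))^[m] := by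
  have hn0 : (n : ℝ) ≠ 0 := by positivity
  have hm0 : (m : ℝ) ≠ 0 := by positivity
  have e1 : t / n = m * (t / (n * m)) := by field_simp
  have e2 : t / m = n * (t / (n * m)) := by field_simp
  rw [e1, e2, localFlow_nat_mul h0 hadd _ m (by rwa [← e1]),
    localFlow_nat_mul h0 hadd _ n (by rwa [← e2]), ← Function.iterate_mul, ← Function.iterate_mul,
    Nat.mul_comm m n]

variable [ChartedSpace (EuclideanSpace ℝ (Fin 3)) M]

/-- A smooth local flow with a uniform time of existence extends to a smooth flow. -/
theorem exists_flow_of_localFlow (hε : 0 < ε) (h0 : ∀ p, ψ 0 p = p)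
    (hadd : ∀ s t, |s| < ε → |t| < ε → |s + t| < ε → ∀ p, ψ (s + t) p = ψ s (ψ t p))
    (hψ : ∀ t p, |t| < ε → ContMDiffAt (𝓘(ℝ, ℝ).prod (𝓡 3)) (𝓡 3) ∞
      (fun x : ℝ × M => ψ x.1 x.2) (t, p)) :
    ∃ φ : Flow ℝ M, IsSmoothFlow φ ∧
      ∀ (t : ℝ) (n : ℕ), 0 < n → |t / n| < ε → ∀ p, φ t p = (ψ (t / n))^[n] p := by
  -- Enough steps to make each of them shorter than `ε`; any larger number gives the same map.
  let N : ℝ → ℕ := fun t => ⌊|t| / ε⌋₊ + 1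
  have hN : ∀ t n, N t ≤ n → |t / n| < ε := by
    intro t n hn
    have hn0 : (0 : ℝ) < n := by
      have : 0 < n := lt_of_lt_of_le (Nat.succ_pos _) hn
      exact_mod_cast this
    rw [abs_div, abs_of_pos hn0, div_lt_iff₀ hn0]
    have h1 : |t| / ε < n :=
      (Nat.lt_floor_add_one _).trans_le (by exact_mod_cast hn)
    rw [div_lt_iff₀ hε] at h1
    linarith
  have hN0 : ∀ t, 0 < N t := fun t => Nat.succ_pos _
  let Φ : ℝ → M → M := fun t => (ψ (t / N t))^[N t]
  have hΦ : ∀ (t : ℝ) (n : ℕ), 0 < n → |t / n| < ε → Φ t = (ψ (t / n))^[n] := fun t n hn hn' =>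
    localFlow_iterate_eq h0 hadd t (hN0 t) hn (hN t _ le_rfl) hn'
  have hsm : ContMDiff (𝓘(ℝ, ℝ).prod (𝓡 3)) (𝓡 3) ∞ (fun x : ℝ × M => Φ x.1 x.2) := by
    rintro ⟨t₀, p₀⟩
    -- The number of steps jumps with the time, but the one chosen for `t₀` still serves for all
    -- times nearby.
    set n := N t₀ with hn
    have hlt : |t₀ / n| < ε := hN t₀ n le_rfl
    have hdiv : ContMDiff (𝓘(ℝ, ℝ).prod (𝓡 3)) 𝓘(ℝ, ℝ) ∞ (fun x : ℝ × M => x.1 / n) :=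
      ((contDiff_id.div_const (n : ℝ)).contMDiff).comp contMDiff_fst
    have hit : ∀ k : ℕ, ContMDiffAt (𝓘(ℝ, ℝ).prod (𝓡 3)) (𝓡 3) ∞
        (fun x : ℝ × M => (ψ (x.1 / n))^[k] x.2) (t₀, p₀) := by
      intro k
      induction k with
      | zero => exact contMDiffAt_snd
      | succ k ih =>
        simp only [Function.iterate_succ_apply']
        exact ContMDiffAt.comp (t₀, p₀) (I' := 𝓘(ℝ, ℝ).prod (𝓡 3))
          (g := fun x : ℝ × M => ψ x.1 x.2) (f := fun x : ℝ × M => (x.1 / n, (ψ (x.1 / n))^[k] x.2))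
          (hψ _ _ hlt) (hdiv.contMDiffAt.prodMk ih)
    refine (hit n).congr_of_eventuallyEq ?_
    have hc : ContinuousAt (fun x : ℝ × M => |x.1 / n|) (t₀, p₀) := by fun_prop
    filter_upwards [hc.eventually_lt continuousAt_const hlt] with x hx
    rw [hΦ x.1 n (hN0 t₀) hx]
  refine ⟨⟨Φ, hsm.continuous, ?_, ?_⟩, hsm, fun t n hn hn' p => congrFun (hΦ t n hn hn') p⟩
  · intro s t p
    -- One number of steps fine enough for `s`, `t` and `s + t`. The short steps commute, so the
    -- iterates can be rearranged.
    set n := N s + N t + N (s + t) with hn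
    have hn0 : 0 < n := by have := hN0 s; omega
    have h1 := hN s n (by omega)
    have h2 := hN t n (by omega)
    have h3 := hN (s + t) n (by omega)
    rw [hΦ _ n hn0 h1, hΦ _ n hn0 h2, hΦ _ n hn0 h3]
    have e1 : (s + t) / n = s / n + t / n := add_div _ _ _
    have e2 : s / n + t / n = t / n + s / n := add_comm _ _
    rw [e1] at h3 ⊢
    have hcomp : ψ (s / n + t / n) = ψ (s / n) ∘ ψ (t / n) := funext (hadd _ _ h1 h2 h3)
    have hcomm : Function.Commute (ψ (s / n)) (ψ (t / n)) := by
      intro q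
      rw [← hadd _ _ h1 h2 h3, e2, hadd _ _ h2 h1 (by rwa [← e2])]
    rw [hcomp, hcomm.comp_iterate]
    rfl
  · intro p
    rw [hΦ 0 1 one_pos (by simpa using hε)]
    simp [h0]

end LocalFlow

/-! ### Measuring time along the tube. -/

namespace IsContractionTube

open ComplexFoliation

variable {M : Type*} [TopologicalSpace M] [ChartedSpace (EuclideanSpace ℝ (Fin 3)) M]
  {F : ComplexFoliation M} {φ : Flow ℝ M} {γ : Set M}
  {τ : OpenPartialHomeomorph (ℂ × Circle) M} {T : ℝ}

theorem isOpen_openTube (hτ : IsContractionTube φ γ τ) : IsOpen (openTube τ) :=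
  τ.isOpen_image_of_subset_source (isOpen_ball.prod isOpen_univ) fun y hy =>
    hτ.mem_source (mem_ball_zero_iff.1 hy.1).le y.2

theorem openTube_subset_target (hτ : IsContractionTube φ γ τ) : openTube τ ⊆ τ.target := by
  rintro _ ⟨⟨z, θ⟩, ⟨hz, -⟩, rfl⟩
  exact τ.map_source (hτ.mem_source (mem_ball_zero_iff.1 hz).le θ)

omit [ChartedSpace (EuclideanSpace ℝ (Fin 3)) M] in
theorem mem_openTube {z : ℂ} (hz : z ∈ ball (0 : ℂ) 1) (θ : Circle) : τ (z, θ) ∈ openTube τ :=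
  ⟨(z, θ), ⟨hz, mem_univ _⟩, rfl⟩

theorem symm_apply (hτ : IsContractionTube φ γ τ) {z : ℂ} (hz : z ∈ ball (0 : ℂ) 1) (θ : Circle) :
    τ.symm (τ (z, θ)) = (z, θ) :=
  τ.left_inv (hτ.mem_source (mem_ball_zero_iff.1 hz).le θ)

theorem symm_fst_mem_ball (hτ : IsContractionTube φ γ τ) {p : M} (hp : p ∈ openTube τ) :
    (τ.symm p).1 ∈ ball (0 : ℂ) 1 ∧ τ ((τ.symm p).1, (τ.symm p).2) = p := by
  obtain ⟨⟨z, θ⟩, ⟨hz, -⟩, rfl⟩ := hp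
  rw [hτ.symm_apply hz]
  exact ⟨hz, rfl⟩

/-- For negative times the tube is not preserved; with both end points in the tube, the motion can
be run backwards. -/
theorem phase_eq_of_flow_eq (hγ : γ ∈ closedOrbits F φ) (hτ : IsContractionTube φ γ τ) {t : ℝ}
    {θ θ' : Circle} {z z' : ℂ} (hz : z ∈ ball (0 : ℂ) 1) (hz' : z' ∈ ball (0 : ℂ) 1)
    (h : φ t (τ (z, θ)) = τ (z', θ')) : phase φ τ t θ = θ' := by
  have key : ∀ (t : ℝ) (θ θ' : Circle) (z z' : ℂ), 0 ≤ t → z ∈ ball (0 : ℂ) 1 →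
      z' ∈ ball (0 : ℂ) 1 → φ t (τ (z, θ)) = τ (z', θ') → phase φ τ t θ = θ' := by
    intro t θ θ' z z' ht hz hz' h
    obtain ⟨w, hw, h1⟩ := hτ.flow_slices hγ ht θ hz
    have := congrArg τ.symm (h1.symm.trans h)
    rw [hτ.symm_apply hw, hτ.symm_apply hz'] at this
    exact congrArg Prod.snd this
  rcases le_total 0 t with ht | ht
  · exact key t θ θ' z z' ht hz hz' h
  · have h1 : φ (-t) (τ (z', θ')) = τ (z, θ) := by
      rw [← h, ← φ.map_add, neg_add_cancel, φ.map_zero_apply]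
    have h2 := key (-t) θ' θ z' z (by linarith) hz' hz h1
    rw [← h2, ← hτ.phase_add hγ, add_neg_cancel, hτ.phase_zero]

theorem exists_clock (hγ : γ ∈ closedOrbits F φ) (hτ : IsContractionTube φ γ τ)
    (hT : IsPeriod φ τ T) (θ₀ θ : Circle) : ∃ s ∈ Ico 0 T, phase φ τ s θ₀ = θ := by
  obtain ⟨t, -, ht⟩ := hτ.exists_phase_eq hγ θ₀ θ
  refine ⟨toIcoMod hT.1 0 t, by simpa using toIcoMod_mem_Ico hT.1 0 t, ?_⟩
  have h1 : t = toIcoMod hT.1 0 t + toIcoDiv hT.1 0 t • T := (toIcoMod_add_toIcoDiv_zsmul _ _ _).symm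
  have h2 : phase φ τ (toIcoDiv hT.1 0 t • T) θ₀ = θ₀ := (hT.2 _ _).2 ⟨toIcoDiv hT.1 0 t, by simp⟩
  rw [← ht]
  conv_rhs => rw [h1, hτ.phase_add hγ, h2]

theorem phase_injOn (hγ : γ ∈ closedOrbits F φ) (hτ : IsContractionTube φ γ τ)
    (hT : IsPeriod φ τ T) {θ₀ : Circle} {s s' : ℝ} (hs : |s - s'| < T)
    (h : phase φ τ s θ₀ = phase φ τ s' θ₀) : s = s' := by
  have h1 : phase φ τ (s - s') θ₀ = θ₀ := by
    rw [sub_eq_add_neg, add_comm, hτ.phase_add hγ, h, ← hτ.phase_add hγ, neg_add_cancel,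
      hτ.phase_zero]
  obtain ⟨k, hk⟩ := (hT.2 _ _).1 h1
  have hk0 : k = 0 := by
    rw [hk, abs_mul, abs_of_pos hT.1] at hs
    have h2 : |(k : ℝ)| < 1 := by
      by_contra hle
      nlinarith [hT.1, not_lt.1 hle]
    have h3 : |k| < 1 := by exact_mod_cast h2
    exact Int.abs_lt_one_iff.1 h3
  rw [hk0] at hk
  simp at hk
  linarith

/-- The time in `[0, T)` after which the core reaches `θ` from `θ₀`. -/
def clock (hγ : γ ∈ closedOrbits F φ) (hτ : IsContractionTube φ γ τ)
    (hT : IsPeriod φ τ T) (θ₀ θ : Circle) : ℝ :=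
  (hτ.exists_clock hγ hT θ₀ θ).choose

theorem clock_mem (hγ : γ ∈ closedOrbits F φ) (hτ : IsContractionTube φ γ τ)
    (hT : IsPeriod φ τ T) (θ₀ θ : Circle) : hτ.clock hγ hT θ₀ θ ∈ Ico 0 T :=
  (hτ.exists_clock hγ hT θ₀ θ).choose_spec.1

theorem phase_clock (hγ : γ ∈ closedOrbits F φ) (hτ : IsContractionTube φ γ τ)
    (hT : IsPeriod φ τ T) (θ₀ θ : Circle) : phase φ τ (hτ.clock hγ hT θ₀ θ) θ₀ = θ :=
  (hτ.exists_clock hγ hT θ₀ θ).choose_spec.2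

theorem clock_phase (hγ : γ ∈ closedOrbits F φ) (hτ : IsContractionTube φ γ τ)
    (hT : IsPeriod φ τ T) (θ₀ : Circle) {s : ℝ} (hs : s ∈ Ico 0 T) :
    hτ.clock hγ hT θ₀ (phase φ τ s θ₀) = s := by
  have h1 := hτ.clock_mem hγ hT θ₀ (phase φ τ s θ₀)
  refine hτ.phase_injOn hγ hT (θ₀ := θ₀) ?_ (hτ.phase_clock hγ hT θ₀ _)
  rw [abs_lt]
  constructor <;> linarith [h1.1, h1.2, hs.1, hs.2]

/-- The phases reached at times of `[0, T]` outside `U` form a compact set that misses `θ`. The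
phase `θ₀` is excluded because the clock jumps there from `T` to `0`. -/
theorem continuousAt_clock (hγ : γ ∈ closedOrbits F φ) (hτ : IsContractionTube φ γ τ)
    (hT : IsPeriod φ τ T) {θ₀ θ : Circle} (hθ : θ ≠ θ₀) :
    ContinuousAt (hτ.clock hγ hT θ₀) θ := by
  rw [ContinuousAt, _root_.tendsto_nhds]
  intro U hU hmem
  have hc : Continuous fun s : ℝ => phase φ τ s θ₀ :=
    (hτ.continuous_phase hγ).comp (continuous_id.prodMk continuous_const)
  have hK : IsCompact ((fun s : ℝ => phase φ τ s θ₀) '' (Icc 0 T \ U)) :=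
    (isCompact_Icc.diff hU).image hc
  have hθK : θ ∉ (fun s : ℝ => phase φ τ s θ₀) '' (Icc 0 T \ U) := by
    rintro ⟨s, ⟨hs, hsU⟩, hsθ⟩
    dsimp only at hsθ
    rcases hs.2.eq_or_lt with rfl | hlt
    · rw [hT.phase_eq] at hsθ
      exact hθ hsθ.symm
    · rw [← hsθ, hτ.clock_phase hγ hT θ₀ ⟨hs.1, hlt⟩] at hmem
      exact hsU hmem
  filter_upwards [hK.isClosed.isOpen_compl.mem_nhds hθK] with θ' hθ'
  by_contra hout
  have h1 := hτ.clock_mem hγ hT θ₀ θ'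
  exact hθ' ⟨_, ⟨Ico_subset_Icc_self h1, hout⟩, hτ.phase_clock hγ hT θ₀ θ'⟩

variable [T2Space M] [CompactSpace M]

theorem eventually_height_flow_tube (hS : IsFDS F φ) (hγ : γ ∈ closedOrbits F φ)
    (hτ : IsContractionTube φ γ τ) {z : ℂ} (hz : z ∈ ball (0 : ℂ) 1) (θ : Circle)
    {e : OpenPartialHomeomorph M (ℂ × ℝ)} (he : e ∈ F.atlas) (h : τ (z, θ) ∈ e.source) :
    ∀ᶠ t in 𝓝 (0 : ℝ), (e (φ t (τ (z, θ)))).2 = (e (τ (z, phase φ τ t θ))).2 := by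
  have hprod := hτ.eventually_height_tube_prod hS hγ (mem_ball_zero_iff.1 hz) θ he h
  have h1 : Tendsto (fun t : ℝ => φ t (τ (z, θ))) (𝓝 0) (𝓝 (τ (z, θ))) := by
    have : ContinuousAt (fun t : ℝ => φ t (τ (z, θ))) 0 :=
      (φ.continuous continuous_id continuous_const).continuousAt
    simpa only [ContinuousAt, φ.map_zero_apply] using this
  have hc : Tendsto (fun t : ℝ => τ.symm (φ t (τ (z, θ)))) (𝓝 0) (𝓝 (z, θ)) := by
    have h2 := (τ.symm.continuousAt (hτ.openTube_subset_target
      (mem_openTube hz θ))).tendsto.comp h1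
    rwa [hτ.symm_apply hz] at h2
  filter_upwards [hc.eventually hprod, h1.eventually (hτ.isOpen_openTube.mem_nhds
    (mem_openTube hz θ))] with t h3 h4
  obtain ⟨h5, h6⟩ := hτ.symm_fst_mem_ball h4
  have h7 := hτ.phase_eq_of_flow_eq hγ hz h5 h6.symm
  rw [show τ (τ.symm (φ t (τ (z, θ)))) = φ t (τ (z, θ)) from h6, ← h7] at h3
  exact h3.2

/-- Near `τ (z, θ)` the clock is its value at `θ` plus `g` of the height, where `g` is a local
inverse of the height along the orbit of `τ (z, θ)`; it exists as the transverse speed is nonzero.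
That the height of a point is the one on this orbit at the same phase is the tangency of the discs.
-/
theorem contMDiffAt_clock (hS : IsFDS F φ) (hγ : γ ∈ closedOrbits F φ)
    (hτ : IsContractionTube φ γ τ) (hT : IsPeriod φ τ T) {θ₀ θ : Circle} (hθ : θ ≠ θ₀) {z : ℂ}
    (hz : z ∈ ball (0 : ℂ) 1) :
    ContMDiffAt (𝓡 3) 𝓘(ℝ, ℝ) ∞ (fun p => hτ.clock hγ hT θ₀ (τ.symm p).2) (τ (z, θ)) := by
  obtain ⟨e, he, hpe⟩ := F.cover (τ (z, θ))
  have hp0 : φ 0 (τ (z, θ)) ∈ e.source := by rwa [φ.map_zero_apply]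
  set v : ℝ → ℝ := fun t => (e (φ t (τ (z, θ)))).2 with hv
  have hvs : ContDiffAt ℝ ∞ v 0 := contDiffAt_height_flow hS.smooth he hp0
  have hv0 : v 0 = (e (τ (z, θ))).2 := by simp only [hv, φ.map_zero_apply]
  have hderiv := hS.smooth.hasDerivAt_comp (t := 0) (q := τ (z, θ))
    (mdifferentiableAt_height he hp0)
  rw [φ.map_zero_apply] at hderiv
  have hne := heightDeriv_velocity_ne_zero hS
    (hτ.mem_transverseRegion hS hγ (mem_ball_zero_iff.1 hz).le θ) he hpe
  obtain ⟨g, hg, -, -, hgv⟩ := hvs.exists_local_inverse (by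
    rw [injective_iff_map_eq_zero]
    intro x hx
    have h1 : fderiv ℝ v 0 x = x * heightDeriv e (τ (z, θ)) (velocity φ (τ (z, θ))) := by
      rw [hderiv.hasFDerivAt.fderiv]
      simp [heightDeriv]
    rw [h1] at hx
    exact (mul_eq_zero.1 hx).resolve_right hne)
  rw [hv0] at hg
  have hheight : ContMDiffAt (𝓡 3) 𝓘(ℝ, ℝ) ∞ (fun p => (e p).2) (τ (z, θ)) :=
    ContMDiffAt.comp (τ (z, θ)) (contDiff_snd.contMDiff.contMDiffAt :
      ContMDiffAt 𝓘(ℝ, ℂ × ℝ) 𝓘(ℝ, ℝ) ∞ (Prod.snd : ℂ × ℝ → ℝ) (e (τ (z, θ))))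
      ((F.smooth e he).contMDiffAt (e.open_source.mem_nhds hpe))
  have hsm : ContMDiffAt (𝓡 3) 𝓘(ℝ, ℝ) ∞
      (fun p => hτ.clock hγ hT θ₀ θ + g (e p).2) (τ (z, θ)) := by
    have h1 : ContMDiffAt 𝓘(ℝ, ℝ) 𝓘(ℝ, ℝ) ∞ (fun x => hτ.clock hγ hT θ₀ θ + g x)
        (e (τ (z, θ))).2 := (contDiffAt_const.add hg).contMDiffAt
    exact ContMDiffAt.comp (g := fun x => hτ.clock hγ hT θ₀ θ + g x) (f := fun p => (e p).2)
      (τ (z, θ)) h1 hheight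
  refine hsm.congr_of_eventuallyEq ?_
  have hsymm : Tendsto τ.symm (𝓝 (τ (z, θ))) (𝓝 (z, θ)) := by
    have := (τ.symm.continuousAt (hτ.openTube_subset_target (mem_openTube hz θ))).tendsto
    rwa [hτ.symm_apply hz] at this
  have hprod := hτ.eventually_height_tube_prod hS hγ (mem_ball_zero_iff.1 hz) θ he hpe
  have hflow := hτ.eventually_height_flow_tube hS hγ hz θ he hpe
  have hclock : Tendsto (fun p => hτ.clock hγ hT θ₀ (τ.symm p).2 - hτ.clock hγ hT θ₀ θ)
      (𝓝 (τ (z, θ))) (𝓝 0) := by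
    have h1 := ((hτ.continuousAt_clock hγ hT hθ).tendsto.comp
      (continuousAt_snd.tendsto.comp hsymm)).sub_const (hτ.clock hγ hT θ₀ θ)
    rwa [sub_self] at h1
  filter_upwards [hsymm.eventually hprod, hclock.eventually hflow, hclock.eventually hgv,
    hτ.isOpen_openTube.mem_nhds (mem_openTube hz θ)] with p h1 h2 h3 h4
  obtain ⟨-, h6⟩ := hτ.symm_fst_mem_ball h4
  set d := hτ.clock hγ hT θ₀ (τ.symm p).2 - hτ.clock hγ hT θ₀ θ with hd
  have h7 : phase φ τ d θ = (τ.symm p).2 := by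
    have h8 := hτ.phase_clock hγ hT θ₀ θ
    conv_lhs => rw [← h8]
    rw [← hτ.phase_add hγ, hd, sub_add_cancel, hτ.phase_clock]
  rw [show τ (τ.symm p) = p from h6, ← h7, ← h2] at h1
  rw [h1.2]
  have h9 : g (e (φ d (τ (z, θ)))).2 = d := h3
  rw [h9, hd]
  ring

end IsContractionTube

/-! ### Return maps of the tube as disc embeddings. -/

/-- A function that is smooth near the closed unit disc agrees there with a globally smooth one. -/
theorem exists_contDiff_eventuallyEq {R : ℂ → ℂ} {U : Set ℂ} (hU : IsOpen U)
    (hsub : closedBall (0 : ℂ) 1 ⊆ U) (hR : ∀ z ∈ U, ContDiffAt ℝ ∞ R z) :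
    ∃ R' : ℂ → ℂ, ContDiff ℝ ∞ R' ∧ ∀ z ∈ closedBall (0 : ℂ) 1, R' =ᶠ[𝓝 z] R := by
  obtain ⟨δ, hδ, hδU⟩ := (isCompact_closedBall (0 : ℂ) 1).exists_cthickening_subset_open hU hsub
  rw [cthickening_closedBall hδ.le zero_le_one] at hδU
  let χ : ContDiffBump (0 : ℂ) := ⟨1 + δ / 3, 1 + δ / 2, by linarith, by linarith⟩
  refine ⟨fun z => χ z • R z, ?_, fun z hz => ?_⟩
  · rw [contDiff_iff_contDiffAt]
    intro z
    by_cases hz : z ∈ closedBall (0 : ℂ) (δ + 1)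
    · exact χ.contDiff.contDiffAt.smul (hR z (hδU hz))
    · refine (contDiffAt_const (c := (0 : ℂ))).congr_of_eventuallyEq ?_
      filter_upwards [isClosed_closedBall.isOpen_compl.mem_nhds hz] with w hw
      have h1 : χ w = 0 := χ.zero_of_le_dist (by
        have h2 : δ + 1 < dist w 0 := not_le.1 hw
        change 1 + δ / 2 ≤ dist w 0
        linarith)
      rw [h1, zero_smul]
  · have hz' : z ∈ ball (0 : ℂ) (1 + δ / 3) :=
      closedBall_subset_ball (by linarith) hz
    filter_upwards [isOpen_ball.mem_nhds hz'] with w hw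
    rw [χ.one_of_mem_closedBall (ball_subset_closedBall hw), one_smul]

namespace IsContractionTube

open ComplexFoliation

variable {M : Type*} [TopologicalSpace M] [ChartedSpace (EuclideanSpace ℝ (Fin 3)) M]
  {F : ComplexFoliation M} {φ : Flow ℝ M} {γ : Set M}
  {τ : OpenPartialHomeomorph (ℂ × Circle) M} {T : ℝ}

theorem contMDiffAt_tube_left (hτ : IsContractionTube φ γ τ) {θ : Circle} {z : ℂ}
    (hz : (z, θ) ∈ τ.source) :
    ContMDiffAt 𝓘(ℝ, ℂ) (𝓡 3) ∞ (fun w : ℂ => τ (w, θ)) z :=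
  ContMDiffAt.comp (g := τ) (f := fun w : ℂ => (w, θ)) z
    (hτ.smooth.contMDiffAt (τ.open_source.mem_nhds hz))
    (contMDiffAt_id.prodMk contMDiffAt_const)

theorem contDiffAt_sliceMap (hφ : IsSmoothFlow φ) (hτ : IsContractionTube φ γ τ) {t : ℝ}
    {θ : Circle} {z : ℂ} (hz : (z, θ) ∈ τ.source) (ht : φ t (τ (z, θ)) ∈ τ.target) :
    ContDiffAt ℝ ∞ (fun x : ℝ × ℂ => sliceMap φ τ x.1 θ x.2) (t, z) := by
  rw [← contMDiffAt_iff_contDiffAt]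
  have h1 : ContMDiffAt 𝓘(ℝ, ℝ × ℂ) (𝓘(ℝ, ℝ).prod (𝓡 3)) ∞
      (fun x : ℝ × ℂ => (x.1, τ (x.2, θ))) (t, z) :=
    contDiff_fst.contMDiff.contMDiffAt.prodMk (ContMDiffAt.comp (I' := 𝓘(ℝ, ℂ))
      (g := fun w : ℂ => τ (w, θ)) (f := Prod.snd) (t, z) (hτ.contMDiffAt_tube_left hz)
      contDiff_snd.contMDiff.contMDiffAt)
  have h2 : ContMDiffAt 𝓘(ℝ, ℝ × ℂ) (𝓡 3) ∞
      (fun x : ℝ × ℂ => φ x.1 (τ (x.2, θ))) (t, z) :=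
    ContMDiffAt.comp (g := fun x : ℝ × M => φ x.1 x.2) (f := fun x : ℝ × ℂ => (x.1, τ (x.2, θ)))
      (t, z) hφ.contMDiffAt h1
  have h3 : ContMDiffAt 𝓘(ℝ, ℝ × ℂ) (𝓘(ℝ, ℂ).prod (𝓡 1)) ∞
      (fun x : ℝ × ℂ => τ.symm (φ x.1 (τ (x.2, θ)))) (t, z) :=
    ContMDiffAt.comp (g := τ.symm) (f := fun x : ℝ × ℂ => φ x.1 (τ (x.2, θ))) (t, z)
      (hτ.smooth_symm.contMDiffAt (τ.open_target.mem_nhds ht)) h2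
  exact contMDiffAt_fst.comp (t, z) h3

theorem contDiffAt_sliceMap_right (hφ : IsSmoothFlow φ) (hτ : IsContractionTube φ γ τ) {t : ℝ}
    {θ : Circle} {z : ℂ} (hz : (z, θ) ∈ τ.source) (ht : φ t (τ (z, θ)) ∈ τ.target) :
    ContDiffAt ℝ ∞ (sliceMap φ τ t θ) z :=
  ContDiffAt.comp (g := fun x : ℝ × ℂ => sliceMap φ τ x.1 θ x.2) (f := fun w : ℂ => (t, w)) z
    (hτ.contDiffAt_sliceMap hφ hz ht) (contDiffAt_const.prodMk contDiffAt_id)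

theorem flow_mem_target (hτ : IsContractionTube φ γ τ) {t : ℝ} (ht : 0 ≤ t) (θ : Circle) {z : ℂ}
    (hz : ‖z‖ ≤ 1) : φ t (τ (z, θ)) ∈ τ.target := by
  obtain ⟨h1, h2⟩ := hτ.flow_tube ht θ hz
  rw [h1]
  exact τ.map_source (hτ.mem_source h2 _)

theorem sliceMap_neg_sliceMap (hτ : IsContractionTube φ γ τ) {t : ℝ} (ht : 0 ≤ t) (θ : Circle)
    {z : ℂ} (hz : ‖z‖ ≤ 1) :
    sliceMap φ τ (-t) (phase φ τ t θ) (sliceMap φ τ t θ z) = z := by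
  obtain ⟨h1, h2⟩ := hτ.flow_tube ht θ hz
  unfold sliceMap at h1 ⊢
  rw [← h1, ← φ.map_add, neg_add_cancel, φ.map_zero_apply, τ.left_inv (hτ.mem_source hz θ)]

/-- The slice map for time `-t` is a left inverse. This is available on the closed disc only, so at
the boundary the chain rule is applied to derivatives within the disc, which are unique there. -/
theorem det_fderiv_sliceMap_ne_zero (hφ : IsSmoothFlow φ) (hτ : IsContractionTube φ γ τ) {t : ℝ}
    (ht : 0 ≤ t) (θ : Circle) {z : ℂ} (hz : ‖z‖ ≤ 1) :
    (fderiv ℝ (sliceMap φ τ t θ) z).det ≠ 0 := by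
  obtain ⟨h1, h2⟩ := hτ.flow_tube ht θ hz
  have hf := ((hτ.contDiffAt_sliceMap_right hφ (hτ.mem_source hz θ)
    (hτ.flow_mem_target ht θ hz)).differentiableAt (by simp)).hasFDerivAt
  have hback : φ (-t) (τ (sliceMap φ τ t θ z, phase φ τ t θ)) = τ (z, θ) := by
    rw [← h1, ← φ.map_add, neg_add_cancel, φ.map_zero_apply]
  have hg := ((hτ.contDiffAt_sliceMap_right hφ (t := -t) (hτ.mem_source h2 (phase φ τ t θ))
    (by rw [hback]; exact τ.map_source (hτ.mem_source hz θ))).differentiableAt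
      (by simp)).hasFDerivAt
  have hz' : z ∈ closedBall (0 : ℂ) 1 := mem_closedBall_zero_iff.2 hz
  have hcomp := ((hg.comp z hf).hasFDerivWithinAt (s := closedBall (0 : ℂ) 1)).congr
    (f₁ := id) (fun w hw => (hτ.sliceMap_neg_sliceMap ht θ (mem_closedBall_zero_iff.1 hw)).symm)
    (hτ.sliceMap_neg_sliceMap ht θ hz).symm
  have huniq : UniqueDiffWithinAt ℝ (closedBall (0 : ℂ) 1) z :=
    uniqueDiffOn_convex (convex_closedBall 0 1)
      ⟨0, ball_subset_interior_closedBall (mem_ball_self one_pos)⟩ z hz'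
  have heq := huniq.eq hcomp (hasFDerivWithinAt_id z _)
  have hdet := congrArg (fun A : ℂ →L[ℝ] ℂ => LinearMap.det (A : ℂ →ₗ[ℝ] ℂ)) heq
  exact right_ne_zero_of_mul_eq_one ((LinearMap.det_comp _ _).symm.trans
    (hdet.trans LinearMap.det_id))

/-- The determinant depends continuously on the time, never vanishes, and is `1` at time `0`. -/
theorem det_fderiv_sliceMap_pos (hφ : IsSmoothFlow φ) (hτ : IsContractionTube φ γ τ) {t : ℝ}
    (ht : 0 ≤ t) (θ : Circle) {z : ℂ} (hz : ‖z‖ ≤ 1) :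
    0 < (fderiv ℝ (sliceMap φ τ t θ) z).det := by
  have hsrc := hτ.mem_source hz θ
  have hcont : ContinuousOn (fun s : ℝ => (fderiv ℝ (sliceMap φ τ s θ) z).det) (Icc 0 t) := by
    intro s hs
    have hF := hτ.contDiffAt_sliceMap hφ hsrc (hτ.flow_mem_target hs.1 θ hz)
    have h1 : ContinuousAt (fderiv ℝ fun x : ℝ × ℂ => sliceMap φ τ x.1 θ x.2) (s, z) :=
      (hF.fderiv_right (m := 0) (by simp)).continuousAt
    have h2 : ContinuousAt (fun s : ℝ => (fderiv ℝ (fun x : ℝ × ℂ => sliceMap φ τ x.1 θ x.2)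
        (s, z)).comp (ContinuousLinearMap.inr ℝ ℝ ℂ)) s :=
      (ContinuousAt.comp (f := fun s : ℝ => (s, z)) h1 (by fun_prop)).clm_comp
        continuousAt_const
    have h3 := (ContinuousLinearMap.continuous_det (𝕜 := ℝ) (E := ℂ)).continuousAt.comp h2
    refine (h3.continuousWithinAt (s := Icc 0 t)).congr (fun r hr => ?_) ?_
    all_goals
      simp only [Function.comp]
      refine congrArg ContinuousLinearMap.det ?_
      refine HasFDerivAt.fderiv ?_
      refine HasFDerivAt.comp (g := fun x : ℝ × ℂ => sliceMap φ τ x.1 θ x.2) z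
        ((hτ.contDiffAt_sliceMap hφ hsrc (hτ.flow_mem_target ?_ θ hz)).differentiableAt
          (by simp)).hasFDerivAt (hasFDerivAt_prodMk_right _ _)
    · exact hr.1
    · exact hs.1
  have h0 : (fderiv ℝ (sliceMap φ τ 0 θ) z).det = 1 := by
    have hev : sliceMap φ τ 0 θ =ᶠ[𝓝 z] id := by
      have hc : ContinuousAt (fun w : ℂ => (w, θ)) z := by fun_prop
      filter_upwards [hc.eventually (τ.open_source.mem_nhds hsrc)] with w hw
      simp only [sliceMap, φ.map_zero_apply, τ.left_inv hw, id]
    rw [hev.fderiv_eq, fderiv_id]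
    exact LinearMap.det_id
  by_contra hneg
  obtain ⟨s, hs, hs0⟩ := intermediate_value_Icc' ht hcont ⟨not_lt.1 hneg, by
    change 0 ≤ (fderiv ℝ (sliceMap φ τ 0 θ) z).det
    rw [h0]; exact zero_le_one⟩
  exact hτ.det_fderiv_sliceMap_ne_zero hφ hs.1 θ hz hs0

/-- The return maps of the tube extend to smooth maps of the plane. -/
theorem exists_isDiscEmbedding_sliceMap (hφ : IsSmoothFlow φ) (hγ : γ ∈ closedOrbits F φ)
    (hτ : IsContractionTube φ γ τ) {t : ℝ} (ht : 0 < t) (θ : Circle) :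
    ∃ R : ℂ → ℂ, IsDiscEmbedding R ∧ EqOn R (sliceMap φ τ t θ) (closedBall 0 1) := by
  have hc : ContinuousOn (fun w : ℂ => φ t (τ (w, θ))) {w | (w, θ) ∈ τ.source} := fun w hw =>
    ((φ.continuous continuous_const continuous_id).continuousAt.comp
      (hτ.contMDiffAt_tube_left hw).continuousAt).continuousWithinAt
  have hopen : IsOpen {w : ℂ | (w, θ) ∈ τ.source} :=
    τ.open_source.preimage (by fun_prop : Continuous fun w : ℂ => (w, θ))
  obtain ⟨R, hR, hev⟩ := exists_contDiff_eventuallyEq (R := sliceMap φ τ t θ)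
    (hc.isOpen_inter_preimage hopen τ.open_target)
    (fun w hw => ⟨hτ.mem_source (mem_closedBall_zero_iff.1 hw) θ,
      hτ.flow_mem_target ht.le θ (mem_closedBall_zero_iff.1 hw)⟩)
    (fun w hw => hτ.contDiffAt_sliceMap_right hφ hw.1 hw.2)
  have heq : EqOn R (sliceMap φ τ t θ) (closedBall 0 1) := fun z hz => (hev z hz).self_of_nhds
  refine ⟨R, ⟨hR, fun z hz w hw h => ?_, fun z hz => ?_, fun z hz => ?_⟩, heq⟩
  · rw [heq hz, heq hw] at h
    rw [← hτ.sliceMap_neg_sliceMap ht.le θ (mem_closedBall_zero_iff.1 hz), h,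
      hτ.sliceMap_neg_sliceMap ht.le θ (mem_closedBall_zero_iff.1 hw)]
  · rw [heq hz, mem_ball_zero_iff]
    exact hτ.norm_sliceMap_lt_one hγ ht θ (mem_closedBall_zero_iff.1 hz)
  · rw [(hev z hz).fderiv_eq]
    exact hτ.det_fderiv_sliceMap_pos hφ ht.le θ (mem_closedBall_zero_iff.1 hz)

end IsContractionTube

/-! ### Inserting an isotopy into the flow along the tube. -/

namespace DiscIsotopy

/-- The motion of the disc from time `s` to time `t` of an isotopy. -/
def motion (G : DiscIsotopy) (s t : ℝ) (z : ℂ) : ℂ := G.toFun t (G.invFun s z)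

variable (G : DiscIsotopy)

theorem toFun_mem_ball (s : ℝ) {z : ℂ} (hz : z ∈ ball (0 : ℂ) 1) :
    G.toFun s z ∈ ball (0 : ℂ) 1 := by
  by_contra hout
  rw [mem_ball_zero_iff, not_lt] at hout
  have h1 := G.support_inv s _ (G.radius_lt_one.le.trans hout)
  rw [G.left_inv] at h1
  rw [← h1, ← not_lt] at hout
  exact hout (mem_ball_zero_iff.1 hz)

theorem invFun_mem_ball (s : ℝ) {z : ℂ} (hz : z ∈ ball (0 : ℂ) 1) :
    G.invFun s z ∈ ball (0 : ℂ) 1 := by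
  by_contra hout
  rw [mem_ball_zero_iff, not_lt] at hout
  have h1 := G.support s _ (G.radius_lt_one.le.trans hout)
  rw [G.right_inv] at h1
  rw [← h1, ← not_lt] at hout
  exact hout (mem_ball_zero_iff.1 hz)

theorem motion_mem_ball (s t : ℝ) {z : ℂ} (hz : z ∈ ball (0 : ℂ) 1) :
    G.motion s t z ∈ ball (0 : ℂ) 1 :=
  G.toFun_mem_ball t (G.invFun_mem_ball s hz)

theorem motion_self (s : ℝ) (z : ℂ) : G.motion s s z = z := G.right_inv s z

theorem motion_motion (s t u : ℝ) (z : ℂ) : G.motion t u (G.motion s t z) = G.motion s u z := by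
  simp only [motion, G.left_inv]

theorem motion_of_radius_le (s t : ℝ) {z : ℂ} (hz : G.radius ≤ ‖z‖) : G.motion s t z = z := by
  rw [motion, G.support_inv s z hz, G.support t z hz]

theorem motion_of_nonpos {s t : ℝ} (hs : s ≤ 0) (ht : t ≤ 0) (z : ℂ) : G.motion s t z = z := by
  rw [motion, G.of_nonpos t ht, ← G.of_nonpos s hs (G.invFun s z), G.right_inv]

theorem motion_of_one_le {s t : ℝ} (hs : 1 ≤ s) (ht : 1 ≤ t) (z : ℂ) : G.motion s t z = z := by
  rw [motion, G.of_one_le t ht, ← G.of_one_le s hs, G.right_inv]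

theorem motion_nonpos_one_le {s t : ℝ} (hs : s ≤ 0) (ht : 1 ≤ t) (z : ℂ) :
    G.motion s t z = G.toFun 1 z := by
  rw [← G.motion_motion s 0 t, G.motion_of_nonpos hs le_rfl, ← G.motion_motion 0 1 t,
    G.motion_of_one_le le_rfl ht]
  have h1 : G.invFun 0 z = z := by
    conv_lhs => rw [← G.of_nonpos 0 le_rfl z]
    exact G.left_inv 0 z
  rw [motion, h1]

theorem contDiff_motion : ContDiff ℝ ∞ fun x : ℝ × ℝ × ℂ => G.motion x.1 x.2.1 x.2.2 :=
  G.contDiff.comp ((contDiff_fst.comp contDiff_snd).prodMk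
    (G.contDiff_inv.comp (contDiff_fst.prodMk (contDiff_snd.comp contDiff_snd))))

end DiscIsotopy

namespace IsContractionTube

open ComplexFoliation

variable {M : Type*} [TopologicalSpace M] [ChartedSpace (EuclideanSpace ℝ (Fin 3)) M]
  {F : ComplexFoliation M} {φ : Flow ℝ M} {γ : Set M}
  {τ : OpenPartialHomeomorph (ℂ × Circle) M} {T : ℝ} {θ₀ : Circle}

theorem flow_mem_openTube (hγ : γ ∈ closedOrbits F φ) (hτ : IsContractionTube φ γ τ) {s : ℝ}
    (hs : 0 ≤ s) (θ : Circle) {z : ℂ} (hz : z ∈ ball (0 : ℂ) 1) :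
    φ s (τ (z, θ)) ∈ openTube τ ∧ (τ.symm (φ s (τ (z, θ)))).2 = phase φ τ s θ := by
  obtain ⟨z', hz', h⟩ := hτ.flow_slices hγ hs θ hz
  rw [h, hτ.symm_apply hz']
  exact ⟨mem_openTube hz' _, rfl⟩

theorem flow_tube_injective (hγ : γ ∈ closedOrbits F φ) (hτ : IsContractionTube φ γ τ)
    (hT : IsPeriod φ τ T) {s s' : ℝ} {z z' : ℂ} (hz : z ∈ ball (0 : ℂ) 1)
    (hz' : z' ∈ ball (0 : ℂ) 1) (hs : |s - s'| < T)
    (h : φ s (τ (z, θ₀)) = φ s' (τ (z', θ₀))) : s = s' ∧ z = z' := by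
  have h1 : φ (s - s') (τ (z, θ₀)) = τ (z', θ₀) := by
    rw [sub_eq_add_neg, add_comm, φ.map_add, h, ← φ.map_add, neg_add_cancel, φ.map_zero_apply]
  have h2 := hτ.phase_eq_of_flow_eq hγ hz hz' h1
  have h3 : s - s' = 0 := hτ.phase_injOn hγ hT (θ₀ := θ₀) (by simpa using hs)
    (h2.trans (hτ.phase_zero θ₀).symm)
  rw [h3, φ.map_zero_apply] at h1
  have h4 := congrArg τ.symm h1
  rw [hτ.symm_apply hz, hτ.symm_apply hz'] at h4
  exact ⟨sub_eq_zero.1 h3, congrArg Prod.fst h4⟩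

/-- The part of the tube swept out by the open disc over `θ₀` during three quarters of a period. -/
def sweep (φ : Flow ℝ M) (τ : OpenPartialHomeomorph (ℂ × Circle) M) (T : ℝ) (θ₀ : Circle) :
    Set M :=
  {p | ∃ s ∈ Ioo 0 (3 * T / 4), ∃ z ∈ ball (0 : ℂ) 1, φ s (τ (z, θ₀)) = p}

theorem sweep_subset_openTube (hγ : γ ∈ closedOrbits F φ) (hτ : IsContractionTube φ γ τ) :
    sweep φ τ T θ₀ ⊆ openTube τ := by
  rintro _ ⟨s, hs, z, hz, rfl⟩
  exact (hτ.flow_mem_openTube hγ hs.1.le θ₀ hz).1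

/-- The time since an orbit in the tube has left the disc over `θ₀`. -/
def age (hγ : γ ∈ closedOrbits F φ) (hτ : IsContractionTube φ γ τ) (hT : IsPeriod φ τ T)
    (θ₀ : Circle) (p : M) : ℝ :=
  hτ.clock hγ hT θ₀ (τ.symm p).2

/-- The point at which an orbit in the tube has left the disc over `θ₀`. -/
def origin (hγ : γ ∈ closedOrbits F φ) (hτ : IsContractionTube φ γ τ) (hT : IsPeriod φ τ T)
    (θ₀ : Circle) (p : M) : ℂ :=
  (τ.symm (φ (-(hτ.age hγ hT θ₀ p)) p)).1

theorem age_flow (hγ : γ ∈ closedOrbits F φ) (hτ : IsContractionTube φ γ τ)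
    (hT : IsPeriod φ τ T) {s : ℝ} (hs : s ∈ Ico 0 T) {z : ℂ} (hz : z ∈ ball (0 : ℂ) 1) :
    hτ.age hγ hT θ₀ (φ s (τ (z, θ₀))) = s := by
  rw [age, (hτ.flow_mem_openTube hγ hs.1 θ₀ hz).2, hτ.clock_phase hγ hT θ₀ hs]

theorem origin_flow (hγ : γ ∈ closedOrbits F φ) (hτ : IsContractionTube φ γ τ)
    (hT : IsPeriod φ τ T) {s : ℝ} (hs : s ∈ Ico 0 T) {z : ℂ} (hz : z ∈ ball (0 : ℂ) 1) :
    hτ.origin hγ hT θ₀ (φ s (τ (z, θ₀))) = z := by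
  rw [origin, hτ.age_flow hγ hT hs hz, ← φ.map_add, neg_add_cancel, φ.map_zero_apply,
    hτ.symm_apply hz]

theorem Ioo_subset_Ico_period (hT : 0 < T) : Ioo 0 (3 * T / 4) ⊆ Ico 0 T :=
  fun s hs => ⟨hs.1.le, by linarith [hs.2]⟩

theorem contMDiffAt_age [T2Space M] [CompactSpace M] (hS : IsFDS F φ) (hγ : γ ∈ closedOrbits F φ)
    (hτ : IsContractionTube φ γ τ) (hT : IsPeriod φ τ T) {s : ℝ} (hs : s ∈ Ioo 0 T) {z : ℂ}
    (hz : z ∈ ball (0 : ℂ) 1) :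
    ContMDiffAt (𝓡 3) 𝓘(ℝ, ℝ) ∞ (hτ.age hγ hT θ₀) (φ s (τ (z, θ₀))) := by
  obtain ⟨z', hz', h⟩ := hτ.flow_slices hγ hs.1.le θ₀ hz
  rw [h]
  refine hτ.contMDiffAt_clock hS hγ hT (fun heq => ?_) hz'
  have h1 := hτ.phase_injOn hγ hT (θ₀ := θ₀) (s := s) (s' := 0)
    (by rw [sub_zero, abs_of_pos hs.1]; exact hs.2) (heq.trans (hτ.phase_zero θ₀).symm)
  exact hs.1.ne' h1

theorem contMDiffAt_origin [T2Space M] [CompactSpace M] (hS : IsFDS F φ)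
    (hγ : γ ∈ closedOrbits F φ) (hτ : IsContractionTube φ γ τ) (hT : IsPeriod φ τ T) {s : ℝ}
    (hs : s ∈ Ioo 0 T) {z : ℂ} (hz : z ∈ ball (0 : ℂ) 1) :
    ContMDiffAt (𝓡 3) 𝓘(ℝ, ℂ) ∞ (hτ.origin hγ hT θ₀) (φ s (τ (z, θ₀))) := by
  set p := φ s (τ (z, θ₀)) with hp
  have h1 : ContMDiffAt (𝓡 3) 𝓘(ℝ, ℝ) ∞ (fun q => -(hτ.age hγ hT θ₀ q)) p :=
    ContMDiffAt.comp (g := fun x : ℝ => -x) (f := hτ.age hγ hT θ₀) p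
      contDiff_neg.contMDiff.contMDiffAt (hτ.contMDiffAt_age hS hγ hT hs hz)
  have h2 : ContMDiffAt (𝓡 3) (𝓡 3) ∞ (fun q => φ (-(hτ.age hγ hT θ₀ q)) q) p :=
    ContMDiffAt.comp (g := fun x : ℝ × M => φ x.1 x.2)
      (f := fun q => (-(hτ.age hγ hT θ₀ q), q)) p hS.smooth.contMDiffAt (h1.prodMk contMDiffAt_id)
  have h3 : φ (-(hτ.age hγ hT θ₀ p)) p = τ (z, θ₀) := by
    rw [hp, hτ.age_flow hγ hT (Ioo_subset_Ico_self hs) hz, ← φ.map_add, neg_add_cancel,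
      φ.map_zero_apply]
  have h4 : ContMDiffAt (𝓡 3) (𝓘(ℝ, ℂ).prod (𝓡 1)) ∞
      (fun q => τ.symm (φ (-(hτ.age hγ hT θ₀ q)) q)) p :=
    ContMDiffAt.comp (g := τ.symm) (f := fun q => φ (-(hτ.age hγ hT θ₀ q)) q) p
      (hτ.smooth_symm.contMDiffAt (τ.open_target.mem_nhds (by
        rw [h3]; exact hτ.openTube_subset_target (mem_openTube hz θ₀)))) h2
  exact contMDiffAt_fst.comp p h4

/-- Belonging to the sweep is more than having a suitable phase, since the flow shrinks the discs:
the orbit followed back by its age must still be in the tube. Both conditions are open, and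
injectivity of the phase shows that the orbit then started over `θ₀`. -/
theorem isOpen_sweep [T2Space M] [CompactSpace M] (hS : IsFDS F φ) (hγ : γ ∈ closedOrbits F φ)
    (hτ : IsContractionTube φ γ τ) (hT : IsPeriod φ τ T) : IsOpen (sweep φ τ T θ₀) := by
  rw [isOpen_iff_mem_nhds]
  rintro _ ⟨s, hs, z, hz, rfl⟩
  have hsT : s ∈ Ioo 0 T := ⟨hs.1, by linarith [hs.2, hT.1]⟩
  have hage := (hτ.contMDiffAt_age (θ₀ := θ₀) hS hγ hT hsT hz).continuousAt
  have hback : ContinuousAt (fun q => φ (-(hτ.age hγ hT θ₀ q)) q) (φ s (τ (z, θ₀))) :=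
    ContinuousAt.comp (g := fun x : ℝ × M => φ x.1 x.2) (f := fun q => (-(hτ.age hγ hT θ₀ q), q))
      hS.smooth.continuous.continuousAt (hage.neg.prodMk continuousAt_id)
  have h1 : hτ.age hγ hT θ₀ (φ s (τ (z, θ₀))) = s :=
    hτ.age_flow hγ hT (Ioo_subset_Ico_self hsT) hz
  have h2 : φ (-(hτ.age hγ hT θ₀ (φ s (τ (z, θ₀))))) (φ s (τ (z, θ₀))) = τ (z, θ₀) := by
    rw [h1, ← φ.map_add, neg_add_cancel, φ.map_zero_apply]
  filter_upwards [hage.eventually (isOpen_Ioo.mem_nhds (by rw [h1]; exact hs)),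
    hback.eventually (hτ.isOpen_openTube.mem_nhds (by
      beta_reduce; rw [h2]; exact mem_openTube hz θ₀)),
    hτ.isOpen_openTube.mem_nhds (hτ.flow_mem_openTube hγ hs.1.le θ₀ hz).1] with q h3 h4 h5
  obtain ⟨h6, h7⟩ := hτ.symm_fst_mem_ball h4
  obtain ⟨h8, h9⟩ := hτ.symm_fst_mem_ball h5
  have h10 : φ (hτ.age hγ hT θ₀ q) (τ (τ.symm (φ (-(hτ.age hγ hT θ₀ q)) q))) = q := by
    rw [show τ (τ.symm (φ (-(hτ.age hγ hT θ₀ q)) q)) = φ (-(hτ.age hγ hT θ₀ q)) q from h7,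
      ← φ.map_add, add_neg_cancel, φ.map_zero_apply]
  have h11 := hτ.phase_eq_of_flow_eq hγ h6 h8 (h10.trans h9.symm)
  have h12 := hτ.phase_clock hγ hT θ₀ (τ.symm q).2
  have h13 := hτ.phase_injective hγ _ (h11.trans h12.symm)
  refine ⟨_, h3, _, h6, ?_⟩
  conv_rhs => rw [← h10]
  exact congrArg (fun θ => φ (hτ.age hγ hT θ₀ q)
    (τ ((τ.symm (φ (-(hτ.age hγ hT θ₀ q)) q)).1, θ))) h13.symm

open Classical in
/-- The flow `φ` for short times, modified by the isotopy `G` while the orbits cross the sweep. -/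
def twist (hγ : γ ∈ closedOrbits F φ) (hτ : IsContractionTube φ γ τ) (hT : IsPeriod φ τ T)
    (θ₀ : Circle) (G : DiscIsotopy) (t : ℝ) (p : M) : M :=
  if p ∈ sweep φ τ T θ₀ then
    φ (hτ.age hγ hT θ₀ p + t) (τ (G.motion (4 * hτ.age hγ hT θ₀ p / T - 1)
      (4 * (hτ.age hγ hT θ₀ p + t) / T - 1) (hτ.origin hγ hT θ₀ p), θ₀))
  else φ t p

variable (G : DiscIsotopy)

theorem twist_of_notMem (hγ : γ ∈ closedOrbits F φ) (hτ : IsContractionTube φ γ τ)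
    (hT : IsPeriod φ τ T) {p : M} (hp : p ∉ sweep φ τ T θ₀) (t : ℝ) :
    hτ.twist hγ hT θ₀ G t p = φ t p := if_neg hp

/-- The isotopy parameter `4 s / T - 1` runs from `0` to `1` for `s` between `T / 4` and `T / 2`.
Near the two ends of the sweep the motion is therefore trivial for `|t| ≤ T / 16`, and one formula
covers the sweep and a margin around it. The margin is such that times in it differ from those of
the sweep by less than `T`. -/
theorem twist_flow (hγ : γ ∈ closedOrbits F φ) (hτ : IsContractionTube φ γ τ)
    (hT : IsPeriod φ τ T) {s t : ℝ} (hs : s ∈ Icc (-(T / 8)) T) (ht : |t| ≤ T / 16) {z : ℂ}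
    (hz : z ∈ ball (0 : ℂ) 1) :
    hτ.twist hγ hT θ₀ G t (φ s (τ (z, θ₀))) =
      φ (s + t) (τ (G.motion (4 * s / T - 1) (4 * (s + t) / T - 1) z, θ₀)) := by
  have hT0 := hT.1
  rw [abs_le] at ht
  by_cases hs' : s ∈ Ioo 0 (3 * T / 4)
  · rw [twist, if_pos ⟨s, hs', z, hz, rfl⟩, hτ.age_flow hγ hT (Ioo_subset_Ico_period hT0 hs') hz,
      hτ.origin_flow hγ hT (Ioo_subset_Ico_period hT0 hs') hz]
  · have hnot : φ s (τ (z, θ₀)) ∉ sweep φ τ T θ₀ := by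
      rintro ⟨s', hs1, z', hz', heq⟩
      refine hs' ((hτ.flow_tube_injective hγ hT hz' hz ?_ heq).1 ▸ hs1)
      rw [abs_lt]
      constructor <;> linarith [hs.1, hs.2, hs1.1, hs1.2]
    rw [twist_of_notMem G hγ hτ hT hnot, add_comm s t, φ.map_add]
    rcases le_or_gt s 0 with h0 | h0
    · rw [G.motion_of_nonpos]
      · rw [sub_nonpos, div_le_one hT0]; linarith
      · rw [sub_nonpos, div_le_one hT0]; linarith
    · have h1 : 3 * T / 4 ≤ s := by
        by_contra hlt
        exact hs' ⟨h0, not_le.1 hlt⟩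
      rw [G.motion_of_one_le]
      · rw [le_sub_iff_add_le, le_div_iff₀ hT0]; linarith
      · rw [le_sub_iff_add_le, le_div_iff₀ hT0]; linarith

theorem twist_zero (hγ : γ ∈ closedOrbits F φ) (hτ : IsContractionTube φ γ τ)
    (hT : IsPeriod φ τ T) (p : M) : hτ.twist hγ hT θ₀ G 0 p = p := by
  by_cases hp : p ∈ sweep φ τ T θ₀
  · obtain ⟨s, hs, z, hz, rfl⟩ := hp
    rw [hτ.twist_flow G hγ hT ⟨by linarith [hs.1, hT.1], by linarith [hs.2, hT.1]⟩
      (by rw [abs_zero]; linarith [hT.1]) hz, add_zero, G.motion_self]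
  · rw [twist_of_notMem G hγ hτ hT hp, φ.map_zero_apply]

/-- Points that can meet the sweep within time `T / 16` are of the form covered by `twist_flow`,
where additivity is that of `φ` and of the motion. For the others only `φ` is involved. -/
theorem twist_add (hγ : γ ∈ closedOrbits F φ) (hτ : IsContractionTube φ γ τ)
    (hT : IsPeriod φ τ T) (s t : ℝ) (hs : |s| < T / 16) (ht : |t| < T / 16)
    (hst : |s + t| < T / 16) (p : M) :
    hτ.twist hγ hT θ₀ G (s + t) p = hτ.twist hγ hT θ₀ G s (hτ.twist hγ hT θ₀ G t p) := by
  have hT0 := hT.1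
  have ht' := abs_lt.1 ht
  by_cases hp : ∃ u ∈ Ioo (-(T / 16)) (13 * T / 16), ∃ z ∈ ball (0 : ℂ) 1, φ u (τ (z, θ₀)) = p
  · obtain ⟨u, hu, z, hz, rfl⟩ := hp
    have hu' : u ∈ Icc (-(T / 8)) T := ⟨by linarith [hu.1], by linarith [hu.2]⟩
    rw [hτ.twist_flow G hγ hT hu' ht.le hz, hτ.twist_flow G hγ hT hu' hst.le hz,
      hτ.twist_flow G hγ hT ⟨by linarith [hu.1], by linarith [hu.2]⟩ hs.le
        (G.motion_mem_ball _ _ hz), G.motion_motion, add_assoc, add_comm t s]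
  · have h1 : p ∉ sweep φ τ T θ₀ := fun ⟨u, hu, z, hz, h⟩ =>
      hp ⟨u, ⟨by linarith [hu.1], by linarith [hu.2]⟩, z, hz, h⟩
    have h2 : φ t p ∉ sweep φ τ T θ₀ := fun ⟨u, hu, z, hz, h⟩ =>
      hp ⟨-t + u, ⟨by linarith [hu.1], by linarith [hu.2]⟩, z, hz, by
        rw [φ.map_add, h, ← φ.map_add, neg_add_cancel, φ.map_zero_apply]⟩
    rw [twist_of_notMem G hγ hτ hT h1, twist_of_notMem G hγ hτ hT h1,
      twist_of_notMem G hγ hτ hT h2, φ.map_add]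

/-- Within time `T / 16` the parameter enters `[0, 1]` only from ages between `T / 4 - T / 16` and
`T / 2 + T / 16`, and points outside the support of `G` do not move. The exceptional set is compact
and lies in the sweep, so the twist is `φ` near every point off the sweep; this gives smoothness
across its boundary. -/
theorem twist_eq_flow (hγ : γ ∈ closedOrbits F φ) (hτ : IsContractionTube φ γ τ)
    (hT : IsPeriod φ τ T) {t : ℝ} (ht : |t| < T / 16) {p : M}
    (hp : p ∉ (fun x : ℝ × ℂ => φ x.1 (τ (x.2, θ₀))) ''
      (Icc (3 * T / 16) (9 * T / 16) ×ˢ closedBall 0 G.radius)) :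
    hτ.twist hγ hT θ₀ G t p = φ t p := by
  have hT0 := hT.1
  by_cases hsw : p ∈ sweep φ τ T θ₀
  · obtain ⟨s, hs, z, hz, rfl⟩ := hsw
    rw [hτ.twist_flow G hγ hT ⟨by linarith [hs.1], by linarith [hs.2]⟩ ht.le hz]
    rw [abs_lt] at ht
    rw [add_comm s t, φ.map_add]
    by_cases hz' : z ∈ closedBall 0 G.radius
    · have hs' : s ∉ Icc (3 * T / 16) (9 * T / 16) := fun hs' => hp ⟨(s, z), ⟨hs', hz'⟩, rfl⟩
      rcases lt_or_ge s (3 * T / 16) with h | h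
      · rw [G.motion_of_nonpos]
        · rw [sub_nonpos, div_le_one hT0]; linarith
        · rw [sub_nonpos, div_le_one hT0]; linarith
      · have h1 : 9 * T / 16 < s := by
          by_contra hle
          exact hs' ⟨h, not_lt.1 hle⟩
        rw [G.motion_of_one_le]
        · rw [le_sub_iff_add_le, le_div_iff₀ hT0]; linarith
        · rw [le_sub_iff_add_le, le_div_iff₀ hT0]; linarith
    · rw [mem_closedBall_zero_iff, not_le] at hz'
      rw [G.motion_of_radius_le _ _ hz'.le]
  · exact twist_of_notMem G hγ hτ hT hsw t

theorem contMDiffAt_twist [T2Space M] [CompactSpace M] (hS : IsFDS F φ)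
    (hγ : γ ∈ closedOrbits F φ) (hτ : IsContractionTube φ γ τ) (hT : IsPeriod φ τ T) (t : ℝ)
    (p : M) (ht : |t| < T / 16) :
    ContMDiffAt (𝓘(ℝ, ℝ).prod (𝓡 3)) (𝓡 3) ∞
      (fun x : ℝ × M => hτ.twist hγ hT θ₀ G x.1 x.2) (t, p) := by
  have hT0 := hT.1
  by_cases hp : p ∈ sweep φ τ T θ₀
  · have hopen := (hτ.isOpen_sweep hS hγ hT).mem_nhds hp
    obtain ⟨s, hs, z, hz, hpz⟩ := hp
    have hsT : s ∈ Ioo 0 T := ⟨hs.1, by linarith [hs.2]⟩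
    have hage : ContMDiffAt (𝓘(ℝ, ℝ).prod (𝓡 3)) 𝓘(ℝ, ℝ) ∞
        (fun x : ℝ × M => hτ.age hγ hT θ₀ x.2) (t, p) :=
      ContMDiffAt.comp (g := hτ.age hγ hT θ₀) (f := Prod.snd) (t, p)
        (hpz ▸ hτ.contMDiffAt_age hS hγ hT hsT hz) contMDiffAt_snd
    have horig : ContMDiffAt (𝓘(ℝ, ℝ).prod (𝓡 3)) 𝓘(ℝ, ℂ) ∞
        (fun x : ℝ × M => hτ.origin hγ hT θ₀ x.2) (t, p) :=
      ContMDiffAt.comp (g := hτ.origin hγ hT θ₀) (f := Prod.snd) (t, p)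
        (hpz ▸ hτ.contMDiffAt_origin hS hγ hT hsT hz) contMDiffAt_snd
    have htime : ContMDiffAt (𝓘(ℝ, ℝ).prod (𝓡 3)) 𝓘(ℝ, ℝ) ∞
        (fun x : ℝ × M => hτ.age hγ hT θ₀ x.2 + x.1) (t, p) := hage.add contMDiffAt_fst
    have hparam : ∀ f : ℝ × M → ℝ, ContMDiffAt (𝓘(ℝ, ℝ).prod (𝓡 3)) 𝓘(ℝ, ℝ) ∞ f (t, p) →
        ContMDiffAt (𝓘(ℝ, ℝ).prod (𝓡 3)) 𝓘(ℝ, ℝ) ∞ (fun x => 4 * f x / T - 1) (t, p) :=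
      fun f hf => ContMDiffAt.comp (g := fun r : ℝ => 4 * r / T - 1) (f := f) (t, p)
        (ContDiff.contMDiff (by fun_prop)).contMDiffAt hf
    have hmot : ContMDiffAt (𝓘(ℝ, ℝ).prod (𝓡 3)) 𝓘(ℝ, ℂ) ∞
        (fun x : ℝ × M => G.motion (4 * hτ.age hγ hT θ₀ x.2 / T - 1)
          (4 * (hτ.age hγ hT θ₀ x.2 + x.1) / T - 1) (hτ.origin hγ hT θ₀ x.2)) (t, p) :=
      ContMDiffAt.comp (I' := 𝓘(ℝ, ℝ × ℝ × ℂ))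
        (g := fun x : ℝ × ℝ × ℂ => G.motion x.1 x.2.1 x.2.2)
        (f := fun x : ℝ × M => (4 * hτ.age hγ hT θ₀ x.2 / T - 1,
          4 * (hτ.age hγ hT θ₀ x.2 + x.1) / T - 1, hτ.origin hγ hT θ₀ x.2)) (t, p)
        G.contDiff_motion.contMDiff.contMDiffAt
        ((hparam _ hage).prodMk_space ((hparam _ htime).prodMk_space horig))
    have hball : hτ.origin hγ hT θ₀ p ∈ ball (0 : ℂ) 1 := by
      rw [← hpz, hτ.origin_flow hγ hT (Ioo_subset_Ico_self hsT) hz]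
      exact hz
    have htube := ContMDiffAt.comp (g := fun w : ℂ => τ (w, θ₀)) (t, p)
      (hτ.contMDiffAt_tube_left (hτ.mem_source
        (mem_ball_zero_iff.1 (G.motion_mem_ball _ _ hball)).le θ₀)) hmot
    have hfl := ContMDiffAt.comp (g := fun x : ℝ × M => φ x.1 x.2) (t, p)
      hS.smooth.contMDiffAt (htime.prodMk htube)
    refine hfl.congr_of_eventuallyEq ?_
    filter_upwards [continuous_snd.continuousAt.eventually hopen] with x hx
    exact if_pos hx
  · refine hS.smooth.contMDiffAt.congr_of_eventuallyEq ?_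
    set C := (fun x : ℝ × ℂ => φ x.1 (τ (x.2, θ₀))) ''
      (Icc (3 * T / 16) (9 * T / 16) ×ˢ closedBall 0 G.radius) with hC
    have hCcomp : IsCompact C := by
      refine (isCompact_Icc.prod (isCompact_closedBall 0 G.radius)).image_of_continuousOn ?_
      rintro ⟨s, z⟩ ⟨-, hz⟩
      have hz1 : ‖z‖ ≤ 1 := (mem_closedBall_zero_iff.1 hz).trans G.radius_lt_one.le
      have h1 : ContinuousAt (fun x : ℝ × ℂ => τ (x.2, θ₀)) (s, z) :=
        ContinuousAt.comp (g := fun w : ℂ => τ (w, θ₀)) (f := Prod.snd)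
          (hτ.continuousAt_tube_left hz1 θ₀) continuousAt_snd
      exact (ContinuousAt.comp (g := fun x : ℝ × M => φ x.1 x.2)
        (f := fun x : ℝ × ℂ => (x.1, τ (x.2, θ₀))) hS.smooth.continuous.continuousAt
        (continuousAt_fst.prodMk h1)).continuousWithinAt
    have hpC : p ∉ C := by
      rintro ⟨⟨s, z⟩, ⟨hs, hz⟩, rfl⟩
      refine hp ⟨s, ⟨by linarith [hs.1], by linarith [hs.2]⟩, z, ?_, rfl⟩
      exact mem_ball_zero_iff.2 ((mem_closedBall_zero_iff.1 hz).trans_lt G.radius_lt_one)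
    have habs : ContinuousAt (fun x : ℝ × M => |x.1|) (t, p) := by fun_prop
    filter_upwards [continuous_snd.continuousAt.eventually
      (hCcomp.isClosed.isOpen_compl.mem_nhds hpC), habs.eventually_lt continuousAt_const ht]
      with x h1 h2
    exact hτ.twist_eq_flow G hγ hT h2 h1

theorem twist_slices (hγ : γ ∈ closedOrbits F φ) (hτ : IsContractionTube φ γ τ)
    (hT : IsPeriod φ τ T) {t : ℝ} (ht : 0 ≤ t) (θ : Circle) {z : ℂ} (hz : z ∈ ball (0 : ℂ) 1) :
    ∃ z' ∈ ball (0 : ℂ) 1, hτ.twist hγ hT θ₀ G t (τ (z, θ)) = τ (z', phase φ τ t θ) := by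
  by_cases hp : τ (z, θ) ∈ sweep φ τ T θ₀
  · have hage : phase φ τ (hτ.age hγ hT θ₀ (τ (z, θ))) θ₀ = θ := by
      rw [age, hτ.symm_apply hz, hτ.phase_clock hγ hT]
    have horig : hτ.origin hγ hT θ₀ (τ (z, θ)) ∈ ball (0 : ℂ) 1 := by
      obtain ⟨s, hs, w, hw, h⟩ := hp
      rw [← h, hτ.origin_flow hγ hT (Ioo_subset_Ico_period hT.1 hs) hw]
      exact hw
    rw [twist, if_pos hp]
    obtain ⟨z', hz', h⟩ := hτ.flow_slices hγ (add_nonneg (hτ.clock_mem hγ hT θ₀ _).1 ht) θ₀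
      (G.motion_mem_ball _ _ horig)
    refine ⟨z', hz', h.trans ?_⟩
    rw [add_comm, hτ.phase_add hγ]
    exact congrArg (fun θ => τ (z', phase φ τ t θ)) hage
  · rw [twist_of_notMem G hγ hτ hT hp]
    exact hτ.flow_slices hγ ht θ hz

theorem twist_iterate_slices (hγ : γ ∈ closedOrbits F φ) (hτ : IsContractionTube φ γ τ)
    (hT : IsPeriod φ τ T) {t : ℝ} (ht : 0 ≤ t) (θ : Circle) {z : ℂ} (hz : z ∈ ball (0 : ℂ) 1)
    (n : ℕ) :
    ∃ z' ∈ ball (0 : ℂ) 1,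
      (hτ.twist hγ hT θ₀ G t)^[n] (τ (z, θ)) = τ (z', phase φ τ (n * t) θ) := by
  induction n with
  | zero => exact ⟨z, hz, by simp [hτ.phase_zero]⟩
  | succ n ih =>
    obtain ⟨w, hw, h⟩ := ih
    obtain ⟨z', hz', h'⟩ := hτ.twist_slices (θ₀ := θ₀) G hγ hT ht (phase φ τ (n * t) θ) hw
    refine ⟨z', hz', ?_⟩
    rw [Function.iterate_succ_apply', h, h', ← hτ.phase_add hγ]
    congr 3
    push_cast
    ring

theorem twist_iterate_disc (hγ : γ ∈ closedOrbits F φ) (hτ : IsContractionTube φ γ τ)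
    (hT : IsPeriod φ τ T) {t : ℝ} (ht0 : 0 ≤ t) (ht : t ≤ T / 16) {z : ℂ}
    (hz : z ∈ ball (0 : ℂ) 1) (n : ℕ) (hn : n * t ≤ T) :
    (hτ.twist hγ hT θ₀ G t)^[n] (τ (z, θ₀)) =
      φ (n * t) (τ (G.motion (-1) (4 * (n * t) / T - 1) z, θ₀)) := by
  have hT0 := hT.1
  induction n with
  | zero => simp [φ.map_zero_apply, G.motion_self]
  | succ n ih =>
    push_cast at hn
    have h1 : (n : ℝ) * t ≤ T := by linarith
    have h2 : (0 : ℝ) ≤ n * t := by positivity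
    rw [Function.iterate_succ_apply', ih h1, hτ.twist_flow G hγ hT ⟨by linarith, h1⟩
      (by rwa [abs_of_nonneg ht0]) (G.motion_mem_ball _ _ hz), G.motion_motion]
    have e1 : (n : ℝ) * t + t = ((n + 1 : ℕ) : ℝ) * t := by push_cast; ring
    rw [e1]

/-- An isotopy of the open disc, performed in the course of one period, changes the flow in the
tube in such a way that its end is composed with the return map. -/
theorem exists_flow_of_discIsotopy [T2Space M] [CompactSpace M] (hS : IsFDS F φ)
    (hγ : γ ∈ closedOrbits F φ) (hτ : IsContractionTube φ γ τ) (hT : IsPeriod φ τ T)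
    (θ₀ : Circle) :
    ∃ φ' : Flow ℝ M, IsSmoothFlow φ' ∧ (∀ p ∉ openTube τ, velocity φ' p = velocity φ p) ∧
      (∀ t : ℝ, 0 ≤ t → ∀ θ : Circle, ∀ z ∈ ball (0 : ℂ) 1,
        ∃ z' ∈ ball (0 : ℂ) 1, φ' t (τ (z, θ)) = τ (z', phase φ τ t θ)) ∧
      ∀ z ∈ ball (0 : ℂ) 1, φ' T (τ (z, θ₀)) = φ T (τ (G.toFun 1 z, θ₀)) := by
  have hT0 := hT.1
  have hε : 0 < T / 16 := by linarith
  obtain ⟨φ', hsm, hφ'⟩ := exists_flow_of_localFlow hε (hτ.twist_zero (θ₀ := θ₀) G hγ hT)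
    (hτ.twist_add G hγ hT) (hτ.contMDiffAt_twist G hS hγ hT)
  refine ⟨φ', hsm, fun p hp => ?_, fun t ht θ z hz => ?_, fun z hz => ?_⟩
  · have hev : (fun t : ℝ => φ' t p) =ᶠ[𝓝 0] fun t => φ t p := by
      filter_upwards [(continuous_abs.continuousAt (x := (0 : ℝ))).eventually_lt
        continuousAt_const (by rw [abs_zero]; exact hε)] with t ht
      rw [hφ' t 1 one_pos (by simpa using ht)]
      simp only [Nat.cast_one, div_one, Function.iterate_one]
      exact twist_of_notMem G hγ hτ hT (fun h => hp (hτ.sweep_subset_openTube hγ h)) t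
    exact congrArg (fun L : ℝ →L[ℝ] EuclideanSpace ℝ (Fin 3) => L 1) hev.mfderiv_eq
  · obtain ⟨n, hn⟩ := exists_nat_gt (t / (T / 16))
    have hn0 : (0 : ℝ) < n := lt_of_le_of_lt (by positivity) hn
    have hlt : t / n < T / 16 := by
      rw [div_lt_iff₀ hn0]
      rw [div_lt_iff₀ hε] at hn
      linarith
    have hnn : 0 ≤ t / n := by positivity
    obtain ⟨z', hz', h⟩ := hτ.twist_iterate_slices (θ₀ := θ₀) G hγ hT hnn θ hz n
    refine ⟨z', hz', ?_⟩
    rw [hφ' t n (by exact_mod_cast hn0) (by rwa [abs_of_nonneg hnn]), h,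
      mul_div_cancel₀ _ hn0.ne']
  -- One period is cut into `17` steps, as the steps must be strictly shorter than `T / 16`. In its
  -- course the isotopy parameter goes from `-1` to `3`, so the whole isotopy is performed.
  · have hlt : T / (17 : ℕ) < T / 16 := by push_cast; linarith
    have hnn : 0 ≤ T / (17 : ℕ) := by positivity
    have hmul : ((17 : ℕ) : ℝ) * (T / (17 : ℕ)) = T := by push_cast; ring
    rw [hφ' T 17 (by norm_num) (by rwa [abs_of_nonneg hnn]),
      hτ.twist_iterate_disc G hγ hT hnn hlt.le hz 17 hmul.le, hmul,
      G.motion_nonpos_one_le (by norm_num)]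
    rw [mul_div_assoc, div_self hT0.ne']
    norm_num

/-- The flow in the tube can be replaced by the suspension of any orientation-preserving embedding
of the disc. -/
theorem exists_isSuspensionReplacement [T2Space M] [CompactSpace M] (hS : IsFDS F φ)
    (hγ : γ ∈ closedOrbits F φ) (hτ : IsContractionTube φ γ τ) {h : ℂ → ℂ}
    (hh : IsDiscEmbedding h) : ∃ φ' : Flow ℝ M, IsSuspensionReplacement φ τ h φ' := by
  obtain ⟨T, hT⟩ := hτ.exists_isPeriod hγ
  have hT0 := hT.1
  let θ₀ : Circle := 1
  obtain ⟨R, hR, hReq⟩ := hτ.exists_isDiscEmbedding_sliceMap hS.smooth hγ hT0 θ₀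
  obtain ⟨G, hG⟩ := hR.isotopic hh
  obtain ⟨φ', hsm, hout, hsl, hret⟩ := hτ.exists_flow_of_discIsotopy G hS hγ hT θ₀
  -- The new return map is `R ∘ G₁` and `h = G₁ ∘ R`, so `c = G₁⁻¹` satisfies `(R ∘ G₁) ∘ c = R = c
  -- ∘ h`.
  let c : OpenPartialHomeomorph ℂ ℂ :=
    { toFun := G.invFun 1
      invFun := G.toFun 1
      source := ball 0 1
      target := ball 0 1
      map_source' := fun z hz => G.invFun_mem_ball 1 hz
      map_target' := fun z hz => G.toFun_mem_ball 1 hz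
      left_inv' := fun z _ => G.right_inv 1 z
      right_inv' := fun z _ => G.left_inv 1 z
      open_source := isOpen_ball
      open_target := isOpen_ball
      continuousOn_toFun :=
        (G.contDiff_inv.continuous.comp (by fun_prop : Continuous fun z : ℂ => ((1 : ℝ), z))
          ).continuousOn
      continuousOn_invFun :=
        (G.contDiff.continuous.comp (by fun_prop : Continuous fun z : ℂ => ((1 : ℝ), z))
          ).continuousOn }
  refine ⟨φ', hsm, hout, hsl, θ₀, T, c, hT0, hT.phase_eq θ₀, fun t ht heq => ?_, rfl, rfl,
    (G.contDiff_inv.comp (contDiff_const.prodMk contDiff_id)).contDiffOn,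
    (G.contDiff.comp (contDiff_const.prodMk contDiff_id)).contDiffOn, fun z hz => ?_⟩
  · have h1 := hτ.phase_injOn hγ hT (θ₀ := θ₀) (s := t) (s' := 0)
      (by rw [sub_zero, abs_of_pos ht.1]; exact ht.2) (heq.trans (hτ.phase_zero θ₀).symm)
    exact ht.1.ne' h1
  · have hz' : ‖z‖ ≤ 1 := (mem_ball_zero_iff.1 hz).le
    change φ' T (τ (G.invFun 1 z, θ₀)) = τ (G.invFun 1 (h z), θ₀)
    rw [hret _ (G.invFun_mem_ball 1 hz), G.right_inv, (hτ.flow_tube hT0.le θ₀ hz').1,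
      hT.phase_eq, hG z (ball_subset_closedBall hz), G.left_inv,
      hReq (ball_subset_closedBall hz)]

end IsContractionTube

end

theorem lemma3p2 {M : Type*} [TopologicalSpace M] [T2Space M] [CompactSpace M] [ConnectedSpace M]
    [ChartedSpace (EuclideanSpace ℝ (Fin 3)) M] [IsManifold (𝓡 3) ∞ M]
    (F : ComplexFoliation M) (φ : Flow ℝ M) (hS : IsFDS F φ)
    (γ : Set M) (hγ : γ ∈ closedOrbits F φ)
    (τ : OpenPartialHomeomorph (ℂ × Circle) M) (hτ : IsContractionTube φ γ τ)
    (h : ℂ → ℂ) (hh : IsHorseshoe h) :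
    (∃ φ' : Flow ℝ M, IsSuspensionReplacement φ τ h φ') ∧
    ∀ φ' : Flow ℝ M, IsSuspensionReplacement φ τ h φ' →
      IsFDS F φ' ∧
      ({γ' ∈ closedOrbits F φ' | γ' ⊆ openTube τ}.Countable ∧
        {γ' ∈ closedOrbits F φ' | γ' ⊆ openTube τ}.Infinite) ∧
      (transverseRegion F φ' = transverseRegion F φ ∧
        (∃ η : ∀ p : M, TangentSpace (𝓡 3) p →L[ℝ] ℝ,
          IsCanonicalForm F φ η ∧ IsCanonicalForm F φ' η) ∧
        ∀ η η' : ∀ p : M, TangentSpace (𝓡 3) p →L[ℝ] ℝ,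
          IsCanonicalForm F φ η → IsCanonicalForm F φ' η' →
            ∀ p ∈ transverseRegion F φ, η p = η' p) := by
  refine ⟨hτ.exists_isSuspensionReplacement hS hγ
    ⟨hh.smooth, hh.injOn, hh.mapsTo, hh.orientation⟩, fun φ' h' => ?_⟩
  have hv := h'.heightDeriv_velocity_eq hS hγ hτ
  have hη := ComplexFoliation.isCanonicalForm_canonicalForm hS
  exact ⟨hS.of_heightDeriv_velocity_eq h'.smooth hv,
    h'.countable_infinite_closedOrbits hS hγ hτ hh,
    ComplexFoliation.transverseRegion_eq hS.smooth h'.smooth hS.leaf_to_leaf hv,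
    ⟨_, hη, hη.of_heightDeriv_velocity_eq hS h'.smooth hv⟩,
    fun η η' h1 h2 p hp => h1.eq_of_heightDeriv_velocity_eq hS h'.smooth hv h2 hp⟩
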